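/- Let $V=\mathbb R^3$ with standard basis $e_1,e_2,e_3$ and dual basis $\lambda^1,\lambda^2,\lambda^3$, let $G=\mathrm{GL}_3(\mathbb R)$, and let $W=\Lambda^2V^*\otimes V$ be the space of alternating bilinear maps $C:V\times V\to V$, with the action $(g.C)(a,b)=g\,C(g^{-1}a,g^{-1}b)$. Let $X\subseteq W$ be the set of those $C$ that satisfy the Jacobi identity, and $W_1\subseteq W$ the $6$-dimensional submodule of unimodular $C$ ($\mathrm{tr}(C(a,\cdot))=0$ for all $a$). For a symmetric matrix $A$ and $\nu\in V^*$ let $C_{A,\nu}(a,b)=A(a\times b)+\nu(a)b-\nu(b)a$; write also $j(\nu)=C_{0,\nu}$. The Bianchi classes have the representatives $C_{A,\nu}$ with $(A,\nu)$ equal to: $I$: $(0,0)$; $II$: $(\mathrm{diag}(1,0,0),0)$; $IV$: $(\mathrm{diag}(1,0,0),\lambda^3)$; $V$: $(0,\lambda^3)$; $VI_h$ ($h\le 0$): $(\mathrm{diag}(1,-1,0),h\lambda^3)$; $VII_h$ ($h\ge0$): $(\mathrm{diag}(1,1,0),h\lambda^3)$; $VIII$: $(\mathrm{diag}(1,1,-1),0)$;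 $IX$: $(\mathrm{diag}(1,1,1),0)$. Let $B_t\subseteq W$ be the $G$-orbit of the representative of class $t$ and $H_t\subseteq G$ its automorphism group. For $S=\mathrm{diag}(1,-1)$ or $S=\mathbf 1_2$ let $\mathrm{CO}(S)=\{g_1\in\mathrm{GL}_2(\mathbb R):\exists\lambda\ne0,\ g_1Sg_1^T=\lambda S\}$, that is $\mathrm{CO}(1,1)$ and $\mathrm{CO}(2)$ respectively, and let $\mathrm{CO}^+(S)=\{g_1\in \mathrm{GL}_2(\mathbb R):g_1Sg_1^T=\det(g_1)S\}$. Then: 1. All representatives lie in $X$, and the stabilizer of any $C\in W$ is the automorphism group of $(V,C)$. The automorphism groups are: $H_I=G$; $H_{II}=\left\{\begin{pmatrix}\det g_2&h\\0&g_2\end{pmatrix}:g_2\in\mathrm{GL}_2(\mathbb R),\,h\in\mathbb R^2\right\}$; $H_{VI_0}=\left\{\begin{pmatrix}g_1&h\\0&\lambda/\det g_1\end{pmatrix}: g_1\in\mathrm{CO}(1,1),\ h\in\mathbb R^2\right\}$, where $\lambda$ is the conformal factor of $g_1$, and $\lambda/\det g_1\in\{-1,1\}$; $H_{VII_0}=\left\{\begin{pmatrix}g_1&h\\0&|\det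 g_1|/\det g_1\end{pmatrix}: g_1\in\mathrm{CO}(2),\ h\in\mathbb R^2\right\}$; $H_{VIII}=\mathrm{SO}(2,1)=\{g: g\,\mathrm{diag}(1,1,-1)g^T=\mathrm{diag}(1,1,-1),\ \det g=1\}$; $H_{IX}=\mathrm{SO}(3)$; $H_V=\left\{\begin{pmatrix}g_1&h\\0&1\end{pmatrix}:g_1\in\mathrm{GL}_2(\mathbb R),h\in\mathbb R^2\right\}\cong\mathrm{GL}_2(\mathbb R)\ltimes\mathbb R^2\cong\mathrm{Aff}_2(\mathbb R)$; $H_{IV}=\left\{\begin{pmatrix}\mu&h_1&h_2\\0&\mu&h_3\\0&0&1\end{pmatrix}:\mu\ne0,\ h_1,h_2,h_3\in\mathbb R\right\}$; $H_{VI_h}=\left\{\begin{pmatrix}g_1&h'\\0&1\end{pmatrix}:g_1\in\mathrm{CO}^+(S),h'\in\mathbb R^2\right\}\cong\mathrm{CO}^+(S)\ltimes\mathbb R^2$ with $S=\mathrm{diag}(1,-1)$ for every $h<0$, a subgroup of index $2$ in $H_{VI_0}$; and in the same way with $S=\mathbf 1_2$ for $H_{VII_h}$, $h>0$, a subgroup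 of index $2$ in $H_{VII_0}$. 2. Each $B_t$ is an embedded smooth submanifold of $W$ of dimension $0$ for $I$; $3$ for $II,V$; $5$ for $IV$, $VI_h$ ($h\le0$), $VII_h$ ($h\ge0$); $6$ for $VIII,IX$; and $H_t$ is an embedded submanifold of $\mathbb R^{3\times3}$ of dimension $9-\dim B_t$. The union $\bigcup_{h>0}B_{VII_h}$ is a $6$-dimensional embedded submanifold. 3. The representation $W'=\Lambda^3V^*\otimes S^2V$ of $G$ is irreducible. 4. $0$ is the only fixed point of $G$ in $W$ and $B_I=\{0\}$. $W_1$ is the union of $B_I,B_{II},B_{VI_0},B_{VII_0},B_{VIII},B_{IX}$. Each of these six is invariant under multiplication by nonzero reals; $B_{VIII},B_{IX}$ are open in $W_1$; and $B_{VI_0},B_{VII_0}$ are open in $W_1\setminus(B_{VIII}\cup B_{IX})$. 5. $B_s\subseteq\overline{B_t}$ if and only if $s=t$, or $s=I$, or $s=II$ and $t\ne I,V$, or $(s,t)$ is one of $(V,IV)$, $(VI_0,VIII)$, $(VII_0,VIII)$, $(VII_0,IX)$; and $\overline{B_t}$ is the union of the $B_s$ that it contains. In particular, among the six unimodular classes,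 an orbit lies in the closure of a different one if and only if it has smaller dimension, with the single exception that $B_{VI_0}\not\subseteq\overline{B_{IX}}$. Moreover $\overline{B_V}=j(V^*)$, $$\overline{\bigcup_{h<0}B_{VI_h}}=\bigcup_{h\le0}B_{VI_h}\cup B_{IV}\cup B_V\cup B_{II}\cup B_I,\qquad \overline{\bigcup_{h>0}B_{VII_h}}=\bigcup_{h\ge0}B_{VII_h}\cup B_{IV}\cup B_V\cup B_{II}\cup B_I .$$ 6. Over $\mathbb C$, for the same action of $\mathrm{GL}_3(\mathbb C)$ on $\Lambda^2(\mathbb C^3)^*\otimes\mathbb C^3$, let $B_r$ ($r=0,1,2,3$) be the orbit of $C_{A,0}$ with $A=\mathrm{diag}(1,\dots,1,0,\dots,0)$ of rank $r$ (the abelian, nilpotent, solvable and simple unimodular algebra). It is an embedded complex submanifold of complex dimension $0,3,5,6$ respectively; $B_3$ is open and dense in the space of unimodular brackets; $B_s\subseteq\overline{B_r}$ if and only if $s\le r$, and $\overline{B_r}=\bigcup_{s\le r}B_s$; and $\Lambda^3V^*\otimes S^2V$ is irreducible for $V=\mathbb C^3$. -/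

import Mathlib

open scoped Matrix ContDiff

noncomputable section

namespace Bianchi

/-- The fixed three-dimensional vector space `V = 𝕜³`. -/
abbrev V (𝕜 : Type) : Type := Fin 3 → 𝕜

/-- `W = Λ²V* ⊗ V = Alt₂(V, V)`: the alternating bilinear maps `V × V → V`
(all bilinear maps are continuous; the operator norm gives the usual topology). -/
abbrev W (𝕜 : Type) [RCLike 𝕜] : Type := V 𝕜 [⋀^Fin 2]→L[𝕜] V 𝕜

section Defs

variable {𝕜 : Type} [RCLike 𝕜]

/-- The value `C(a, b)`. -/
def br (C : W 𝕜) (a b : V 𝕜) : V 𝕜 := C ![a, b]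

/-- `ad_a = C(a, ·)`. -/
def ad (C : W 𝕜) (a : V 𝕜) : V 𝕜 →ₗ[𝕜] V 𝕜 where
  toFun b := br C a b
  map_add' x y := by
    have e : ∀ z : V 𝕜, Function.update ![a, 0] 1 z = ![a, z] := by
      intro z
      ext i : 1
      fin_cases i <;> simp
    have h := C.map_update_add ![a, 0] 1 x y
    simp only [e] at h
    exact h
  map_smul' c x := by
    have e : ∀ z : V 𝕜, Function.update ![a, 0] 1 z = ![a, z] := by
      intro z
      ext i : 1
      fin_cases i <;> simp
    have h := C.map_update_smul ![a, 0] 1 c x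
    simp only [e] at h
    exact h

/-- The alternating bracket given by a bilinear formula. -/
def mkW (f : V 𝕜 →ₗ[𝕜] V 𝕜 →ₗ[𝕜] V 𝕜) (hf : ∀ a, f a a = 0) : W 𝕜 where
  toFun v := f (v 0) (v 1)
  map_update_add' := by
    intro _ v i x y
    fin_cases i <;> simp
  map_update_smul' := by
    intro _ v i c x
    fin_cases i <;> simp
  map_eq_zero_of_eq' := by
    intro v i k h hik
    fin_cases i <;> fin_cases k <;> simp_all
  cont := (f.toContinuousBilinearMap.continuous.comp (continuous_apply 0)).clm_apply
    (continuous_apply 1)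

theorem br_mkW (f : V 𝕜 →ₗ[𝕜] V 𝕜 →ₗ[𝕜] V 𝕜) (hf : ∀ a, f a a = 0) (a b : V 𝕜) :
    br (mkW f hf) a b = f a b := rfl

theorem ext_br {C D : W 𝕜} (h : ∀ a b, br C a b = br D a b) : C = D := by
  refine ContinuousAlternatingMap.ext fun v => ?_
  have hv : v = ![v 0, v 1] := by
    ext i : 1
    fin_cases i <;> rfl
  rw [hv]
  exact h _ _

/-- The action `(g.C)(a, b) = g C(g⁻¹a, g⁻¹b)` of `GL(V)` on `W`. -/
def act (g : GL (Fin 3) 𝕜) (C : W 𝕜) : W 𝕜 :=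
  (Matrix.mulVecLin (g : Matrix (Fin 3) (Fin 3) 𝕜)).toContinuousLinearMap.compContinuousAlternatingMap
    (C.compContinuousLinearMap
      (Matrix.mulVecLin ((g⁻¹ : GL (Fin 3) 𝕜) : Matrix _ _ 𝕜)).toContinuousLinearMap)

theorem act_apply (g : GL (Fin 3) 𝕜) (C : W 𝕜) (v : Fin 2 → V 𝕜) :
    act g C v = (g : Matrix _ _ 𝕜) *ᵥ
      C (fun i => ((g⁻¹ : GL (Fin 3) 𝕜) : Matrix _ _ 𝕜) *ᵥ v i) := rfl

theorem br_act (g : GL (Fin 3) 𝕜) (C : W 𝕜) (a b : V 𝕜) :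
    br (act g C) a b = (g : Matrix _ _ 𝕜) *ᵥ
      br C (((g⁻¹ : GL (Fin 3) 𝕜) : Matrix _ _ 𝕜) *ᵥ a)
        (((g⁻¹ : GL (Fin 3) 𝕜) : Matrix _ _ 𝕜) *ᵥ b) := by
  refine (act_apply g C ![a, b]).trans ?_
  unfold br
  congr 2
  ext i : 1
  fin_cases i <;> rfl

instance : DistribMulAction (GL (Fin 3) 𝕜) (W 𝕜) where
  smul := act
  one_smul C := by
    refine ContinuousAlternatingMap.ext fun v => (act_apply 1 C v).trans ?_
    simp
  mul_smul g h C := by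
    refine ContinuousAlternatingMap.ext fun v => (act_apply (g * h) C v).trans
      (Eq.trans ?_ (act_apply g (act h C) v).symm)
    simp only [act_apply, mul_inv_rev, Units.val_mul, Matrix.mulVec_mulVec]
  smul_zero g := by
    refine ContinuousAlternatingMap.ext fun v => (act_apply g 0 v).trans ?_
    simp
  smul_add g C D := by
    refine ContinuousAlternatingMap.ext fun v => (act_apply g (C + D) v).trans ?_
    exact Matrix.mulVec_add _ _ _

theorem br_smul (g : GL (Fin 3) 𝕜) (C : W 𝕜) (a b : V 𝕜) :
    br (g • C) a b = (g : Matrix _ _ 𝕜) *ᵥ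
      br C (((g⁻¹ : GL (Fin 3) 𝕜) : Matrix _ _ 𝕜) *ᵥ a)
        (((g⁻¹ : GL (Fin 3) 𝕜) : Matrix _ _ 𝕜) *ᵥ b) := br_act g C a b

/-- The Lie variety `X ⊆ W`: the brackets that satisfy the Jacobi identity. -/
def lieVariety (𝕜 : Type) [RCLike 𝕜] : Set (W 𝕜) :=
  {C | ∀ a b c, br C (br C a b) c + br C (br C b c) a + br C (br C c a) b = 0}

/-- The submodule `W₁ = ker tr ⊆ W` of unimodular brackets: `tr(ad_a) = 0` for all `a`. -/
def unimodular (𝕜 : Type) [RCLike 𝕜] : Submodule 𝕜 (W 𝕜) where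
  carrier := {C | ∀ a, LinearMap.trace 𝕜 (V 𝕜) (ad C a) = 0}
  add_mem' := by
    intro C D hC hD a
    exact (map_add (LinearMap.trace 𝕜 (V 𝕜)) (ad C a) (ad D a)).trans
      (by rw [hC a, hD a, add_zero])
  zero_mem' := by
    intro a
    exact map_zero (LinearMap.trace 𝕜 (V 𝕜))
  smul_mem' := by
    intro c C hC a
    exact (map_smul (LinearMap.trace 𝕜 (V 𝕜)) c (ad C a)).trans
      (by rw [hC a, smul_zero])

/-- The automorphism group of the algebra `(V, C)`. -/
def autGroup (C : W 𝕜) : Subgroup (GL (Fin 3) 𝕜) where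
  carrier := {g | ∀ a b, (g : Matrix _ _ 𝕜) *ᵥ br C a b =
    br C ((g : Matrix _ _ 𝕜) *ᵥ a) ((g : Matrix _ _ 𝕜) *ᵥ b)}
  one_mem' := by
    intro a b
    simp
  mul_mem' := by
    intro g h hg hh a b
    simp only [Units.val_mul, ← Matrix.mulVec_mulVec]
    rw [hh a b, hg]
  inv_mem' := by
    intro g hg a b
    have h := hg (((g⁻¹ : GL (Fin 3) 𝕜) : Matrix _ _ 𝕜) *ᵥ a)
      (((g⁻¹ : GL (Fin 3) 𝕜) : Matrix _ _ 𝕜) *ᵥ b)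
    have e : (g : Matrix (Fin 3) (Fin 3) 𝕜) * ((g⁻¹ : GL (Fin 3) 𝕜) : Matrix _ _ 𝕜) = 1 := by
      rw [← Units.val_mul, mul_inv_cancel, Units.val_one]
    have e' : ((g⁻¹ : GL (Fin 3) 𝕜) : Matrix _ _ 𝕜) * (g : Matrix (Fin 3) (Fin 3) 𝕜) = 1 := by
      rw [← Units.val_mul, inv_mul_cancel, Units.val_one]
    simp only [Matrix.mulVec_mulVec, e, Matrix.one_mulVec] at h
    rw [← h, Matrix.mulVec_mulVec, e', Matrix.one_mulVec]

/-- The unimodular bracket `Tr(M)(a, b) = M(a, b, eᵢ)(λⁱ, ·)` of the element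
`M ∈ Λ³V* ⊗ S²V` whose coefficients `M(e₁, e₂, e₃)(λⁱ, λʲ)` are the entries of a symmetric
matrix `A`; that is, `(a, b) ↦ A (a × b)`, so `[eᵢ, eⱼ] = ∑ₖ εᵢⱼₖ μₖ eₖ` for
`A = diag(μ₁, μ₂, μ₃)`. -/
def ofMatrix (A : Matrix (Fin 3) (Fin 3) 𝕜) : W 𝕜 :=
  mkW ((crossProduct (R := 𝕜)).compr₂ A.mulVecLin) (by intro a; simp)

/-- `j(ν)(a, b) = ν(a) b - ν(b) a`, where `ν ∈ V*` is given by its coordinates. -/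
def j (ν : V 𝕜) : W 𝕜 :=
  mkW (LinearMap.mk₂ 𝕜 (fun a b => (ν ⬝ᵥ a) • b - (ν ⬝ᵥ b) • a)
    (by intro a a' b; simp only [dotProduct_add, add_smul, smul_add]; abel)
    (by intro c a b; simp only [dotProduct_smul, smul_sub, smul_eq_mul, mul_smul,
          smul_comm c])
    (by intro a b b'; simp only [dotProduct_add, add_smul, smul_add]; abel)
    (by intro c a b; simp only [dotProduct_smul, smul_sub, smul_eq_mul, mul_smul,
          smul_comm c])) (by intro a; simp)

/-- Bilinear forms on `V*`. -/
def DualForms (𝕜 : Type) [RCLike 𝕜] : Type :=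
  Module.Dual 𝕜 (V 𝕜) →ₗ[𝕜] Module.Dual 𝕜 (V 𝕜) →ₗ[𝕜] 𝕜

instance (𝕜 : Type) [RCLike 𝕜] : AddCommGroup (DualForms 𝕜) :=
  inferInstanceAs (AddCommGroup (Module.Dual 𝕜 (V 𝕜) →ₗ[𝕜] Module.Dual 𝕜 (V 𝕜) →ₗ[𝕜] 𝕜))

instance (𝕜 : Type) [RCLike 𝕜] : Module 𝕜 (DualForms 𝕜) :=
  inferInstanceAs (Module 𝕜 (Module.Dual 𝕜 (V 𝕜) →ₗ[𝕜] Module.Dual 𝕜 (V 𝕜) →ₗ[𝕜] 𝕜))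

/-- The value of a bilinear form on `V*`. -/
def DualForms.val (f : DualForms 𝕜) :
    Module.Dual 𝕜 (V 𝕜) →ₗ[𝕜] Module.Dual 𝕜 (V 𝕜) →ₗ[𝕜] 𝕜 := f

/-- Symmetric bilinear forms on `V*`, that is `S²V`. -/
def symForms (𝕜 : Type) [RCLike 𝕜] : Submodule 𝕜 (DualForms 𝕜) where
  carrier := {f | ∀ α β, f.val α β = f.val β α}
  add_mem' := by
    intro f g hf hg α β
    exact congrArg₂ (· + ·) (hf α β) (hg α β)
  zero_mem' := fun _ _ => rfl
  smul_mem' := by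
    intro c f hf α β
    exact congrArg (c • ·) (hf α β)

/-- `W' = Λ³V* ⊗ S²V = Alt₃(V, S²V)`. -/
abbrev W' (𝕜 : Type) [RCLike 𝕜] : Type := V 𝕜 [⋀^Fin 3]→ₗ[𝕜] symForms 𝕜

/-- `α ↦ α ∘ g`, that is `α ↦ g⁻¹.α` for the action of `GL(V)` on `V*`. -/
def dualPull (g : GL (Fin 3) 𝕜) : Module.Dual 𝕜 (V 𝕜) →ₗ[𝕜] Module.Dual 𝕜 (V 𝕜) :=
  (Matrix.mulVecLin (g : Matrix _ _ 𝕜)).dualMap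

/-- The action `(g.f)(α, β) = f(g⁻¹.α, g⁻¹.β)` on symmetric forms. -/
def symAct (g : GL (Fin 3) 𝕜) : symForms 𝕜 →ₗ[𝕜] symForms 𝕜 where
  toFun f := ⟨f.1.val.compl₁₂ (dualPull g) (dualPull g), fun _ _ => f.2 _ _⟩
  map_add' _ _ := rfl
  map_smul' _ _ := rfl

/-- The action `(g.M)(a, b, c)(α, β) = M(g⁻¹a, g⁻¹b, g⁻¹c)(g⁻¹.α, g⁻¹.β)` of `GL(V)` on `W'`. -/
def actW' (g : GL (Fin 3) 𝕜) (M : W' 𝕜) : W' 𝕜 :=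
  (symAct g).compAlternatingMap
    (M.compLinearMap (Matrix.mulVecLin ((g⁻¹ : GL (Fin 3) 𝕜) : Matrix _ _ 𝕜)))

theorem actW'_apply (g : GL (Fin 3) 𝕜) (M : W' 𝕜)
    (v : Fin 3 → V 𝕜) (α β : Module.Dual 𝕜 (V 𝕜)) :
    (actW' g M v).1.val α β =
      (M fun i => ((g⁻¹ : GL (Fin 3) 𝕜) : Matrix _ _ 𝕜) *ᵥ v i).1.val (dualPull g α)
        (dualPull g β) := rfl

theorem ext_W' {M N : W' 𝕜}
    (h : ∀ v α β, (M v).1.val α β = (N v).1.val α β) : M = N :=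
  AlternatingMap.ext fun v => Subtype.ext (LinearMap.ext fun α => LinearMap.ext fun β => h v α β)

/-- `W'` as a representation of `GL(V)`. -/
def repW' (𝕜 : Type) [RCLike 𝕜] : Representation 𝕜 (GL (Fin 3) 𝕜) (W' 𝕜) where
  toFun g :=
    { toFun := actW' g
      map_add' := fun _ _ => ext_W' fun _ _ _ => rfl
      map_smul' := fun _ _ => ext_W' fun _ _ _ => rfl }
  map_one' := by
    refine LinearMap.ext fun M => ext_W' fun v α β => ?_
    have h : ∀ γ : Module.Dual 𝕜 (V 𝕜), dualPull (1 : GL (Fin 3) 𝕜) γ = γ := by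
      intro γ
      ext
      simp [dualPull]
    refine (actW'_apply 1 M v α β).trans ?_
    rw [h, h]
    simp only [inv_one, Units.val_one, Matrix.one_mulVec]
    rfl
  map_mul' g g' := by
    refine LinearMap.ext fun M => ext_W' fun v α β => ?_
    have e : ∀ γ : Module.Dual 𝕜 (V 𝕜), dualPull (g * g') γ = dualPull g' (dualPull g γ) := by
      intro γ
      refine LinearMap.ext fun x => ?_
      simp [dualPull, Matrix.mulVec_mulVec]
    refine (actW'_apply (g * g') M v α β).trans ?_
    refine Eq.trans ?_ (actW'_apply g (actW' g' M) v α β).symm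
    rw [actW'_apply, e, e]
    simp only [mul_inv_rev, Units.val_mul, Matrix.mulVec_mulVec]

end Defs

/-- `B` is an embedded `C^∞` submanifold (holomorphic for `𝕜 = ℂ`) of `E` of dimension `d` over
`𝕜`: around each of its points there is a chart of `E` that straightens `B` to a `d`-dimensional
linear subspace. -/
def IsSubmanifoldOfDim (𝕜 : Type) [RCLike 𝕜] {E : Type*} [NormedAddCommGroup E]
    [NormedSpace 𝕜 E] (B : Set E) (d : ℕ) : Prop :=
  ∀ x ∈ B, ∃ (Φ : OpenPartialHomeomorph E E) (L : Submodule 𝕜 E),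
    x ∈ Φ.source ∧ ContDiffOn 𝕜 ∞ Φ Φ.source ∧ ContDiffOn 𝕜 ∞ Φ.symm Φ.target ∧
    Module.finrank 𝕜 L = d ∧ ∀ y ∈ Φ.source, (y ∈ B ↔ Φ y ∈ L)

/-- `B` is relatively open in `S`. -/
def IsOpenIn {E : Type*} [TopologicalSpace E] (B S : Set E) : Prop :=
  ∃ U : Set E, IsOpen U ∧ B = U ∩ S

/-- The underlying set of matrices of a group of matrices, in the space `𝕜^{3×3}`. -/
def matrixSet {𝕜 : Type} [RCLike 𝕜] (H : Subgroup (GL (Fin 3) 𝕜)) : Set (Fin 3 → Fin 3 → 𝕜) :=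
  {f | ∃ g ∈ H, ∀ i k, f i k = (g : Matrix (Fin 3) (Fin 3) 𝕜) i k}

/-- The classes of real three-dimensional Lie algebras in Bianchi's list (`III` is `VI₋₁`). -/
inductive BianchiClass : Type
  | I
  | II
  | IV
  | V
  | VI (h : ℝ) (hh : h ≤ 0)
  | VII (h : ℝ) (hh : 0 ≤ h)
  | VIII
  | IX

/-- The matrix `A` of the unimodular part of the representative. -/
def BianchiClass.mat : BianchiClass → Matrix (Fin 3) (Fin 3) ℝ
  | .I => Matrix.diagonal ![0, 0, 0]
  | .II => Matrix.diagonal ![1, 0, 0]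
  | .IV => Matrix.diagonal ![1, 0, 0]
  | .V => Matrix.diagonal ![0, 0, 0]
  | .VI _ _ => Matrix.diagonal ![1, -1, 0]
  | .VII _ _ => Matrix.diagonal ![1, 1, 0]
  | .VIII => Matrix.diagonal ![1, 1, -1]
  | .IX => Matrix.diagonal ![1, 1, 1]

/-- The covector `ν` of the trace part of the representative. -/
def BianchiClass.covec : BianchiClass → Bianchi.V ℝ
  | .I => ![0, 0, 0]
  | .II => ![0, 0, 0]
  | .IV => ![0, 0, 1]
  | .V => ![0, 0, 1]
  | .VI h _ => ![0, 0, h]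
  | .VII h _ => ![0, 0, h]
  | .VIII => ![0, 0, 0]
  | .IX => ![0, 0, 0]

/-- The representative `Tr(M) + j(ν)` of a class. -/
def BianchiClass.rep (t : BianchiClass) : W ℝ := ofMatrix t.mat + j t.covec

/-- The `GL₃(ℝ)`-orbit of a class in `W`. -/
def BianchiClass.orbit (t : BianchiClass) : Set (W ℝ) := MulAction.orbit (GL (Fin 3) ℝ) t.rep

/-- The automorphism group of the representative. -/
def BianchiClass.aut (t : BianchiClass) : Subgroup (GL (Fin 3) ℝ) := autGroup t.rep

def BianchiClass.orbitDim : BianchiClass → ℕ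
  | .I => 0
  | .II => 3
  | .IV => 5
  | .V => 3
  | .VI _ _ => 5
  | .VII _ _ => 5
  | .VIII => 6
  | .IX => 6

/-- `VI₀` and `VII₀`. -/
abbrev BianchiClass.VI₀ : BianchiClass := .VI 0 le_rfl

abbrev BianchiClass.VII₀ : BianchiClass := .VII 0 le_rfl

/-- The block matrix with rows `(g₁ h)` and `(0 c)`. -/
def block (g₁ : Matrix (Fin 2) (Fin 2) ℝ) (h : Fin 2 → ℝ) (c : ℝ) : Matrix (Fin 3) (Fin 3) ℝ :=
  !![g₁ 0 0, g₁ 0 1, h 0; g₁ 1 0, g₁ 1 1, h 1; 0, 0, c]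

/-- `diag(1, -1)`, the Gram matrix of the Minkowski plane. -/
def mink : Matrix (Fin 2) (Fin 2) ℝ := Matrix.diagonal ![1, -1]

theorem inv_conf {S : Matrix (Fin 2) (Fin 2) ℝ} {g : GL (Fin 2) ℝ} {c : ℝ} (hc : c ≠ 0)
    (h : (g : Matrix _ _ ℝ) * S * (g : Matrix _ _ ℝ)ᵀ = c • S) :
    ((g⁻¹ : GL (Fin 2) ℝ) : Matrix _ _ ℝ) * S * ((g⁻¹ : GL (Fin 2) ℝ) : Matrix _ _ ℝ)ᵀ =
      c⁻¹ • S := by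
  have e' : ((g⁻¹ : GL (Fin 2) ℝ) : Matrix _ _ ℝ) * (g : Matrix (Fin 2) (Fin 2) ℝ) = 1 := by
    rw [← Units.val_mul, inv_mul_cancel, Units.val_one]
  have e : (g : Matrix (Fin 2) (Fin 2) ℝ)ᵀ * ((g⁻¹ : GL (Fin 2) ℝ) : Matrix _ _ ℝ)ᵀ = 1 := by
    rw [← Matrix.transpose_mul, e', Matrix.transpose_one]
  have hS : S = c⁻¹ • ((g : Matrix _ _ ℝ) * S * (g : Matrix _ _ ℝ)ᵀ) := by
    rw [h, smul_smul, inv_mul_cancel₀ hc, one_smul]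
  calc _ = ((g⁻¹ : GL (Fin 2) ℝ) : Matrix _ _ ℝ) *
        (c⁻¹ • ((g : Matrix _ _ ℝ) * S * (g : Matrix _ _ ℝ)ᵀ)) *
          ((g⁻¹ : GL (Fin 2) ℝ) : Matrix _ _ ℝ)ᵀ := by rw [← hS]
    _ = c⁻¹ • ((((g⁻¹ : GL (Fin 2) ℝ) : Matrix _ _ ℝ) * (g : Matrix _ _ ℝ)) * S *
          ((g : Matrix _ _ ℝ)ᵀ * ((g⁻¹ : GL (Fin 2) ℝ) : Matrix _ _ ℝ)ᵀ)) := by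
        simp only [Matrix.mul_smul, Matrix.smul_mul, Matrix.mul_assoc]
    _ = _ := by rw [e', e, Matrix.one_mul, Matrix.mul_one]

theorem mul_conf {S : Matrix (Fin 2) (Fin 2) ℝ} {g g' : Matrix (Fin 2) (Fin 2) ℝ} {c c' : ℝ}
    (h : g * S * gᵀ = c • S) (h' : g' * S * g'ᵀ = c' • S) :
    g * g' * S * (g * g')ᵀ = (c * c') • S := by
  calc _ = g * (g' * S * g'ᵀ) * gᵀ := by simp only [Matrix.transpose_mul, Matrix.mul_assoc]
    _ = c' • (g * S * gᵀ) := by rw [h', Matrix.mul_smul, Matrix.smul_mul]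
    _ = _ := by rw [h, smul_smul, mul_comm]

/-- The conformal group of the form with Gram matrix `S`: `CO(1,1)` for `S = diag(1, -1)` and
`CO(2)` for `S = 1`. -/
def CO (S : Matrix (Fin 2) (Fin 2) ℝ) : Subgroup (GL (Fin 2) ℝ) where
  carrier := {g | ∃ c : ℝ, c ≠ 0 ∧ (g : Matrix _ _ ℝ) * S * (g : Matrix _ _ ℝ)ᵀ = c • S}
  one_mem' := ⟨1, one_ne_zero, by simp⟩
  mul_mem' := by
    rintro g g' ⟨c, hc, h⟩ ⟨c', hc', h'⟩
    exact ⟨c * c', mul_ne_zero hc hc', mul_conf h h'⟩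
  inv_mem' := by
    rintro g ⟨c, hc, h⟩
    exact ⟨c⁻¹, inv_ne_zero hc, inv_conf hc h⟩

/-- The subgroup of those elements of `CO(S)` whose conformal factor is equal to their
determinant. -/
def COPlus (S : Matrix (Fin 2) (Fin 2) ℝ) : Subgroup (GL (Fin 2) ℝ) where
  carrier := {g | (g : Matrix _ _ ℝ) * S * (g : Matrix _ _ ℝ)ᵀ =
    (g : Matrix (Fin 2) (Fin 2) ℝ).det • S}
  one_mem' := by simp
  mul_mem' := by
    intro g g' h h'
    have := mul_conf h h'
    rwa [← Matrix.det_mul] at this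
  inv_mem' := by
    intro g h
    have hd : (g : Matrix (Fin 2) (Fin 2) ℝ).det ≠ 0 :=
      ((Matrix.isUnit_iff_isUnit_det _).1 g.isUnit).ne_zero
    have := inv_conf hd h
    rwa [← Ring.inverse_eq_inv', ← Matrix.det_nonsing_inv, ← Matrix.coe_units_inv] at this

/-- The standard action of `GL₂(ℝ)` on the additive group `ℝ²`. -/
def stdAction : GL (Fin 2) ℝ →* MulAut (Multiplicative (Fin 2 → ℝ)) where
  toFun g :=
    { toFun := fun v => Multiplicative.ofAdd ((g : Matrix _ _ ℝ) *ᵥ v.toAdd)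
      invFun := fun v =>
        Multiplicative.ofAdd (((g⁻¹ : GL (Fin 2) ℝ) : Matrix _ _ ℝ) *ᵥ v.toAdd)
      left_inv := by
        intro v
        simp only [toAdd_ofAdd, Matrix.mulVec_mulVec, ← Units.val_mul, inv_mul_cancel,
          Units.val_one, Matrix.one_mulVec, ofAdd_toAdd]
      right_inv := by
        intro v
        simp only [toAdd_ofAdd, Matrix.mulVec_mulVec, ← Units.val_mul, mul_inv_cancel,
          Units.val_one, Matrix.one_mulVec, ofAdd_toAdd]
      map_mul' := by
        intro v w
        simp only [toAdd_mul, Matrix.mulVec_add, ofAdd_add] }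
  map_one' := by
    ext v : 1
    simp
  map_mul' g h := by
    ext v : 1
    exact congrArg Multiplicative.ofAdd (Matrix.mulVec_mulVec v.toAdd g.1 h.1).symm

/-- The semidirect product `K ⋉ ℝ²` for a subgroup `K` of `GL₂(ℝ)`. -/
abbrev Semi (K : Subgroup (GL (Fin 2) ℝ)) : Type :=
  Multiplicative (Fin 2 → ℝ) ⋊[stdAction.comp K.subtype] K

/-- `H` is the group of the matrices `(g₁ h; 0 1)` with `g₁ ∈ K`, `h ∈ ℝ²`, and
`(g₁ h; 0 1) ↦ (h, g₁)` is an isomorphism of `H` with `K ⋉ ℝ²`. -/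
def IsBlockSemidirect (H : Subgroup (GL (Fin 3) ℝ)) (K : Subgroup (GL (Fin 2) ℝ)) : Prop :=
  (∀ g : GL (Fin 3) ℝ, g ∈ H ↔ ∃ g₁ ∈ K, ∃ h : Fin 2 → ℝ,
    (g : Matrix _ _ ℝ) = block (g₁ : Matrix _ _ ℝ) h 1) ∧
  ∃ e : H ≃* Semi K, ∀ g : H, ((g : GL (Fin 3) ℝ) : Matrix _ _ ℝ) =
    block (((e g).right : GL (Fin 2) ℝ) : Matrix _ _ ℝ) (e g).left.toAdd 1

/-- The bracket over `ℂ` with `A = diag(1, …, 1, 0, …, 0)` of rank `r`: abelian for `r = 0`,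
nilpotent for `r = 1`, solvable for `r = 2` and simple for `r = 3`. -/
def complexRep (r : Fin 4) : W ℂ :=
  ofMatrix (Matrix.diagonal fun i : Fin 3 => if (i : ℕ) < r then 1 else 0)

def complexOrbit (r : Fin 4) : Set (W ℂ) := MulAction.orbit (GL (Fin 3) ℂ) (complexRep r)

end Bianchi

end

open Bianchi

/-! Every bracket is `C_{A,ν}` for a unique symmetric `A` and covector `ν`. In these coordinates
everything becomes linear algebra of quadratic forms. By `smul_T` the group acts by `(A, ν) ↦ (det
g⁻¹ · g A gᵀ, g⁻ᵀ ν)`. The Jacobi identity reads `A ν = 0` (`T_mem_lieVariety`), and unimodularity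
reads `ν = 0` (`mem_unimodular_iff`). Scalar matrices realise every nonzero multiple of a bracket,
so the determinant factor never matters for orbits: real forms are classified by their sign pattern
up to permutation and a common sign, and a covector killed by `A` is normalised afterwards
(`exists_orbit_T_eq`).

The parameter `h` survives because `adj A` transforms as a quadratic form on `V`, by the same
congruence as `ν νᵀ` (`adjugate_conj`). Hence `ν νᵀ = k · adj A` is an invariant relation, with `k =
-h²` for `VI_h` and `k = h²` for `VII_h`.

For the closures, each class `t` gets a closed invariant set `Z t` inside the Lie variety, given by
minors, semidefiniteness and this relation. Being invariant, `Z t` is the union of the orbits whose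
representatives it contains, and for diagonal representatives this is a comparison of entries
(`rep_mem_Z_iff`). It contains the orbit, hence its closure; explicit curves of diagonal forms show
that nothing is lost (`closure_orbit`). Since the resulting relation is antisymmetric, distinct
classes have distinct orbits.

The orbits are submanifolds because near the representative an orbit agrees with `Z t`
(`eventually_mem_orbit_iff`), which there is the zero set of independent equations; homogeneity
moves the chart along the orbit. The stabilizers are found from `g A gᵀ = det g · A` and `gᵀ ν = ν`,
and they are submanifolds by the same regular value argument at the identity.

For irreducibility, an invariant subspace of `Λ³V* ⊗ S²V` is a space of symmetric matrices stable
under congruence, and a single nonzero element already generates all rank-one diagonal matrices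
(`mem_of_conj_invariant`). Over `ℂ` there are square roots, so the rank is the only invariant of a
form, and the orbit closures are cut out by minors. -/

namespace Bianchi

/-! ### The coordinates `(A, ν)` on the space of brackets -/

section General

variable {𝕜 : Type} [RCLike 𝕜]

/-- The bracket `C_{A,ν}`. -/
noncomputable def T (A : Matrix (Fin 3) (Fin 3) 𝕜) (ν : V 𝕜) : W 𝕜 := ofMatrix A + j ν

theorem br_T (A : Matrix (Fin 3) (Fin 3) 𝕜) (ν a b : V 𝕜) :
    br (T A ν) a b = A *ᵥ (a ⨯₃ b) + ((ν ⬝ᵥ a) • b - (ν ⬝ᵥ b) • a) := rfl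

theorem T_def (A : Matrix (Fin 3) (Fin 3) 𝕜) (ν : V 𝕜) : T A ν = ofMatrix A + j ν := rfl

attribute [irreducible] T

theorem br_swap (C : W 𝕜) (a b : V 𝕜) : br C b a = - br C a b := by
  have h := C.toAlternatingMap.map_swap ![a, b] (i := 0) (j := 1) (by decide)
  have e : (![a, b] ∘ Equiv.swap (0 : Fin 2) 1) = ![b, a] := by
    ext i : 1
    fin_cases i <;> simp
  rw [e] at h
  exact h

/-- Antisymmetry leaves only the three cyclic pairs of basis vectors, those whose cross product is
again a basis vector. -/
theorem ext_br_single {C D : W 𝕜}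
    (h : ∀ p ∈ ({(0, 1), (1, 2), (2, 0)} : Set (Fin 3 × Fin 3)),
      br C (Pi.single p.1 1) (Pi.single p.2 1) = br D (Pi.single p.1 1) (Pi.single p.2 1)) :
    C = D := by
  have h' : ∀ i k : Fin 3, i ≠ k →
      br C (Pi.single i 1) (Pi.single k 1) = br D (Pi.single i 1) (Pi.single k 1) := by
    intro i k hik
    have : (i, k) ∈ ({(0, 1), (1, 2), (2, 0)} : Set (Fin 3 × Fin 3)) ∨
        (k, i) ∈ ({(0, 1), (1, 2), (2, 0)} : Set (Fin 3 × Fin 3)) := by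
      revert i k
      simp only [Set.mem_insert_iff, Set.mem_singleton_iff]
      decide
    rcases this with hp | hp
    · exact h _ hp
    · rw [br_swap C, br_swap D, h _ hp]
  have : C.toAlternatingMap = D.toAlternatingMap := by
    refine Module.Basis.ext_alternating (Pi.basisFun 𝕜 (Fin 3)) fun v hv => ?_
    have e : (fun i => Pi.basisFun 𝕜 (Fin 3) (v i)) =
        ![Pi.single (v 0) 1, Pi.single (v 1) 1] := by
      ext i : 1
      fin_cases i <;> simp
    rw [e]
    exact h' (v 0) (v 1) fun hh => absurd (hv hh) (by decide)
  exact ContinuousAlternatingMap.toAlternatingMap_injective this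

/-- The structure constant `λᵏ(C(eᵢ, eₗ))` as a linear function of `C`. -/
noncomputable def sc (i l k : Fin 3) : W 𝕜 →ₗ[𝕜] 𝕜 where
  toFun C := br C (Pi.single i 1) (Pi.single l 1) k
  map_add' _ _ := rfl
  map_smul' _ _ := rfl

theorem sc_apply (i l k : Fin 3) (C : W 𝕜) :
    sc i l k C = br C (Pi.single i 1) (Pi.single l 1) k := rfl

/-- The symmetric matrix with given upper triangle. -/
def sym (w : Fin 6 → 𝕜) : Matrix (Fin 3) (Fin 3) 𝕜 :=
  !![w 0, w 1, w 2; w 1, w 3, w 4; w 2, w 4, w 5]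

theorem sym_isSymm (w : Fin 6 → 𝕜) : (sym w).IsSymm := by
  ext i k
  fin_cases i <;> fin_cases k <;> rfl

theorem eq_sym {A : Matrix (Fin 3) (Fin 3) 𝕜} (hA : A.IsSymm) :
    A = sym ![A 0 0, A 0 1, A 0 2, A 1 1, A 1 2, A 2 2] := by
  have h := hA.apply
  ext i k
  fin_cases i <;> fin_cases k <;> simp [sym, h 0 1, h 0 2, h 1 2]

/-- The upper triangle of the symmetric matrix of a bracket. -/
noncomputable def matL : W 𝕜 →ₗ[𝕜] (Fin 6 → 𝕜) :=
  LinearMap.pi ![sc 1 2 0, (2⁻¹ : 𝕜) • (sc 2 0 0 + sc 1 2 1), (2⁻¹ : 𝕜) • (sc 0 1 0 + sc 1 2 2),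
    sc 2 0 1, (2⁻¹ : 𝕜) • (sc 0 1 1 + sc 2 0 2), sc 0 1 2]

/-- The trace covector of a bracket. -/
noncomputable def cov : W 𝕜 →ₗ[𝕜] V 𝕜 :=
  LinearMap.pi ![(2⁻¹ : 𝕜) • (sc 0 1 1 - sc 2 0 2), (2⁻¹ : 𝕜) • (sc 1 2 2 - sc 0 1 0),
    (2⁻¹ : 𝕜) • (sc 2 0 0 - sc 1 2 1)]

/-- The symmetric matrix of a bracket. -/
noncomputable def mat (C : W 𝕜) : Matrix (Fin 3) (Fin 3) 𝕜 := sym (matL C)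

theorem mat_isSymm (C : W 𝕜) : (mat C).IsSymm := sym_isSymm _

/-- For cyclic `(i, l, k)` one has `C(eᵢ, eₗ) = A eₖ + νᵢ eₗ - νₗ eᵢ`. Hence the diagonal of `A`
consists of structure constants, while half sums and half differences of the two that share an
off-diagonal place give the entry of `A` and an entry of `ν`. -/
theorem T_mat_cov (C : W 𝕜) : T (mat C) (cov C) = C := by
  refine ext_br_single fun p hp => ?_
  simp only [Set.mem_insert_iff, Set.mem_singleton_iff] at hp
  rcases hp with rfl | rfl | rfl <;>
  · ext k
    rw [br_T]
    fin_cases k <;>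
    · simp [cross_apply, mat, sym, matL, cov, sc_apply, Matrix.mulVec, dotProduct, Fin.sum_univ_three]
      try ring

theorem matL_T_sym (w : Fin 6 → 𝕜) (ν : V 𝕜) : matL (T (sym w) ν) = w := by
  ext i
  fin_cases i <;>
  · simp [sym, matL, sc_apply, br_T, cross_apply, Matrix.mulVec, dotProduct, Fin.sum_univ_three]
    try ring

theorem mat_T {A : Matrix (Fin 3) (Fin 3) 𝕜} (hA : A.IsSymm) (ν : V 𝕜) : mat (T A ν) = A := by
  rw [eq_sym hA, mat, matL_T_sym]

theorem cov_T {A : Matrix (Fin 3) (Fin 3) 𝕜} (hA : A.IsSymm) (ν : V 𝕜) : cov (T A ν) = ν := by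
  rw [eq_sym hA]
  ext i
  fin_cases i <;>
  · simp [sym, cov, sc_apply, br_T, cross_apply, Matrix.mulVec, dotProduct, Fin.sum_univ_three]
    try ring

/-- `(A, ν) ↦ C_{A,ν}` as a linear map, the symmetric matrix being given by its upper triangle. -/
noncomputable def TL : (Fin 6 → 𝕜) × V 𝕜 →ₗ[𝕜] W 𝕜 where
  toFun p := T (sym p.1) p.2
  map_add' p q := by
    refine ext_br fun a b => ?_
    change br (T _ _) a b = br (T _ _) a b + br (T _ _) a b
    have : sym (p.1 + q.1) = sym p.1 + sym q.1 := by
      ext i k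
      fin_cases i <;> fin_cases k <;> rfl
    simp only [br_T, Prod.fst_add, Prod.snd_add, this, Matrix.add_mulVec, add_dotProduct, add_smul]
    abel
  map_smul' c p := by
    refine ext_br fun a b => ?_
    change br (T _ _) a b = c • br (T _ _) a b
    have : sym (c • p.1) = c • sym p.1 := by
      ext i k
      fin_cases i <;> fin_cases k <;> rfl
    simp only [br_T, Prod.smul_fst, Prod.smul_snd, this, Matrix.smul_mulVec, smul_dotProduct,
      smul_add, smul_sub, smul_smul, smul_eq_mul]

/-- The linear isomorphism `W ≅ S²V ⊕ V*`. -/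
noncomputable def equivW : ((Fin 6 → 𝕜) × V 𝕜) ≃ₗ[𝕜] W 𝕜 :=
  { TL with
    invFun C := (matL C, cov C)
    left_inv _ := Prod.ext (matL_T_sym _ _) (cov_T (sym_isSymm _) _)
    right_inv C := T_mat_cov C }

instance : FiniteDimensional 𝕜 (W 𝕜) := equivW.finiteDimensional

theorem finrank_W : Module.finrank 𝕜 (W 𝕜) = 9 := by
  rw [← equivW.finrank_eq]
  simp

theorem j_eq_T (ν : V 𝕜) : j ν = T 0 ν := by
  refine ext_br fun a b => ?_
  rw [br_T, Matrix.zero_mulVec, zero_add]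
  rfl

theorem T_add_smul (A : Matrix (Fin 3) (Fin 3) 𝕜) (ν : V 𝕜) (c : 𝕜) :
    T (c • A) (c • ν) = c • T A ν := by
  refine ext_br fun a b => ?_
  change _ = c • br (T _ _) a b
  simp only [br_T, Matrix.smul_mulVec, smul_dotProduct, smul_add, smul_sub, smul_smul, smul_eq_mul]

/-- Cross products transform by the cofactor matrix; this is the source of the determinant in the
action on `A`. -/
theorem mulVec_cross (M : Matrix (Fin 3) (Fin 3) 𝕜) (a b : V 𝕜) :
    (M *ᵥ a) ⨯₃ (M *ᵥ b) = M.adjugateᵀ *ᵥ (a ⨯₃ b) := by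
  rw [Matrix.adjugate_fin_three]
  ext i
  fin_cases i <;>
  · simp [cross_apply, Matrix.mulVec, dotProduct, Fin.sum_univ_three]
    ring

theorem GL_det_ne_zero {n : Type*} [Fintype n] [DecidableEq n] (g : GL n 𝕜) :
    (g : Matrix n n 𝕜).det ≠ 0 :=
  ((Matrix.isUnit_iff_isUnit_det (g : Matrix n n 𝕜)).1 g.isUnit).ne_zero

/-- The cofactor matrix of `g⁻¹` is `gᵀ / det g`, so `g A ((g⁻¹a) × (g⁻¹b)) = det g⁻¹ · g A gᵀ (a ×
b)`; the covector is pulled back by `g⁻¹`. -/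
theorem smul_T (g : GL (Fin 3) 𝕜) (A : Matrix (Fin 3) (Fin 3) 𝕜) (ν : V 𝕜) :
    g • T A ν = T ((g : Matrix (Fin 3) (Fin 3) 𝕜).det⁻¹ • ((g : Matrix (Fin 3) (Fin 3) 𝕜) * A * (g : Matrix (Fin 3) (Fin 3) 𝕜)ᵀ))
      (((g⁻¹ : GL (Fin 3) 𝕜) : Matrix (Fin 3) (Fin 3) 𝕜)ᵀ *ᵥ ν) := by
  refine ext_br fun a b => ?_
  have e : (g : Matrix (Fin 3) (Fin 3) 𝕜) * ((g⁻¹ : GL (Fin 3) 𝕜) : Matrix (Fin 3) (Fin 3) 𝕜) = 1 := by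
    rw [← Units.val_mul, mul_inv_cancel, Units.val_one]
  have hadj : ((g⁻¹ : GL (Fin 3) 𝕜) : Matrix (Fin 3) (Fin 3) 𝕜).adjugateᵀ =
      (g : Matrix (Fin 3) (Fin 3) 𝕜).det⁻¹ • (g : Matrix (Fin 3) (Fin 3) 𝕜)ᵀ := by
    rw [← Matrix.transpose_smul]
    congr 1
    have h1 : (g : Matrix (Fin 3) (Fin 3) 𝕜) * (((g⁻¹ : GL (Fin 3) 𝕜) : Matrix (Fin 3) (Fin 3) 𝕜) *
        ((g⁻¹ : GL (Fin 3) 𝕜) : Matrix (Fin 3) (Fin 3) 𝕜).adjugate) =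
        ((g⁻¹ : GL (Fin 3) 𝕜) : Matrix (Fin 3) (Fin 3) 𝕜).adjugate := by
      rw [← Matrix.mul_assoc, e, Matrix.one_mul]
    rw [← h1, Matrix.mul_adjugate, Matrix.mul_smul, Matrix.mul_one]
    congr 1
    have := congrArg Matrix.det e
    rw [Matrix.det_mul, Matrix.det_one] at this
    exact eq_inv_of_mul_eq_one_right this
  have hdot : ∀ a : V 𝕜, ν ⬝ᵥ (((g⁻¹ : GL (Fin 3) 𝕜) : Matrix (Fin 3) (Fin 3) 𝕜) *ᵥ a) =
      (((g⁻¹ : GL (Fin 3) 𝕜) : Matrix (Fin 3) (Fin 3) 𝕜)ᵀ *ᵥ ν) ⬝ᵥ a := by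
    intro a
    rw [Matrix.mulVec_transpose, Matrix.dotProduct_mulVec]
  rw [br_smul, br_T, br_T, mulVec_cross, hadj, Matrix.mulVec_add, Matrix.mulVec_sub,
    Matrix.mulVec_smul, Matrix.mulVec_smul, Matrix.mulVec_mulVec, Matrix.mulVec_mulVec,
    Matrix.mulVec_mulVec, Matrix.mulVec_mulVec, e, Matrix.one_mulVec, Matrix.one_mulVec, hdot,
    hdot]
  congr 2
  simp only [Matrix.mul_smul, Matrix.mul_assoc]

theorem T_inj {A B : Matrix (Fin 3) (Fin 3) 𝕜} (hA : A.IsSymm) (hB : B.IsSymm) {ν μ : V 𝕜} :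
    T A ν = T B μ ↔ A = B ∧ ν = μ := by
  refine ⟨fun h => ⟨?_, ?_⟩, fun h => by rw [h.1, h.2]⟩
  · rw [← mat_T hA ν, h, mat_T hB]
  · rw [← cov_T hA ν, h, cov_T hB]

theorem isSymm_conj {A : Matrix (Fin 3) (Fin 3) 𝕜} (hA : A.IsSymm) (c : 𝕜)
    (g : Matrix (Fin 3) (Fin 3) 𝕜) : (c • (g * A * gᵀ)).IsSymm := by
  rw [Matrix.IsSymm, Matrix.transpose_smul, Matrix.transpose_mul, Matrix.transpose_mul,
    Matrix.transpose_transpose, hA.eq, Matrix.mul_assoc]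

theorem stabilizer_eq_autGroup (C : W 𝕜) : MulAction.stabilizer (GL (Fin 3) 𝕜) C = autGroup C := by
  ext g
  rw [MulAction.mem_stabilizer_iff]
  have e' : ((g⁻¹ : GL (Fin 3) 𝕜) : Matrix (Fin 3) (Fin 3) 𝕜) * (g : Matrix (Fin 3) (Fin 3) 𝕜) = 1 := by
    rw [← Units.val_mul, inv_mul_cancel, Units.val_one]
  have e : (g : Matrix (Fin 3) (Fin 3) 𝕜) * ((g⁻¹ : GL (Fin 3) 𝕜) : Matrix (Fin 3) (Fin 3) 𝕜) = 1 := by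
    rw [← Units.val_mul, mul_inv_cancel, Units.val_one]
  constructor
  · intro h a b
    conv_rhs => rw [← h]
    rw [br_smul, Matrix.mulVec_mulVec, Matrix.mulVec_mulVec, e', Matrix.one_mulVec,
      Matrix.one_mulVec]
  · intro h
    refine ext_br fun a b => ?_
    rw [br_smul, h, Matrix.mulVec_mulVec, Matrix.mulVec_mulVec, e, Matrix.one_mulVec,
      Matrix.one_mulVec]

theorem mem_autGroup_T {A : Matrix (Fin 3) (Fin 3) 𝕜} (hA : A.IsSymm) (ν : V 𝕜)
    (g : GL (Fin 3) 𝕜) : g ∈ autGroup (T A ν) ↔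
      (g : Matrix (Fin 3) (Fin 3) 𝕜) * A * (g : Matrix (Fin 3) (Fin 3) 𝕜)ᵀ = (g : Matrix (Fin 3) (Fin 3) 𝕜).det • A ∧
      (g : Matrix (Fin 3) (Fin 3) 𝕜)ᵀ *ᵥ ν = ν := by
  rw [← stabilizer_eq_autGroup, MulAction.mem_stabilizer_iff, smul_T,
    T_inj (isSymm_conj hA _ _) hA, inv_smul_eq_iff₀ (GL_det_ne_zero g)]
  refine and_congr_right fun _ => ⟨fun h => ?_, fun h => ?_⟩
  · conv_lhs => rw [← h]
    rw [Matrix.mulVec_mulVec, ← Matrix.transpose_mul, ← Units.val_mul, inv_mul_cancel,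
      Units.val_one, Matrix.transpose_one, Matrix.one_mulVec]
  · conv_lhs => rw [← h]
    rw [Matrix.mulVec_mulVec, ← Matrix.transpose_mul, ← Units.val_mul, mul_inv_cancel,
      Units.val_one, Matrix.transpose_one, Matrix.one_mulVec]

/-- The cyclic sum in the Jacobi identity is alternating in three vectors of a three-dimensional
space, so it is a multiple of their determinant; the multiple is `2 A ν`. -/
theorem T_mem_lieVariety {A : Matrix (Fin 3) (Fin 3) 𝕜} (hA : A.IsSymm) (ν : V 𝕜) :
    T A ν ∈ lieVariety 𝕜 ↔ A *ᵥ ν = 0 := by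
  constructor
  · intro h
    have h1 := h (Pi.single 0 1) (Pi.single 1 1) (Pi.single 2 1)
    rw [eq_sym hA] at h1 ⊢
    generalize ![A 0 0, A 0 1, A 0 2, A 1 1, A 1 2, A 2 2] = w at *
    simp only [br_T] at h1
    have h2 : (2 : 𝕜) • (sym w *ᵥ ν) = 0 := by
      rw [← h1]
      ext k
      fin_cases k <;>
      · simp [sym, cross_apply, Matrix.mulVec, dotProduct, Fin.sum_univ_three]
        ring
    exact (smul_eq_zero.1 h2).resolve_left two_ne_zero
  · intro h a b c
    have key : br (T A ν) (br (T A ν) a b) c + br (T A ν) (br (T A ν) b c) a +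
        br (T A ν) (br (T A ν) c a) b = (2 * (a ⬝ᵥ (b ⨯₃ c))) • (A *ᵥ ν) := by
      rw [eq_sym hA]
      generalize ![A 0 0, A 0 1, A 0 2, A 1 1, A 1 2, A 2 2] = w
      simp only [br_T]
      ext k
      fin_cases k <;>
      · simp [sym, cross_apply, Matrix.mulVec, dotProduct, Fin.sum_univ_three]
        ring
    rw [key, h, smul_zero]

/-- The map `b ↦ A (a × b)` is a symmetric matrix times an antisymmetric one and has trace zero; `b
↦ ν(a) b - ν(b) a` has trace `3 ν(a) - ν(a)`. -/
theorem mem_unimodular_iff (C : W 𝕜) : C ∈ unimodular 𝕜 ↔ cov C = 0 := by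
  have key : ∀ a, LinearMap.trace 𝕜 (V 𝕜) (ad C a) = 2 * (cov C ⬝ᵥ a) := by
    intro a
    rw [LinearMap.trace_eq_matrix_trace 𝕜 (Pi.basisFun 𝕜 (Fin 3))]
    simp only [Matrix.trace, Matrix.diag_apply, LinearMap.toMatrix_apply, Pi.basisFun_apply,
      Pi.basisFun_repr, Fin.sum_univ_three]
    change br C a _ 0 + br C a _ 1 + br C a _ 2 = _
    have e : ∀ b, br C a b = br (T (mat C) (cov C)) a b := fun b => by rw [T_mat_cov]
    simp only [e, br_T, mat]
    simp [sym, cross_apply, Matrix.mulVec, dotProduct, Fin.sum_univ_three]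
    ring
  change (∀ a, LinearMap.trace 𝕜 (V 𝕜) (ad C a) = 0) ↔ _
  simp only [key]
  constructor
  · intro h
    ext i
    have := h (Pi.single i 1)
    simpa using this
  · intro h a
    simp [h]

/-- Scalar matrices. -/
noncomputable def scalarGL (c : 𝕜) (hc : c ≠ 0) : GL (Fin 3) 𝕜 :=
  Units.mk0 c hc • (1 : GL (Fin 3) 𝕜)

/-- A bracket takes two arguments and returns one vector, so the scalar `c⁻¹` acts by `c⁻¹ · c²`. In
particular all orbits are stable under nonzero multiples. -/
theorem scalarGL_smul (c : 𝕜) (hc : c ≠ 0) (C : W 𝕜) : scalarGL c⁻¹ (inv_ne_zero hc) • C = c • C := by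
  refine ext_br fun a b => ?_
  have h1 : ((scalarGL c⁻¹ (inv_ne_zero hc) : GL (Fin 3) 𝕜) : Matrix (Fin 3) (Fin 3) 𝕜) =
      c⁻¹ • 1 := rfl
  have h2 : ((scalarGL c⁻¹ (inv_ne_zero hc) : GL (Fin 3) 𝕜)⁻¹ : GL (Fin 3) 𝕜) =
      scalarGL c hc := by
    apply inv_eq_of_mul_eq_one_right
    ext1
    change (c⁻¹ • (1 : Matrix (Fin 3) (Fin 3) 𝕜)) * (c • 1) = 1
    simp [smul_smul, hc]
  have h3 : ((scalarGL c hc : GL (Fin 3) 𝕜) : Matrix (Fin 3) (Fin 3) 𝕜) = c • 1 := rfl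
  rw [br_smul, h2, h1, h3]
  change _ = c • br C a b
  rw [← T_mat_cov C]
  simp only [br_T, Matrix.smul_mulVec, Matrix.one_mulVec, map_smul, LinearMap.smul_apply,
    Matrix.mulVec_smul, dotProduct_smul, smul_add, smul_sub, smul_smul, smul_eq_mul]
  simp [hc, mul_assoc, mul_comm]

theorem continuous_matL : Continuous (matL : W 𝕜 → _) := LinearMap.continuous_of_finiteDimensional (matL (𝕜 := 𝕜))

theorem continuous_cov : Continuous (cov : W 𝕜 → _) :=
  LinearMap.continuous_of_finiteDimensional (cov (𝕜 := 𝕜))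

theorem continuous_sym : Continuous (sym : (Fin 6 → 𝕜) → _) := by
  refine continuous_matrix fun i k => ?_
  fin_cases i <;> fin_cases k <;> exact continuous_apply _

theorem continuous_mat : Continuous (mat : W 𝕜 → _) := continuous_sym.comp continuous_matL

/-- The action of a group element as a continuous linear automorphism. -/
noncomputable def actEquiv (g : GL (Fin 3) 𝕜) : W 𝕜 ≃L[𝕜] W 𝕜 :=
  LinearEquiv.toContinuousLinearEquiv
    { toFun := fun C => g • C
      map_add' := fun C D => smul_add g C D
      map_smul' := fun c C => by
        rw [← T_mat_cov C, ← T_add_smul, smul_T, smul_T, ← T_add_smul]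
        simp only [Matrix.mul_smul, Matrix.smul_mul, Matrix.mulVec_smul, RingHom.id_apply]
        rw [smul_comm c]
      invFun := fun C => g⁻¹ • C
      left_inv := fun C => inv_smul_smul g C
      right_inv := fun C => smul_inv_smul g C }

theorem actEquiv_apply (g : GL (Fin 3) 𝕜) (C : W 𝕜) : actEquiv g C = g • C := rfl

theorem continuous_TL : Continuous fun p : (Fin 6 → 𝕜) × V 𝕜 => (T (sym p.1) p.2 : W 𝕜) := by
  have h := LinearMap.continuous_of_finiteDimensional (TL (𝕜 := 𝕜))
  exact h

theorem continuous_T {X : Type*} [TopologicalSpace X] {w : X → Fin 6 → 𝕜} {ν : X → V 𝕜}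
    (hw : Continuous w) (hν : Continuous ν) : Continuous fun x => T (sym (w x)) (ν x) :=
  continuous_TL.comp₂ hw hν

end General

/-! ### Submanifolds from regular equations -/

section Submanifolds

variable {𝕜 : Type} [RCLike 𝕜] {E F : Type*} [NormedAddCommGroup E] [NormedSpace 𝕜 E]
  [NormedAddCommGroup F] [NormedSpace 𝕜 F]

/-- The condition of `IsSubmanifoldOfDim` at a single point. -/
def IsSubmanifoldAt (𝕜 : Type) [RCLike 𝕜] {E : Type*} [NormedAddCommGroup E]
    [NormedSpace 𝕜 E] (B : Set E) (d : ℕ) (x : E) : Prop :=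
  ∃ (Φ : OpenPartialHomeomorph E E) (L : Submodule 𝕜 E),
    x ∈ Φ.source ∧ ContDiffOn 𝕜 ∞ Φ Φ.source ∧ ContDiffOn 𝕜 ∞ Φ.symm Φ.target ∧
    Module.finrank 𝕜 L = d ∧ ∀ y ∈ Φ.source, (y ∈ B ↔ Φ y ∈ L)

/-- Composing the chart with a linear symmetry of `B` moves it to another point, so for a
homogeneous set one chart suffices. -/
theorem IsSubmanifoldAt.image {B : Set E} {d : ℕ} {x : E} (h : IsSubmanifoldAt 𝕜 B d x)
    (e : E ≃L[𝕜] E) (he : ∀ y, e y ∈ B ↔ y ∈ B) : IsSubmanifoldAt 𝕜 B d (e x) := by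
  obtain ⟨Φ, L, hx, h1, h2, hL, hB⟩ := h
  refine ⟨e.symm.toHomeomorph.toOpenPartialHomeomorph.trans Φ, L, ?_, ?_, ?_, hL, ?_⟩
  · simpa using hx
  · refine h1.comp (f := e.symm) e.symm.contDiff.contDiffOn ?_
    intro y hy
    simpa using hy
  · refine (e.contDiff.comp_contDiffOn (h2.mono ?_))
    intro y hy
    simpa using hy
  · intro y hy
    have hy' : e.symm y ∈ Φ.source := by simpa using hy
    have := hB _ hy'
    rw [← he, e.apply_symm_apply] at this
    exact this

/-- The regular value theorem: a set that is near `x` the zero set of a smooth map `f` which is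
a local submersion at `x`, as seen on the affine subspace `x + s(F)`, is a submanifold near `x`. -/
theorem IsSubmanifoldAt.of_regular [FiniteDimensional 𝕜 E] [FiniteDimensional 𝕜 F]
    {B : Set E} {d : ℕ} {x : E} (f : E → F) (hf : ContDiff 𝕜 ∞ f) (s : F →ₗ[𝕜] E)
    (hs : HasFDerivAt (fun w => f (x + s w)) (ContinuousLinearMap.id 𝕜 F) 0)
    (hB : ∀ᶠ y in nhds x, y ∈ B ↔ f y = 0)
    (hd : d + Module.finrank 𝕜 F = Module.finrank 𝕜 E) : IsSubmanifoldAt 𝕜 B d x := by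
  have : CompleteSpace E := FiniteDimensional.complete 𝕜 E
  have hn : (∞ : WithTop ℕ∞) ≠ 0 := by simp
  set f' : E →L[𝕜] F := fderiv 𝕜 f x with hf'
  set S : F →L[𝕜] E := LinearMap.toContinuousLinearMap s
  have hfd : HasFDerivAt f f' x := (hf.differentiable hn x).hasFDerivAt
  have hcomp : f'.comp S = ContinuousLinearMap.id 𝕜 F := by
    refine HasFDerivAt.unique (f := fun w => f (x + s w)) (x := 0) ?_ hs
    have h1 : HasFDerivAt (fun w => x + S w) S 0 := S.hasFDerivAt.const_add x
    have h2 : HasFDerivAt f f' (x + S 0) := by simpa using hfd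
    exact h2.comp 0 h1
  have hfs : ∀ w, f' (S w) = w := fun w => DFunLike.congr_fun hcomp w
  -- `Φ₀ y = S (f y) + (y - S (f' y))`
  set Φ₀ : E → E := fun y => S (f y) + (y - S (f' y)) with hΦ₀
  have hc : ContDiff 𝕜 ∞ Φ₀ :=
    (S.contDiff.comp hf).add (contDiff_id.sub (S.contDiff.comp f'.contDiff))
  -- Since `f' ∘ S = 1`, the map `Φ₀` has derivative the identity at `x`, and `f' (Φ₀ y) = f y`. So
  -- `Φ₀` is a local chart that carries the zeros of `f` to the kernel of `f'`.
  have hder : HasFDerivAt Φ₀ ((ContinuousLinearEquiv.refl 𝕜 E : E ≃L[𝕜] E) : E →L[𝕜] E) x := by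
    have h1 : HasFDerivAt Φ₀ (S.comp f' + (ContinuousLinearMap.id 𝕜 E - S.comp f')) x :=
      (S.hasFDerivAt.comp x hfd).add ((hasFDerivAt_id x).sub
        (S.hasFDerivAt.comp x f'.hasFDerivAt))
    convert h1 using 1
    ext y
    simp
  have hca : ContDiffAt 𝕜 ∞ Φ₀ x := hc.contDiffAt
  set Ψ := hca.toOpenPartialHomeomorph Φ₀ hder hn with hΨ
  have hΨc : (Ψ : E → E) = Φ₀ := hca.toOpenPartialHomeomorph_coe hder hn
  have hxΨ : x ∈ Ψ.source := hca.mem_toOpenPartialHomeomorph_source hder hn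
  obtain ⟨U, hUB, hUo, hxU⟩ := eventually_nhds_iff.1 hB
  -- The inverse has to be smooth on the whole target and not only near the image of `x`, so the
  -- source is shrunk to the open set where the derivative is invertible.
  set D : Set E := {y | fderiv 𝕜 Φ₀ y ∈
    Set.range (ContinuousLinearEquiv.toContinuousLinearMap : (E ≃L[𝕜] E) → (E →L[𝕜] E))}
  have hDo : IsOpen D :=
    (ContinuousLinearEquiv.isOpen (𝕜 := 𝕜) (E := E) (F := E)).preimage (hc.continuous_fderiv hn)
  have hxD : x ∈ D := ⟨_, hder.fderiv.symm⟩
  refine ⟨Ψ.restrOpen (U ∩ D) (hUo.inter hDo), LinearMap.ker f'.toLinearMap, ?_, ?_, ?_, ?_, ?_⟩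
  · exact ⟨hxΨ, hxU, hxD⟩
  · change ContDiffOn 𝕜 ∞ Ψ _
    rw [hΨc]
    exact hc.contDiffOn
  · intro z hz
    refine ContDiffAt.contDiffWithinAt ?_
    change ContDiffAt 𝕜 ∞ Ψ.symm z
    have hz' := (Ψ.restrOpen (U ∩ D) (hUo.inter hDo)).map_target hz
    have hz1 : z ∈ Ψ.target := by
      have := (Ψ.restrOpen (U ∩ D) (hUo.inter hDo)).right_inv hz
      rw [← this]
      exact Ψ.map_source hz'.1
    obtain ⟨e, he⟩ := hz'.2.2
    refine OpenPartialHomeomorph.contDiffAt_symm Ψ (f₀' := e) hz1 ?_ ?_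
    · rw [hΨc]
      have := (hc.differentiable hn (Ψ.symm z)).hasFDerivAt
      rw [he]
      exact this
    · rw [hΨc]
      exact hc.contDiffAt
  · have h1 := LinearMap.finrank_range_add_finrank_ker f'.toLinearMap
    have h2 : LinearMap.range f'.toLinearMap = ⊤ :=
      LinearMap.range_eq_top.2 fun w => ⟨S w, hfs w⟩
    rw [h2, finrank_top] at h1
    omega
  · intro y hy
    rw [hUB y hy.2.1]
    change _ ↔ f' (Ψ y) = 0
    rw [hΨc]
    simp [hΦ₀, hfs]

theorem IsSubmanifoldAt.of_affine [FiniteDimensional 𝕜 E] [FiniteDimensional 𝕜 F]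
    {B : Set E} {d : ℕ} {x : E} (f : E → F) (hf : ContDiff 𝕜 ∞ f) (s : F →ₗ[𝕜] E)
    (hs : ∀ w, f (x + s w) = w)
    (hB : ∀ᶠ y in nhds x, y ∈ B ↔ f y = 0)
    (hd : d + Module.finrank 𝕜 F = Module.finrank 𝕜 E) : IsSubmanifoldAt 𝕜 B d x := by
  refine .of_regular f hf s ?_ hB hd
  simp only [hs]
  exact hasFDerivAt_id 0

end Submanifolds

theorem diagonal_fin_three {R : Type*} [Zero R] (d : Fin 3 → R) :
    Matrix.diagonal d = !![d 0, 0, 0; 0, d 1, 0; 0, 0, d 2] := by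
  ext i k
  fin_cases i <;> fin_cases k <;> rfl

theorem transpose_fin_three {R : Type*} (a b c d e f g h i : R) :
    !![a, b, c; d, e, f; g, h, i]ᵀ = !![a, d, g; b, e, h; c, f, i] := by
  ext i k
  fin_cases i <;> fin_cases k <;> rfl

theorem vec_three_zero {R : Type*} [Zero R] : (![0, 0, 0] : Fin 3 → R) = 0 := by
  ext i
  fin_cases i <;> rfl

/-! ### Moving within an orbit by congruences -/

section NormalForms

variable {𝕜 : Type} [RCLike 𝕜]

/-- The two equations say that `M` carries `(A, ν)` to `(B, μ)`, with all inverses cleared so that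
explicit matrices can be checked by multiplication. -/
theorem orbit_T_eq {A B M : Matrix (Fin 3) (Fin 3) 𝕜} {ν μ : V 𝕜} (hM : M.det ≠ 0)
    (h : M * A * Mᵀ = M.det • B) (hν : Mᵀ *ᵥ μ = ν) :
    MulAction.orbit (GL (Fin 3) 𝕜) (T A ν) = MulAction.orbit (GL (Fin 3) 𝕜) (T B μ) := by
  have key : Matrix.GeneralLinearGroup.mkOfDetNeZero M hM • T A ν = T B μ := by
    have hc : ((Matrix.GeneralLinearGroup.mkOfDetNeZero M hM : GL (Fin 3) 𝕜) :
        Matrix (Fin 3) (Fin 3) 𝕜) = M := rfl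
    rw [smul_T, hc, h, smul_smul, inv_mul_cancel₀ hM, one_smul, ← hν]
    congr 1
    conv_rhs => rw [← Matrix.one_mulVec μ]
    rw [Matrix.mulVec_mulVec]
    congr 1
    nth_rw 2 [← hc]
    rw [← Matrix.transpose_mul, ← Units.val_mul, mul_inv_cancel, Units.val_one,
      Matrix.transpose_one]
  rw [← key, MulAction.orbit_smul]

theorem orbit_T_smul (A : Matrix (Fin 3) (Fin 3) 𝕜) (ν : V 𝕜) {c : 𝕜} (hc : c ≠ 0) :
    MulAction.orbit (GL (Fin 3) 𝕜) (T A ν) = MulAction.orbit (GL (Fin 3) 𝕜) (T (c • A) (c • ν)) := by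
  rw [T_add_smul, ← scalarGL_smul c hc, MulAction.orbit_smul]

/-- The factor `det M⁻¹` of the action is undone by a scalar matrix. Plain congruences of `A`
therefore stay in the orbit, at the price of rescaling the covector. -/
theorem orbit_T_conj {A M : Matrix (Fin 3) (Fin 3) 𝕜} {ν : V 𝕜} (hM : M.det ≠ 0)
    (hν : A *ᵥ ν = 0) : ∃ μ : V 𝕜, (M * A * Mᵀ) *ᵥ μ = 0 ∧
      MulAction.orbit (GL (Fin 3) 𝕜) (T A ν) = MulAction.orbit (GL (Fin 3) 𝕜) (T (M * A * Mᵀ) μ) := by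
  have hu : IsUnit M.det := hM.isUnit
  have e : Mᵀ *ᵥ (M⁻¹ᵀ *ᵥ ν) = ν := by
    rw [Matrix.mulVec_mulVec, ← Matrix.transpose_mul, Matrix.nonsing_inv_mul _ hu,
      Matrix.transpose_one, Matrix.one_mulVec]
  refine ⟨M.det • (M⁻¹ᵀ *ᵥ ν), ?_, ?_⟩
  · rw [Matrix.mulVec_smul, ← Matrix.mulVec_mulVec, e, ← Matrix.mulVec_mulVec, hν,
      Matrix.mulVec_zero, smul_zero]
  · rw [orbit_T_eq (B := M.det⁻¹ • (M * A * Mᵀ)) (μ := M⁻¹ᵀ *ᵥ ν) hM _ e, orbit_T_smul _ _ hM,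
      smul_smul, mul_inv_cancel₀ hM, one_smul]
    rw [smul_smul, mul_inv_cancel₀ hM, one_smul]

/-- The rows of `M` are an orthogonal basis for the form `A`. -/
theorem exists_conj_diagonal {A : Matrix (Fin 3) (Fin 3) 𝕜} (hA : A.IsSymm) :
    ∃ (M : Matrix (Fin 3) (Fin 3) 𝕜) (d : Fin 3 → 𝕜), M.det ≠ 0 ∧ M * A * Mᵀ = Matrix.diagonal d := by
  have : Invertible (2 : 𝕜) := invertibleOfNonzero two_ne_zero
  set B : LinearMap.BilinForm 𝕜 (V 𝕜) := Matrix.toBilin' A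
  have hB : LinearMap.IsSymm B := by
    refine ⟨fun x y => ?_⟩
    simp only [B, Matrix.toBilin'_apply', RingHom.id_apply]
    rw [Matrix.dotProduct_mulVec, ← Matrix.mulVec_transpose, hA.eq, dotProduct_comm]
  obtain ⟨v, hv⟩ := LinearMap.BilinForm.exists_orthogonal_basis hB
  have h3 : Module.finrank 𝕜 (V 𝕜) = 3 := by simp
  set b := v.reindex (finCongr h3)
  have hb : ∀ i k, i ≠ k → b i ⬝ᵥ A *ᵥ b k = 0 := by
    intro i k hik
    rw [← Matrix.toBilin'_apply']
    simp only [b, Module.Basis.reindex_apply]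
    exact hv fun h => hik ((finCongr h3).symm.injective h)
  refine ⟨Matrix.of fun i => b i, fun i => b i ⬝ᵥ A *ᵥ b i, ?_, ?_⟩
  · have h1 : (Matrix.of fun i => b i) = ((Pi.basisFun 𝕜 (Fin 3)).toMatrix b)ᵀ := by
      ext i k
      simp [Module.Basis.toMatrix_apply]
    rw [h1, Matrix.det_transpose]
    have := (Pi.basisFun 𝕜 (Fin 3)).invertibleToMatrix b
    exact ((Matrix.isUnit_iff_isUnit_det _).1 (isUnit_of_invertible _)).ne_zero
  · ext i k
    have h2 : ((Matrix.of fun i => b i) * A * (Matrix.of fun i => b i)ᵀ) i k =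
        b i ⬝ᵥ A *ᵥ b k := by
      rw [Matrix.dotProduct_mulVec]
      rfl
    rw [h2]
    by_cases hik : i = k
    · rw [hik, Matrix.diagonal_apply_eq]
    · rw [Matrix.diagonal_apply_ne _ hik, hb i k hik]

theorem perm_conj_diagonal (σ : Equiv.Perm (Fin 3)) (d : Fin 3 → 𝕜) :
    (1 : Matrix (Fin 3) (Fin 3) 𝕜).submatrix σ id * Matrix.diagonal d *
      ((1 : Matrix (Fin 3) (Fin 3) 𝕜).submatrix σ id)ᵀ = Matrix.diagonal (d ∘ σ) := by
  ext i k
  rw [Matrix.mul_apply]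
  simp [Matrix.mul_diagonal, Matrix.one_apply, Matrix.diagonal_apply]
  aesop

theorem det_perm_ne_zero (σ : Equiv.Perm (Fin 3)) :
    ((1 : Matrix (Fin 3) (Fin 3) 𝕜).submatrix σ id).det ≠ 0 := by
  rw [Matrix.det_permute]
  simp

theorem orbit_T_perm {d : Fin 3 → 𝕜} {ν : V 𝕜} (hν : Matrix.diagonal d *ᵥ ν = 0)
    (σ : Equiv.Perm (Fin 3)) : ∃ μ : V 𝕜, Matrix.diagonal (d ∘ σ) *ᵥ μ = 0 ∧
      MulAction.orbit (GL (Fin 3) 𝕜) (T (Matrix.diagonal d) ν) =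
        MulAction.orbit (GL (Fin 3) 𝕜) (T (Matrix.diagonal (d ∘ σ)) μ) := by
  have h := orbit_T_conj (det_perm_ne_zero σ) hν
  rwa [perm_conj_diagonal] at h

/-- `N` picks a representative of a number modulo nonzero squares; over the reals it is the sign. -/
theorem exists_orbit_T_diagonal {A : Matrix (Fin 3) (Fin 3) 𝕜} (hA : A.IsSymm) {ν : V 𝕜}
    (hν : A *ᵥ ν = 0) (N : 𝕜 → 𝕜) (hN : ∀ x, ∃ r, r ≠ 0 ∧ r * x * r = N x) :
    ∃ (d : Fin 3 → 𝕜) (μ : V 𝕜), Matrix.diagonal (N ∘ d) *ᵥ μ = 0 ∧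
      MulAction.orbit (GL (Fin 3) 𝕜) (T A ν) =
        MulAction.orbit (GL (Fin 3) 𝕜) (T (Matrix.diagonal (N ∘ d)) μ) := by
  obtain ⟨M, d, hM, hd⟩ := exists_conj_diagonal hA
  obtain ⟨μ, hμ, h⟩ := orbit_T_conj hM hν
  rw [hd] at h hμ
  choose r hr hrN using hN
  obtain ⟨μ', hμ', h'⟩ := orbit_T_conj (M := Matrix.diagonal (r ∘ d)) (by
    rw [Matrix.det_diagonal]
    exact Finset.prod_ne_zero_iff.2 fun i _ => hr (d i)) hμ
  have e : Matrix.diagonal (r ∘ d) * Matrix.diagonal d * (Matrix.diagonal (r ∘ d))ᵀ =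
      Matrix.diagonal (N ∘ d) := by
    simp [Matrix.diagonal_transpose, Matrix.diagonal_mul_diagonal, hrN, Function.comp_def]
  rw [e] at h' hμ'
  exact ⟨d, μ', hμ', h.trans h'⟩

end NormalForms

/-! ### Reduction to Bianchi's list -/

section Real

/-- Sign vectors up to permutation and a common sign. The common sign is available because orbits
are stable under multiplication by `-1`. -/
theorem exists_sign_sort (s : Fin 3 → SignType) : ∃ (σ : Equiv.Perm (Fin 3)) (ε : SignType), ε ≠ 0 ∧
    ((fun i => ε * s (σ i)) = ![0, 0, 0] ∨ (fun i => ε * s (σ i)) = ![1, 0, 0] ∨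
     (fun i => ε * s (σ i)) = ![1, -1, 0] ∨ (fun i => ε * s (σ i)) = ![1, 1, 0] ∨
     (fun i => ε * s (σ i)) = ![1, 1, -1] ∨ (fun i => ε * s (σ i)) = ![1, 1, 1]) := by
  revert s
  decide

theorem rep_eq (t : BianchiClass) : t.rep = T t.mat t.covec := (T_def _ _).symm

theorem exists_orbit_T_sorted {A : Matrix (Fin 3) (Fin 3) ℝ} (hA : A.IsSymm) {ν : V ℝ}
    (hν : A *ᵥ ν = 0) : ∃ (d : Fin 3 → ℝ) (μ : V ℝ), Matrix.diagonal d *ᵥ μ = 0 ∧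
      (d = ![0, 0, 0] ∨ d = ![1, 0, 0] ∨ d = ![1, -1, 0] ∨ d = ![1, 1, 0] ∨ d = ![1, 1, -1] ∨
        d = ![1, 1, 1]) ∧
      MulAction.orbit (GL (Fin 3) ℝ) (T A ν) =
        MulAction.orbit (GL (Fin 3) ℝ) (T (Matrix.diagonal d) μ) := by
  obtain ⟨d, μ, hμ, h⟩ := exists_orbit_T_diagonal hA hν (fun x => ((SignType.sign x : SignType) : ℝ)) (by
    intro x
    rcases eq_or_ne x 0 with rfl | hx
    · exact ⟨1, one_ne_zero, by simp⟩
    · have hp : 0 < |x| := abs_pos.2 hx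
      refine ⟨(√|x|)⁻¹, inv_ne_zero (Real.sqrt_ne_zero'.2 hp), ?_⟩
      have h1 : (√|x|) ^ 2 = |x| := Real.sq_sqrt hp.le
      have h2 : √|x| ≠ 0 := Real.sqrt_ne_zero'.2 hp
      field_simp
      rw [h1, mul_comm]
      exact (sign_mul_abs x).symm)
  obtain ⟨σ, ε, hε, hs⟩ := exists_sign_sort (fun i => SignType.sign (d i))
  obtain ⟨μ', hμ', h'⟩ := orbit_T_perm hμ σ
  have hε' : ((ε : SignType) : ℝ) ≠ 0 := by
    revert hε
    cases ε <;> simp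
  replace h' := h'.trans (orbit_T_smul _ _ hε')
  rw [← Matrix.diagonal_smul] at h'
  have e : ((ε : ℝ) • (((fun x : ℝ => ((SignType.sign x : SignType) : ℝ)) ∘ d) ∘ σ)) =
      fun i => ((ε * SignType.sign (d (σ i)) : SignType) : ℝ) := by
    ext i
    simp
  refine ⟨_, _, ?_, ?_, h.trans h'⟩
  · rw [Matrix.diagonal_smul, Matrix.smul_mulVec, Matrix.mulVec_smul, hμ', smul_zero, smul_zero]
  · rw [e]
    have hc : ∀ a b c : SignType, (fun i => ε * SignType.sign (d (σ i))) = ![a, b, c] →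
        (fun i => ((ε * SignType.sign (d (σ i)) : SignType) : ℝ)) = ![(a : ℝ), (b : ℝ), (c : ℝ)] := by
      intro a b c h
      ext i
      have := congrFun h i
      rw [this]
      fin_cases i <;> rfl
    rcases hs with hs | hs | hs | hs | hs | hs <;> have := hc _ _ _ hs <;> simp at this <;>
      simp [this]

theorem diag_mulVec_eq {d ν : Fin 3 → ℝ} (h : Matrix.diagonal d *ᵥ ν = 0) (i : Fin 3) (hd : d i ≠ 0) :
    ν i = 0 := by
  have := congrFun h i
  rw [Matrix.mulVec_diagonal] at this
  exact (mul_eq_zero.1 this).resolve_left hd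

theorem exists_orbit_T_eq {A : Matrix (Fin 3) (Fin 3) ℝ} (hA : A.IsSymm) {ν : V ℝ}
    (hν : A *ᵥ ν = 0) : ∃ t : BianchiClass, MulAction.orbit (GL (Fin 3) ℝ) (T A ν) = t.orbit := by
  obtain ⟨d, μ, hμ, hd, h⟩ := exists_orbit_T_sorted hA hν
  rw [h]
  simp only [BianchiClass.orbit, rep_eq]
  clear h hν hA
  rcases hd with rfl | rfl | rfl | rfl | rfl | rfl
  · by_cases h2 : μ 2 = 0
    · by_cases h1 : μ 1 = 0
      · by_cases h0 : μ 0 = 0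
        · refine ⟨.I, ?_⟩
          congr 2
          ext i
          fin_cases i <;> simp [BianchiClass.covec, *]
        -- The last row of `M` is `μ`, so that `Mᵀ λ³ = μ`; two unit vectors, chosen by a nonzero
        -- coordinate of `μ`, complete it to an invertible matrix.
        · refine ⟨.V, orbit_T_eq (M := !![0, 1, 0; 0, 0, 1; μ 0, μ 1, μ 2]) ?_ ?_ ?_⟩
          · simp [Matrix.det_fin_three, h0]
          · simp [BianchiClass.mat, diagonal_fin_three, transpose_fin_three, vec_three_zero]
          · ext i; fin_cases i <;> simp [BianchiClass.covec, Matrix.mulVec, dotProduct, Fin.sum_univ_three]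
      · refine ⟨.V, orbit_T_eq (M := !![1, 0, 0; 0, 0, 1; μ 0, μ 1, μ 2]) ?_ ?_ ?_⟩
        · simp [Matrix.det_fin_three, h1]
        · simp [BianchiClass.mat, diagonal_fin_three, transpose_fin_three, vec_three_zero]
        · ext i; fin_cases i <;> simp [BianchiClass.covec, Matrix.mulVec, dotProduct, Fin.sum_univ_three]
    · refine ⟨.V, orbit_T_eq (M := !![1, 0, 0; 0, 1, 0; μ 0, μ 1, μ 2]) ?_ ?_ ?_⟩
      · simp [Matrix.det_fin_three, h2]
      · simp [BianchiClass.mat, diagonal_fin_three, transpose_fin_three, vec_three_zero]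
      · ext i; fin_cases i <;> simp [BianchiClass.covec, Matrix.mulVec, dotProduct, Fin.sum_univ_three]
  · have h0 : μ 0 = 0 := diag_mulVec_eq hμ 0 (by simp)
    by_cases h2 : μ 2 = 0
    · by_cases h1 : μ 1 = 0
      · refine ⟨.II, ?_⟩
        congr 2
        ext i
        fin_cases i <;> simp [BianchiClass.covec, *]
      -- The last row is again `μ`. The corner entry is chosen with square `det M`, because `M A Mᵀ`
      -- is that square times `A`.
      · refine ⟨.IV, orbit_T_eq (M := !![-μ 1, 0, 0; 0, 0, 1; 0, μ 1, 0]) ?_ ?_ ?_⟩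
        · simp [Matrix.det_fin_three, h1]
        · simp [BianchiClass.mat, diagonal_fin_three, transpose_fin_three, Matrix.det_fin_three,
            vec_three_zero]
        · ext i; fin_cases i <;> simp [BianchiClass.covec, Matrix.mulVec, dotProduct, Fin.sum_univ_three, *]
    · refine ⟨.IV, orbit_T_eq (M := !![μ 2, 0, 0; 0, 1, 0; 0, μ 1, μ 2]) ?_ ?_ ?_⟩
      · simp [Matrix.det_fin_three, h2]
      · simp [BianchiClass.mat, diagonal_fin_three, transpose_fin_three, Matrix.det_fin_three,
            vec_three_zero]
      · ext i; fin_cases i <;> simp [BianchiClass.covec, Matrix.mulVec, dotProduct, Fin.sum_univ_three, *]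
  · have h0 : μ 0 = 0 := diag_mulVec_eq hμ 0 (by simp)
    have h1 : μ 1 = 0 := diag_mulVec_eq hμ 1 (by simp)
    rcases le_total (μ 2) 0 with h2 | h2
    · refine ⟨.VI (μ 2) h2, ?_⟩
      congr 2
      ext i
      fin_cases i <;> simp [BianchiClass.covec, *]
    -- The half turn `diag(1, -1, -1)` has determinant one, fixes every diagonal form and reverses
    -- `λ³`; so the sign of `h` is a matter of convention.
    · refine ⟨.VI (-μ 2) (neg_nonpos.2 h2), orbit_T_eq (M := !![1, 0, 0; 0, -1, 0; 0, 0, -1]) ?_ ?_ ?_⟩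
      · simp [Matrix.det_fin_three]
      · simp [BianchiClass.mat, diagonal_fin_three, transpose_fin_three, Matrix.det_fin_three,
            vec_three_zero]
      · ext i; fin_cases i <;> simp [BianchiClass.covec, Matrix.mulVec, dotProduct, Fin.sum_univ_three, *]
  · have h0 : μ 0 = 0 := diag_mulVec_eq hμ 0 (by simp)
    have h1 : μ 1 = 0 := diag_mulVec_eq hμ 1 (by simp)
    rcases le_total 0 (μ 2) with h2 | h2
    · refine ⟨.VII (μ 2) h2, ?_⟩
      congr 2
      ext i
      fin_cases i <;> simp [BianchiClass.covec, *]
    · refine ⟨.VII (-μ 2) (neg_nonneg.2 h2), orbit_T_eq (M := !![1, 0, 0; 0, -1, 0; 0, 0, -1]) ?_ ?_ ?_⟩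
      · simp [Matrix.det_fin_three]
      · simp [BianchiClass.mat, diagonal_fin_three, transpose_fin_three, Matrix.det_fin_three,
            vec_three_zero]
      · ext i; fin_cases i <;> simp [BianchiClass.covec, Matrix.mulVec, dotProduct, Fin.sum_univ_three, *]
  · refine ⟨.VIII, ?_⟩
    congr 2
    ext i
    have := diag_mulVec_eq hμ i
    fin_cases i <;> simp_all [BianchiClass.covec]
  · refine ⟨.IX, ?_⟩
    congr 2
    ext i
    have := diag_mulVec_eq hμ i
    fin_cases i <;> simp_all [BianchiClass.covec]

end Real

/-! ### Quadratic forms and the adjugate -/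

section Forms

variable {𝕜 : Type} [RCLike 𝕜]

/-- The quadratic form of a matrix. -/
def qf (A : Matrix (Fin 3) (Fin 3) 𝕜) (x : V 𝕜) : 𝕜 := x ⬝ᵥ A *ᵥ x

theorem qf_conj (A M : Matrix (Fin 3) (Fin 3) 𝕜) (x : V 𝕜) :
    qf (M * A * Mᵀ) x = qf A (Mᵀ *ᵥ x) := by
  rw [qf, qf, ← Matrix.mulVec_mulVec, ← Matrix.mulVec_mulVec, Matrix.dotProduct_mulVec,
    Matrix.mulVec_transpose]

theorem qf_smul (A : Matrix (Fin 3) (Fin 3) 𝕜) (c : 𝕜) (x : V 𝕜) : qf (c • A) x = c * qf A x := by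
  rw [qf, qf, Matrix.smul_mulVec, dotProduct_smul, smul_eq_mul]

theorem mul_inv_GL (g : GL (Fin 3) 𝕜) : (g : Matrix (Fin 3) (Fin 3) 𝕜) *
    ((g⁻¹ : GL (Fin 3) 𝕜) : Matrix (Fin 3) (Fin 3) 𝕜) = 1 := by
  rw [← Units.val_mul, mul_inv_cancel, Units.val_one]

theorem inv_mul_GL (g : GL (Fin 3) 𝕜) : ((g⁻¹ : GL (Fin 3) 𝕜) : Matrix (Fin 3) (Fin 3) 𝕜) *
    (g : Matrix (Fin 3) (Fin 3) 𝕜) = 1 := by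
  rw [← Units.val_mul, inv_mul_cancel, Units.val_one]

/-- The adjugate of the symmetric matrix of a bracket transforms like a quadratic form on `V`. -/
theorem adjugate_conj (g : GL (Fin 3) 𝕜) (A : Matrix (Fin 3) (Fin 3) 𝕜) :
    ((g : Matrix (Fin 3) (Fin 3) 𝕜).det⁻¹ • ((g : Matrix (Fin 3) (Fin 3) 𝕜) * A *
      (g : Matrix (Fin 3) (Fin 3) 𝕜)ᵀ)).adjugate =
    ((g⁻¹ : GL (Fin 3) 𝕜) : Matrix (Fin 3) (Fin 3) 𝕜)ᵀ * A.adjugate *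
      ((g⁻¹ : GL (Fin 3) 𝕜) : Matrix (Fin 3) (Fin 3) 𝕜)ᵀᵀ := by
  have hd := GL_det_ne_zero g
  have h1 : (g : Matrix (Fin 3) (Fin 3) 𝕜).adjugate = (g : Matrix (Fin 3) (Fin 3) 𝕜).det •
      ((g⁻¹ : GL (Fin 3) 𝕜) : Matrix (Fin 3) (Fin 3) 𝕜) := by
    have h := congrArg (· * ((g⁻¹ : GL (Fin 3) 𝕜) : Matrix (Fin 3) (Fin 3) 𝕜))
      (Matrix.adjugate_mul (g : Matrix (Fin 3) (Fin 3) 𝕜))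
    simp only [Matrix.mul_assoc, mul_inv_GL, Matrix.mul_one, Matrix.smul_mul, Matrix.one_mul] at h
    exact h
  rw [Matrix.adjugate_smul, Matrix.adjugate_mul_distrib, Matrix.adjugate_mul_distrib,
    ← Matrix.adjugate_transpose, h1, Matrix.transpose_smul, Matrix.transpose_transpose]
  simp only [Matrix.smul_mul, Matrix.mul_smul, smul_smul, Matrix.mul_assoc, Fintype.card_fin]
  -- The adjugate is quadratic in the entries: it squares `det g⁻¹`, and the two factors `adj g =
  -- det g · g⁻¹` compensate exactly.
  have : (g : Matrix (Fin 3) (Fin 3) 𝕜).det⁻¹ ^ (3 - 1) * ((g : Matrix (Fin 3) (Fin 3) 𝕜).det *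
      (g : Matrix (Fin 3) (Fin 3) 𝕜).det) = 1 := by
    norm_num
    field_simp
  rw [this, one_smul]

theorem mat_smul (g : GL (Fin 3) 𝕜) (C : W 𝕜) :
    mat (g • C) = (g : Matrix (Fin 3) (Fin 3) 𝕜).det⁻¹ • ((g : Matrix (Fin 3) (Fin 3) 𝕜) * mat C *
      (g : Matrix (Fin 3) (Fin 3) 𝕜)ᵀ) := by
  conv_lhs => rw [← T_mat_cov C, smul_T, mat_T (isSymm_conj (mat_isSymm C) _ _)]

theorem cov_smul (g : GL (Fin 3) 𝕜) (C : W 𝕜) :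
    cov (g • C) = ((g⁻¹ : GL (Fin 3) 𝕜) : Matrix (Fin 3) (Fin 3) 𝕜)ᵀ *ᵥ cov C := by
  conv_lhs => rw [← T_mat_cov C, smul_T, cov_T (isSymm_conj (mat_isSymm C) _ _)]

theorem continuous_qf : Continuous fun p : Matrix (Fin 3) (Fin 3) 𝕜 × V 𝕜 => qf p.1 p.2 :=
  Continuous.dotProduct continuous_snd (continuous_fst.matrix_mulVec continuous_snd)

end Forms

/-! ### Definiteness, and the closed sets that are to be the orbit closures -/

/-- Definite real quadratic forms. -/
def IsDefinite (A : Matrix (Fin 3) (Fin 3) ℝ) : Prop :=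
  (∀ x, x ≠ 0 → 0 < qf A x) ∨ ∀ x, x ≠ 0 → qf A x < 0

/-- Sylvester's criterion. It makes definiteness an open condition, which is needed both for the
closedness of `Z VIII` and near the representative of `IX`. -/
theorem pos_iff_minors (w : Fin 6 → ℝ) : (∀ x, x ≠ 0 → 0 < qf (sym w) x) ↔
    0 < w 0 ∧ 0 < w 0 * w 3 - w 1 ^ 2 ∧ 0 < (sym w).det := by
  have hq : ∀ x : V ℝ, qf (sym w) x = w 0 * x 0 ^ 2 + w 3 * x 1 ^ 2 + w 5 * x 2 ^ 2 +
      2 * w 1 * x 0 * x 1 + 2 * w 2 * x 0 * x 2 + 2 * w 4 * x 1 * x 2 := by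
    intro x
    simp [qf, sym, Matrix.mulVec, dotProduct, Fin.sum_univ_three]
    ring
  have hdet : (sym w).det = w 0 * w 3 * w 5 + 2 * w 1 * w 2 * w 4 - w 0 * w 4 ^ 2 - w 3 * w 2 ^ 2 -
      w 5 * w 1 ^ 2 := by
    simp [sym, Matrix.det_fin_three]
    ring
  constructor
  · intro h
    have h0 : 0 < w 0 := by
      have := h ![1, 0, 0] (by intro h; simpa using congrFun h 0)
      simpa [hq] using this
    have h1 : 0 < w 0 * w 3 - w 1 ^ 2 := by
      -- This vector is orthogonal to `e₁` for the form; its value is `w 0` times the second minor.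
      have := h ![-w 1, w 0, 0] (by
        intro h
        have := congrFun h 1
        simp at this
        exact h0.ne' this)
      simp [hq] at this
      refine pos_of_mul_pos_right (a := w 0) (by linarith) h0.le
    refine ⟨h0, h1, ?_⟩
    -- The last column of the adjugate, which `A` sends to `det A · e₃`; the value of the form is
    -- the second minor times the determinant.
    have := h ![w 1 * w 4 - w 2 * w 3, w 1 * w 2 - w 0 * w 4, w 0 * w 3 - w 1 ^ 2] (by
      intro h
      have := congrFun h 2
      simp at this
      exact h1.ne' this)
    simp [hq] at this
    rw [hdet]
    refine pos_of_mul_pos_right (a := w 0 * w 3 - w 1 ^ 2) (by linarith) h1.le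
  · rintro ⟨h0, h1, h2⟩ x hx
    rw [hq]
    rw [hdet] at h2
    set m := w 0 * w 3 - w 1 ^ 2 with hm
    refine pos_of_mul_pos_right (a := w 0 * m) ?_ (mul_pos h0 h1).le
    -- Completion of squares, with denominators cleared by `w 0 * m`.
    have key : w 0 * m * (w 0 * x 0 ^ 2 + w 3 * x 1 ^ 2 + w 5 * x 2 ^ 2 +
        2 * w 1 * x 0 * x 1 + 2 * w 2 * x 0 * x 2 + 2 * w 4 * x 1 * x 2) =
        m * (w 0 * x 0 + w 1 * x 1 + w 2 * x 2) ^ 2 +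
        (m * x 1 + (w 0 * w 4 - w 1 * w 2) * x 2) ^ 2 +
        w 0 * (w 0 * w 3 * w 5 + 2 * w 1 * w 2 * w 4 - w 0 * w 4 ^ 2 - w 3 * w 2 ^ 2 -
      w 5 * w 1 ^ 2) * x 2 ^ 2 := by
      rw [hm]
      ring
    rw [key]
    by_cases hx2 : x 2 = 0
    · by_cases hx1 : x 1 = 0
      · have hx0 : x 0 ≠ 0 := by
          intro hx0
          apply hx
          ext i
          fin_cases i <;> assumption
        simp only [hx1, hx2]
        have : 0 < w 0 * x 0 + w 1 * 0 + w 2 * 0 ∨ w 0 * x 0 + w 1 * 0 + w 2 * 0 < 0 := by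
          rcases hx0.lt_or_gt with h | h
          · right; nlinarith
          · left; nlinarith
        have := mul_pos h1 (sq_pos_iff.2 (this.elim ne_of_gt ne_of_lt))
        nlinarith
      · simp only [hx2]
        have h3 : 0 < (m * x 1 + (w 0 * w 4 - w 1 * w 2) * 0) ^ 2 := by
          apply sq_pos_of_ne_zero
          simpa using ⟨h1.ne', hx1⟩
        have h4 : 0 ≤ m * (w 0 * x 0 + w 1 * x 1 + w 2 * 0) ^ 2 := mul_nonneg h1.le (sq_nonneg _)
        linarith
    · have h3 := mul_pos (mul_pos h0 h2) (sq_pos_of_ne_zero hx2)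
      have h4 : 0 ≤ m * (w 0 * x 0 + w 1 * x 1 + w 2 * x 2) ^ 2 := mul_nonneg h1.le (sq_nonneg _)
      have h5 := sq_nonneg (m * x 1 + (w 0 * w 4 - w 1 * w 2) * x 2)
      linarith

theorem sym_neg (w : Fin 6 → ℝ) : sym (-w) = -sym w := by
  ext i k
  fin_cases i <;> fin_cases k <;> rfl

theorem isOpen_isDefinite : IsOpen {w : Fin 6 → ℝ | IsDefinite (sym w)} := by
  have h1 : IsOpen {w : Fin 6 → ℝ | ∀ x, x ≠ 0 → 0 < qf (sym w) x} := by
    simp only [pos_iff_minors]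
    have h1 : Continuous fun w : Fin 6 → ℝ => w 0 := by fun_prop
    have h2 : Continuous fun w : Fin 6 → ℝ => w 0 * w 3 - w 1 ^ 2 := by fun_prop
    exact (isOpen_lt continuous_const h1).inter ((isOpen_lt continuous_const h2).inter
        (isOpen_lt continuous_const (continuous_sym.matrix_det)))
  have h2 : {w : Fin 6 → ℝ | IsDefinite (sym w)} = {w | ∀ x, x ≠ 0 → 0 < qf (sym w) x} ∪
      (fun w => -w) ⁻¹' {w | ∀ x, x ≠ 0 → 0 < qf (sym w) x} := by
    ext w
    have : ∀ x, qf (sym (-w)) x = - qf (sym w) x := by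
      intro x
      rw [sym_neg, ← neg_one_smul ℝ, qf_smul, neg_one_mul]
    simp [IsDefinite, this]
  rw [h2]
  exact h1.union (h1.preimage continuous_neg)

/-- The conditions on the pair `(A, ν)` that define the closure of an orbit. -/
def closureCond : BianchiClass → Matrix (Fin 3) (Fin 3) ℝ → V ℝ → Prop
  | .I, A, ν => A = 0 ∧ ν = 0
  | .II, A, ν => A.adjugate = 0 ∧ ν = 0
  | .IV, A, ν => A.adjugate = 0 ∧ A *ᵥ ν = 0
  | .V, A, _ => A = 0
  | .VI h _, A, ν => A *ᵥ ν = 0 ∧ A.det = 0 ∧ (∀ x, qf A.adjugate x ≤ 0) ∧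
      Matrix.vecMulVec ν ν = (-h ^ 2) • A.adjugate
  | .VII h _, A, ν => A *ᵥ ν = 0 ∧ A.det = 0 ∧ (∀ x, 0 ≤ qf A.adjugate x) ∧
      Matrix.vecMulVec ν ν = h ^ 2 • A.adjugate
  | .VIII, A, ν => ¬ IsDefinite A ∧ ν = 0
  | .IX, A, ν => ((∀ x, 0 ≤ qf A x) ∨ ∀ x, qf A x ≤ 0) ∧ ν = 0

/-- All the sets lie in the Lie variety, so each of their points belongs to an orbit of the list. -/
theorem closureCond_mulVec {t : BianchiClass} {A : Matrix (Fin 3) (Fin 3) ℝ} {ν : V ℝ}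
    (h : closureCond t A ν) : A *ᵥ ν = 0 := by
  cases t
  all_goals
    first
    | (obtain ⟨-, rfl⟩ := h; exact Matrix.mulVec_zero _)
    | exact h.1
    | exact h.2
    | (obtain rfl : A = 0 := h; exact Matrix.zero_mulVec _)

/-- The closure of the orbit of a class, defined by equations and inequalities. -/
def Z (t : BianchiClass) : Set (W ℝ) := {C | closureCond t (mat C) (cov C)}

theorem isClosed_Z (t : BianchiClass) : IsClosed (Z t) := by
  have hm : Continuous (mat : W ℝ → _) := continuous_mat
  have hc : Continuous (cov : W ℝ → _) := continuous_cov
  have hadj : Continuous fun C : W ℝ => (mat C).adjugate := hm.matrix_adjugate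
  have hmv : Continuous fun C : W ℝ => mat C *ᵥ cov C := hm.matrix_mulVec hc
  have hvv : Continuous fun C : W ℝ => Matrix.vecMulVec (cov C) (cov C) := hc.matrix_vecMulVec hc
  have hdet : Continuous fun C : W ℝ => (mat C).det := hm.matrix_det
  have hq : ∀ x, Continuous fun C : W ℝ => qf (mat C) x := fun x =>
    continuous_qf.comp₂ hm continuous_const
  have hqa : ∀ x, Continuous fun C : W ℝ => qf (mat C).adjugate x := fun x =>
    continuous_qf.comp₂ hadj continuous_const
  have hle : ∀ {f : V ℝ → W ℝ → ℝ}, (∀ x, Continuous (f x)) → IsClosed {C | ∀ x, f x C ≤ 0} := by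
    intro f hf
    rw [Set.ofPred_forall]
    exact isClosed_iInter fun x => isClosed_le (hf x) continuous_const
  have hge : ∀ {f : V ℝ → W ℝ → ℝ}, (∀ x, Continuous (f x)) → IsClosed {C | ∀ x, 0 ≤ f x C} := by
    intro f hf
    rw [Set.ofPred_forall]
    exact isClosed_iInter fun x => isClosed_le continuous_const (hf x)
  cases t with
  | I => exact (isClosed_eq hm continuous_const).inter (isClosed_eq hc continuous_const)
  | II => exact (isClosed_eq hadj continuous_const).inter (isClosed_eq hc continuous_const)
  | IV => exact (isClosed_eq hadj continuous_const).inter (isClosed_eq hmv continuous_const)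
  | V => exact isClosed_eq hm continuous_const
  | VI h hh =>
    exact (isClosed_eq hmv continuous_const).inter ((isClosed_eq hdet continuous_const).inter
      ((hle hqa).inter (isClosed_eq hvv (hadj.const_smul (-h ^ 2)))))
  | VII h hh =>
    exact (isClosed_eq hmv continuous_const).inter ((isClosed_eq hdet continuous_const).inter
      ((hge hqa).inter (isClosed_eq hvv (hadj.const_smul (h ^ 2)))))
  | VIII =>
    refine IsClosed.inter ?_ (isClosed_eq hc continuous_const)
    exact (isOpen_isDefinite.preimage continuous_matL).isClosed_compl
  | IX => exact ((hge hq).union (hle hq)).inter (isClosed_eq hc continuous_const)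

/-- The relation between `ν νᵀ` and `adj A` is preserved because both undergo the same congruence,
and so is the sign of `adj A`. The sign of `A` itself may change with that of `det g`, which is why
the conditions for `VIII` and `IX` are symmetric under `A ↦ -A`. -/
theorem smul_mem_Z {t : BianchiClass} (g : GL (Fin 3) ℝ) {C : W ℝ} (h : C ∈ Z t) : g • C ∈ Z t := by
  have hd := GL_det_ne_zero g
  have h0 := closureCond_mulVec h
  change closureCond t _ _ at h
  change closureCond t _ _
  rw [mat_smul, cov_smul]
  generalize mat C = A at *
  generalize cov C = ν at *
  have hA : A = 0 → (g : Matrix (Fin 3) (Fin 3) ℝ).det⁻¹ • ((g : Matrix (Fin 3) (Fin 3) ℝ) * A *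
      (g : Matrix (Fin 3) (Fin 3) ℝ)ᵀ) = 0 := by
    rintro rfl
    simp
  have hν : ν = 0 → ((g⁻¹ : GL (Fin 3) ℝ) : Matrix (Fin 3) (Fin 3) ℝ)ᵀ *ᵥ ν = 0 := by
    rintro rfl
    simp
  have hAν : ((g : Matrix (Fin 3) (Fin 3) ℝ).det⁻¹ • ((g : Matrix (Fin 3) (Fin 3) ℝ) * A *
      (g : Matrix (Fin 3) (Fin 3) ℝ)ᵀ)) *ᵥ
        (((g⁻¹ : GL (Fin 3) ℝ) : Matrix (Fin 3) (Fin 3) ℝ)ᵀ *ᵥ ν) = 0 := by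
    rw [Matrix.smul_mulVec, ← Matrix.mulVec_mulVec, ← Matrix.mulVec_mulVec,
      Matrix.mulVec_mulVec ν, ← Matrix.transpose_mul, inv_mul_GL, Matrix.transpose_one,
      Matrix.one_mulVec, h0, Matrix.mulVec_zero, smul_zero]
  have hdet : A.det = 0 → ((g : Matrix (Fin 3) (Fin 3) ℝ).det⁻¹ • ((g : Matrix (Fin 3) (Fin 3) ℝ) *
      A * (g : Matrix (Fin 3) (Fin 3) ℝ)ᵀ)).det = 0 := by
    intro h
    simp [Matrix.det_smul, h]
  have hvv : ∀ c : ℝ, Matrix.vecMulVec ν ν = c • A.adjugate →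
      Matrix.vecMulVec (((g⁻¹ : GL (Fin 3) ℝ) : Matrix (Fin 3) (Fin 3) ℝ)ᵀ *ᵥ ν)
        (((g⁻¹ : GL (Fin 3) ℝ) : Matrix (Fin 3) (Fin 3) ℝ)ᵀ *ᵥ ν) =
      c • (((g⁻¹ : GL (Fin 3) ℝ) : Matrix (Fin 3) (Fin 3) ℝ)ᵀ * A.adjugate *
      ((g⁻¹ : GL (Fin 3) ℝ) : Matrix (Fin 3) (Fin 3) ℝ)ᵀᵀ) := by
    intro c h
    rw [← Matrix.smul_mul, ← Matrix.mul_smul, ← h, Matrix.mul_vecMulVec, Matrix.vecMulVec_mul,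
      Matrix.vecMul_transpose]
  have hadj := adjugate_conj g A
  have hq : ∀ x, qf ((g : Matrix (Fin 3) (Fin 3) ℝ).det⁻¹ • ((g : Matrix (Fin 3) (Fin 3) ℝ) *
      A * (g : Matrix (Fin 3) (Fin 3) ℝ)ᵀ)) x = (g : Matrix (Fin 3) (Fin 3) ℝ).det⁻¹ *
        qf A ((g : Matrix (Fin 3) (Fin 3) ℝ)ᵀ *ᵥ x) := by
    intro x
    rw [qf_smul, qf_conj]
  cases t with
  | I => exact ⟨hA h.1, hν h.2⟩
  | II =>
    refine ⟨?_, hν h.2⟩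
    rw [hadj, h.1]
    simp
  | IV =>
    refine ⟨?_, hAν⟩
    rw [hadj, h.1]
    simp
  | V => exact hA h
  | VI k hk =>
    refine ⟨hAν, hdet h.2.1, fun x => ?_, ?_⟩
    · rw [hadj, qf_conj]
      exact h.2.2.1 _
    · rw [hadj]
      exact hvv _ h.2.2.2
  | VII k hk =>
    refine ⟨hAν, hdet h.2.1, fun x => ?_, ?_⟩
    · rw [hadj, qf_conj]
      exact h.2.2.1 _
    · rw [hadj]
      exact hvv _ h.2.2.2
  | VIII =>
    refine ⟨fun hD => h.1 ?_, hν h.2⟩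
    have hx : ∀ x : V ℝ, (g : Matrix (Fin 3) (Fin 3) ℝ)ᵀ *ᵥ
        (((g⁻¹ : GL (Fin 3) ℝ) : Matrix (Fin 3) (Fin 3) ℝ)ᵀ *ᵥ x) = x := by
      intro x
      rw [Matrix.mulVec_mulVec, ← Matrix.transpose_mul, inv_mul_GL, Matrix.transpose_one,
        Matrix.one_mulVec]
    have hx0 : ∀ x : V ℝ, x ≠ 0 →
        ((g⁻¹ : GL (Fin 3) ℝ) : Matrix (Fin 3) (Fin 3) ℝ)ᵀ *ᵥ x ≠ 0 := by
      intro x hx' h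
      apply hx'
      rw [← hx x, h, Matrix.mulVec_zero]
    rcases hD with hD | hD
    · rcases hd.lt_or_gt with hs | hs
      · refine Or.inr fun x hx' => ?_
        have := hD _ (hx0 x hx')
        rw [hq, hx] at this
        exact neg_of_mul_pos_right this (inv_nonpos.2 hs.le)
      · refine Or.inl fun x hx' => ?_
        have := hD _ (hx0 x hx')
        rw [hq, hx] at this
        exact pos_of_mul_pos_right this (inv_nonneg.2 hs.le)
    · rcases hd.lt_or_gt with hs | hs
      · refine Or.inl fun x hx' => ?_
        have := hD _ (hx0 x hx')
        rw [hq, hx] at this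
        exact pos_of_mul_neg_right this (inv_nonpos.2 hs.le)
      · refine Or.inr fun x hx' => ?_
        have := hD _ (hx0 x hx')
        rw [hq, hx] at this
        exact neg_of_mul_neg_right this (inv_nonneg.2 hs.le)
  | IX =>
    refine ⟨?_, hν h.2⟩
    simp only [hq]
    rcases h.1 with hD | hD
    · rcases hd.lt_or_gt with hs | hs
      · exact Or.inr fun x => mul_nonpos_of_nonpos_of_nonneg (inv_nonpos.2 hs.le) (hD _)
      · exact Or.inl fun x => mul_nonneg (inv_nonneg.2 hs.le) (hD _)
    · rcases hd.lt_or_gt with hs | hs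
      · exact Or.inl fun x => mul_nonneg_of_nonpos_of_nonpos (inv_nonpos.2 hs.le) (hD _)
      · exact Or.inr fun x => mul_nonpos_of_nonneg_of_nonpos (inv_nonneg.2 hs.le) (hD _)

theorem mat_isSymm_rep (t : BianchiClass) : t.mat.IsSymm := by
  cases t <;> exact Matrix.isSymm_diagonal _

theorem mat_rep (t : BianchiClass) : mat t.rep = t.mat := by
  rw [rep_eq, mat_T (mat_isSymm_rep t)]

theorem cov_rep (t : BianchiClass) : cov t.rep = t.covec := by
  rw [rep_eq, cov_T (mat_isSymm_rep t)]

/-! ### The closure order, read off from the representatives -/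

/-- The closure order on the classes. -/
def Degenerates (s t : BianchiClass) : Prop :=
  s = t ∨ s = .I ∨ (s = .II ∧ t ≠ .I ∧ t ≠ .V) ∨ (s = .V ∧ t = .IV) ∨
    (s = .VI₀ ∧ t = .VIII) ∨ (s = .VII₀ ∧ (t = .VIII ∨ t = .IX))

theorem qf_diagonal (d : Fin 3 → ℝ) (x : V ℝ) :
    qf (Matrix.diagonal d) x = d 0 * x 0 ^ 2 + d 1 * x 1 ^ 2 + d 2 * x 2 ^ 2 := by
  simp [qf, dotProduct, Fin.sum_univ_three, Matrix.mulVec_diagonal]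
  ring

theorem qf_diagonal_neg (d : Fin 3 → ℝ) (x : V ℝ) :
    qf (Matrix.diagonal (-d)) x = -qf (Matrix.diagonal d) x := by
  simp only [qf_diagonal, Pi.neg_apply]
  ring

theorem adjugate_diagonal_fin_three (d : Fin 3 → ℝ) :
    (Matrix.diagonal d).adjugate = Matrix.diagonal ![d 1 * d 2, d 0 * d 2, d 0 * d 1] := by
  rw [diagonal_fin_three, diagonal_fin_three, Matrix.adjugate_fin_three]
  simp

theorem vecMulVec_eq_iff (a c : ℝ) (d : Fin 3 → ℝ) :
    Matrix.vecMulVec ![0, 0, a] ![0, 0, a] = c • Matrix.diagonal d ↔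
      0 = c * d 0 ∧ 0 = c * d 1 ∧ a * a = c * d 2 := by
  constructor
  · intro h
    have := fun i => congrFun (congrFun h i) i
    refine ⟨?_, ?_, ?_⟩
    · simpa [Matrix.vecMulVec_apply] using this 0
    · simpa [Matrix.vecMulVec_apply] using this 1
    · simpa [Matrix.vecMulVec_apply] using this 2
  · rintro ⟨h0, h1, h2⟩
    ext i k
    rw [diagonal_fin_three]
    fin_cases i <;> fin_cases k <;> simp [Matrix.vecMulVec_apply, ← h0, ← h1, ← h2]

theorem diagonal_eq_zero_iff (d : Fin 3 → ℝ) :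
    Matrix.diagonal d = 0 ↔ d 0 = 0 ∧ d 1 = 0 ∧ d 2 = 0 := by
  rw [diagonal_fin_three]
  simp [← Matrix.ext_iff, Fin.forall_fin_succ]

theorem diagonal_mulVec_eq_zero_iff (d : Fin 3 → ℝ) (a : ℝ) :
    Matrix.diagonal d *ᵥ ![0, 0, a] = 0 ↔ d 2 * a = 0 := by
  simp [funext_iff, Fin.forall_fin_succ, Matrix.mulVec_diagonal]

theorem covec_eq_zero_iff (a : ℝ) : (![0, 0, a] : V ℝ) = 0 ↔ a = 0 := by
  simp [funext_iff, Fin.forall_fin_succ]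

theorem qf_diagonal_nonneg_iff (d : Fin 3 → ℝ) :
    (∀ x, 0 ≤ qf (Matrix.diagonal d) x) ↔ 0 ≤ d 0 ∧ 0 ≤ d 1 ∧ 0 ≤ d 2 := by
  simp only [qf_diagonal]
  refine ⟨fun h => ⟨?_, ?_, ?_⟩, fun h x => ?_⟩
  · simpa using h ![1, 0, 0]
  · simpa using h ![0, 1, 0]
  · simpa using h ![0, 0, 1]
  · have h0 := mul_nonneg h.1 (sq_nonneg (x 0))
    have h1 := mul_nonneg h.2.1 (sq_nonneg (x 1))
    have h2 := mul_nonneg h.2.2 (sq_nonneg (x 2))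
    linarith

theorem qf_diagonal_nonpos_iff (d : Fin 3 → ℝ) :
    (∀ x, qf (Matrix.diagonal d) x ≤ 0) ↔ d 0 ≤ 0 ∧ d 1 ≤ 0 ∧ d 2 ≤ 0 := by
  have h := qf_diagonal_nonneg_iff (-d)
  simpa [qf_diagonal_neg] using h

theorem isDefinite_diagonal_iff (d : Fin 3 → ℝ) :
    IsDefinite (Matrix.diagonal d) ↔
      (0 < d 0 ∧ 0 < d 1 ∧ 0 < d 2) ∨ (d 0 < 0 ∧ d 1 < 0 ∧ d 2 < 0) := by
  have e : ∀ i : Fin 3, (Pi.single i 1 : V ℝ) ≠ 0 := fun i => by simp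
  have hp : ∀ d : Fin 3 → ℝ, (∀ x, x ≠ 0 → 0 < qf (Matrix.diagonal d) x) ↔
      0 < d 0 ∧ 0 < d 1 ∧ 0 < d 2 := by
    intro d
    simp only [qf_diagonal]
    refine ⟨fun h => ⟨?_, ?_, ?_⟩, fun h x hx => ?_⟩
    · simpa using h _ (e 0)
    · simpa using h _ (e 1)
    · simpa using h _ (e 2)
    · have h0 := mul_nonneg h.1.le (sq_nonneg (x 0))
      have h1 := mul_nonneg h.2.1.le (sq_nonneg (x 1))
      have h2 := mul_nonneg h.2.2.le (sq_nonneg (x 2))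
      obtain ⟨i, hi⟩ := Function.ne_iff.1 hx
      have hi' : 0 < x i ^ 2 := sq_pos_of_ne_zero hi
      fin_cases i <;> simp only [Fin.zero_eta, Fin.mk_one, Fin.reduceFinMk] at hi'
      · have := mul_pos h.1 hi'
        linarith
      · have := mul_pos h.2.1 hi'
        linarith
      · have := mul_pos h.2.2 hi'
        linarith
  have hn := hp (-d)
  rw [IsDefinite, hp]
  refine or_congr Iff.rfl ?_
  simpa [qf_diagonal_neg] using hn

theorem rep_mem_Z_iff (s t : BianchiClass) : s.rep ∈ Z t ↔ Degenerates s t := by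
  change closureCond t (mat s.rep) (cov s.rep) ↔ _
  rw [mat_rep, cov_rep, Degenerates]
  cases t <;> cases s <;>
    simp only [closureCond, BianchiClass.mat, BianchiClass.covec, adjugate_diagonal_fin_three,
      diagonal_eq_zero_iff, diagonal_mulVec_eq_zero_iff, covec_eq_zero_iff, qf_diagonal_nonneg_iff,
      qf_diagonal_nonpos_iff, isDefinite_diagonal_iff, vecMulVec_eq_iff, Matrix.det_diagonal,
      Fin.prod_univ_three] <;>
    simp [BianchiClass.VI₀, BianchiClass.VII₀]
  -- Within a family only the square of the parameter enters the conditions; the sign convention for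
  -- `h` then determines it.
  · rename_i k hk h hh
    rw [← sq, sq_eq_sq_iff_abs_eq_abs, abs_of_nonpos hh, abs_of_nonpos hk, neg_inj]
  · rename_i k hk h hh
    rw [← sq, sq_eq_sq_iff_abs_eq_abs, abs_of_nonneg hh, abs_of_nonneg hk]

theorem orbit_subset_Z_iff (s t : BianchiClass) : s.orbit ⊆ Z t ↔ Degenerates s t := by
  rw [← rep_mem_Z_iff]
  refine ⟨fun h => h (MulAction.mem_orbit_self _), ?_⟩
  rintro h _ ⟨g, rfl⟩
  exact smul_mem_Z g h

theorem exists_mem_orbit {C : W ℝ} (h : mat C *ᵥ cov C = 0) : ∃ t : BianchiClass, C ∈ t.orbit := by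
  obtain ⟨t, ht⟩ := exists_orbit_T_eq (mat_isSymm C) h
  rw [T_mat_cov] at ht
  exact ⟨t, ht ▸ MulAction.mem_orbit_self _⟩

theorem rep_mem_Z_of_mem {s t : BianchiClass} {C : W ℝ} (hC : C ∈ s.orbit) (h : C ∈ Z t) :
    s.rep ∈ Z t := by
  obtain ⟨g, rfl⟩ := hC
  simpa using smul_mem_Z g⁻¹ h

/-- An invariant subset of the Lie variety is the union of the orbits whose representatives it
contains. -/
theorem mem_Z_iff {t : BianchiClass} {C : W ℝ} : C ∈ Z t ↔ ∃ s, Degenerates s t ∧ C ∈ s.orbit := by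
  constructor
  · intro h
    obtain ⟨s, hs⟩ := exists_mem_orbit (closureCond_mulVec h)
    exact ⟨s, (rep_mem_Z_iff s t).1 (rep_mem_Z_of_mem hs h), hs⟩
  · rintro ⟨s, h, hs⟩
    exact (orbit_subset_Z_iff s t).2 h hs

theorem Degenerates.refl (t : BianchiClass) : Degenerates t t := Or.inl rfl

theorem orbit_subset_Z (t : BianchiClass) : t.orbit ⊆ Z t :=
  (orbit_subset_Z_iff t t).2 (.refl t)

theorem Degenerates.antisymm {s t : BianchiClass} (h : Degenerates s t) (h' : Degenerates t s) :
    s = t := by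
  cases s <;> cases t <;> simp_all [Degenerates, BianchiClass.VI₀, BianchiClass.VII₀]

/-- A common point puts each representative into the closed set of the other class, and the closure
order is antisymmetric. -/
theorem eq_of_mem_orbit {s t : BianchiClass} {C : W ℝ} (hs : C ∈ s.orbit) (ht : C ∈ t.orbit) :
    s = t :=
  Degenerates.antisymm ((rep_mem_Z_iff s t).1 (rep_mem_Z_of_mem hs (orbit_subset_Z t ht)))
    ((rep_mem_Z_iff t s).1 (rep_mem_Z_of_mem ht (orbit_subset_Z s hs)))

/-! ### Degenerations along explicit curves -/

theorem mem_closure_of_curve {𝕜 : Type} [RCLike 𝕜] {S : Set (W 𝕜)} {w : 𝕜 → Fin 6 → 𝕜}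
    {ν : 𝕜 → V 𝕜} (hw : Continuous w) (hν : Continuous ν)
    (h : ∀ s : 𝕜, s ≠ 0 → T (sym (w s)) (ν s) ∈ S) : T (sym (w 0)) (ν 0) ∈ closure S := by
  have hc : Continuous fun s => (T (sym (w s)) (ν s) : W 𝕜) := continuous_T hw hν
  have h0 : (0 : 𝕜) ∈ closure ({0}ᶜ : Set 𝕜) := by
    rw [(dense_compl_singleton (0 : 𝕜)).closure_eq]
    trivial
  have := image_closure_subset_closure_image hc ⟨0, h0, rfl⟩
  refine closure_mono ?_ this
  rintro _ ⟨s, hs, rfl⟩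
  exact h s hs

theorem closure_smul_invariant {𝕜 : Type} [RCLike 𝕜] {S : Set (W 𝕜)}
    (hS : ∀ (g : GL (Fin 3) 𝕜), ∀ C ∈ S, g • C ∈ S) (g : GL (Fin 3) 𝕜) {C : W 𝕜}
    (hC : C ∈ closure S) : g • C ∈ closure S := by
  have := image_closure_subset_closure_image (actEquiv g).continuous ⟨C, hC, rfl⟩
  refine closure_mono ?_ this
  rintro _ ⟨D, hD, rfl⟩
  exact hS g D hD

theorem orbit_subset_closure {𝕜 : Type} [RCLike 𝕜] {S : Set (W 𝕜)}
    (hS : ∀ (g : GL (Fin 3) 𝕜), ∀ C ∈ S, g • C ∈ S) {C : W 𝕜}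
    (hC : C ∈ closure S) : MulAction.orbit (GL (Fin 3) 𝕜) C ⊆ closure S := by
  rintro _ ⟨g, rfl⟩
  exact closure_smul_invariant hS g hC

theorem smul_mem_orbit (t : BianchiClass) (g : GL (Fin 3) ℝ) (C : W ℝ) (hC : C ∈ t.orbit) :
    g • C ∈ t.orbit :=
  MulAction.mem_orbit_of_mem_orbit g hC

/-- The upper triangle of a diagonal matrix. -/
def diagW {𝕜 : Type} [RCLike 𝕜] (a b c : 𝕜) : Fin 6 → 𝕜 := ![a, 0, 0, b, 0, c]

theorem sym_diagW {𝕜 : Type} [RCLike 𝕜] (a b c : 𝕜) :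
    sym (diagW a b c) = !![a, 0, 0; 0, b, 0; 0, 0, c] := rfl

theorem continuous_diagW {𝕜 : Type} [RCLike 𝕜] {X : Type*} [TopologicalSpace X] {a b c : X → 𝕜}
    (ha : Continuous a) (hb : Continuous b) (hc : Continuous c) :
    Continuous fun x => diagW (a x) (b x) (c x) := by
  refine continuous_pi fun i => ?_
  fin_cases i <;> simp [diagW] <;> first | assumption | exact continuous_const

theorem continuous_covec {𝕜 : Type} [RCLike 𝕜] {X : Type*} [TopologicalSpace X] {c : X → 𝕜}
    (hc : Continuous c) : Continuous fun x => (![0, 0, c x] : V 𝕜) := by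
  refine continuous_pi fun i => ?_
  fin_cases i <;> simp <;> first | assumption | exact continuous_const

/-- A curve of diagonal representatives in an orbit; the congruences that identify the orbit are
given by matrices `M s`. -/
theorem mem_closure_orbit_of_diag {𝕜 : Type} [RCLike 𝕜] {a b c n : 𝕜 → 𝕜} (ha : Continuous a)
    (hb : Continuous b) (hc : Continuous c) (hn : Continuous n) {A : Matrix (Fin 3) (Fin 3) 𝕜}
    {ν : V 𝕜} (M : 𝕜 → Matrix (Fin 3) (Fin 3) 𝕜) (hM : ∀ s, s ≠ 0 → (M s).det ≠ 0)
    (h : ∀ s, s ≠ 0 → M s * !![a s, 0, 0; 0, b s, 0; 0, 0, c s] * (M s)ᵀ = (M s).det • A)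
    (hν : ∀ s, s ≠ 0 → (M s)ᵀ *ᵥ ν = ![0, 0, n s]) :
    T !![a 0, 0, 0; 0, b 0, 0; 0, 0, c 0] ![0, 0, n 0] ∈
      closure (MulAction.orbit (GL (Fin 3) 𝕜) (T A ν)) := by
  refine mem_closure_of_curve (w := fun s => diagW (a s) (b s) (c s))
    (ν := fun s => ![0, 0, n s]) (continuous_diagW ha hb hc) (continuous_covec hn) ?_
  intro s hs
  rw [← orbit_T_eq (hM s hs) (h s hs) (hν s hs), sym_diagW]
  exact MulAction.mem_orbit_self _

/-- Every class except `I` and `V` is represented by `diag(1, d₁, d₂)` and `n λ³`. The matrix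
`diag(s², s, s)` identifies it with `diag(1, d₁ s², d₂ s²)` and `n s λ³`, where only the first entry
survives as `s → 0`. -/
theorem II_rep_mem_closure {t : BianchiClass} (h1 : t ≠ .I) (h2 : t ≠ .V) :
    BianchiClass.II.rep ∈ closure t.orbit := by
  have key : ∀ (d₁ d₂ n : ℝ), T !![1, 0, 0; 0, 0, 0; 0, 0, 0] ![0, 0, 0] ∈
      closure (MulAction.orbit (GL (Fin 3) ℝ) (T !![1, 0, 0; 0, d₁, 0; 0, 0, d₂] ![0, 0, n])) := by
    intro d₁ d₂ n
    have := mem_closure_orbit_of_diag (𝕜 := ℝ) (a := fun _ => 1) (b := fun s => d₁ * s ^ 2)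
      (c := fun s => d₂ * s ^ 2) (n := fun s => n * s) (A := !![1, 0, 0; 0, d₁, 0; 0, 0, d₂])
      (ν := ![0, 0, n]) (by fun_prop) (by fun_prop) (by fun_prop) (by fun_prop)
      (fun s => !![s ^ 2, 0, 0; 0, s, 0; 0, 0, s])
      (by intro s hs; simp [Matrix.det_fin_three, hs])
      (by
        intro s hs
        simp [Matrix.det_fin_three, transpose_fin_three, vec_three_zero]
        refine ⟨?_, ?_, ?_⟩ <;> ring)
      (by
        intro s hs
        ext i
        fin_cases i <;> simp [Matrix.mulVec, dotProduct, Fin.sum_univ_three, mul_comm])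
    simpa using this
  rw [rep_eq, BianchiClass.orbit, rep_eq]
  cases t with
  | I => exact absurd rfl h1
  | V => exact absurd rfl h2
  | _ =>
    simp only [BianchiClass.mat, BianchiClass.covec, diagonal_fin_three]
    exact key _ _ _

theorem I_rep_mem_closure (t : BianchiClass) : BianchiClass.I.rep ∈ closure t.orbit := by
  have := mem_closure_of_curve (S := t.orbit) (w := fun s => s • matL t.rep)
    (ν := fun s => s • cov t.rep) (by fun_prop) (by fun_prop) ?_
  · rw [rep_eq]
    convert this using 2
    · simp only [BianchiClass.mat, diagonal_fin_three, zero_smul]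
      rfl
    · simp [BianchiClass.covec, vec_three_zero]
  · intro s hs
    have e : sym (s • matL t.rep) = s • mat t.rep := by
      ext i k
      fin_cases i <;> fin_cases k <;> rfl
    rw [e, T_add_smul, T_mat_cov, ← scalarGL_smul s hs]
    exact MulAction.mem_orbit _ _

theorem rep_mem_closure {s t : BianchiClass} (h : Degenerates s t) : s.rep ∈ closure t.orbit := by
  rcases h with rfl | rfl | ⟨rfl, h1, h2⟩ | ⟨rfl, rfl⟩ | ⟨rfl, rfl⟩ | ⟨rfl, rfl | rfl⟩
  · exact subset_closure (MulAction.mem_orbit_self _)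
  · exact I_rep_mem_closure t
  · exact II_rep_mem_closure h1 h2
  -- The rank-one form of `IV` can be scaled to zero while `λ³` stays fixed.
  · have := mem_closure_orbit_of_diag (𝕜 := ℝ) (a := fun s => s) (b := fun s => 0)
      (c := fun s => 0) (n := fun s => 1) (A := BianchiClass.IV.mat)
      (ν := BianchiClass.IV.covec) (by fun_prop) (by fun_prop) (by fun_prop) (by fun_prop)
      (fun s => !![1, 0, 0; 0, s, 0; 0, 0, 1])
      (by intro s hs; simp [Matrix.det_fin_three, hs])
      (by
        intro s hs
        simp [BianchiClass.mat, diagonal_fin_three, Matrix.det_fin_three, transpose_fin_three,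
          vec_three_zero])
      (by
        intro s hs
        ext i
        fin_cases i <;>
          simp [BianchiClass.covec, Matrix.mulVec, dotProduct, Fin.sum_univ_three])
    rw [← rep_eq] at this
    rw [rep_eq]
    simp only [BianchiClass.mat, BianchiClass.covec, diagonal_fin_three]
    exact this
  -- An indefinite form of rank three can lose a positive or a negative direction, so `VIII`
  -- degenerates to both `VI₀` and `VII₀`. Here a positive entry vanishes, and `M` moves the
  -- negative one to the last place.
  · have := mem_closure_orbit_of_diag (𝕜 := ℝ) (a := fun s => 1) (b := fun s => -1)
      (c := fun s => s ^ 2) (n := fun s => 0) (A := BianchiClass.VIII.mat)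
      (ν := BianchiClass.VIII.covec) (by fun_prop) (by fun_prop) (by fun_prop) (by fun_prop)
      (fun s => !![s, 0, 0; 0, 0, -1; 0, s, 0])
      (by intro s hs; simp [Matrix.det_fin_three, hs])
      (by
        intro s hs
        simp [BianchiClass.mat, diagonal_fin_three, Matrix.det_fin_three, transpose_fin_three,
          sq])
      (by intro s hs; simp [BianchiClass.covec, vec_three_zero])
    rw [← rep_eq] at this
    rw [rep_eq]
    simpa [BianchiClass.mat, BianchiClass.covec, diagonal_fin_three, BianchiClass.orbit] using this
  · have := mem_closure_orbit_of_diag (𝕜 := ℝ) (a := fun s => 1) (b := fun s => 1)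
      (c := fun s => -s ^ 2) (n := fun s => 0) (A := BianchiClass.VIII.mat)
      (ν := BianchiClass.VIII.covec) (by fun_prop) (by fun_prop) (by fun_prop) (by fun_prop)
      (fun s => !![s, 0, 0; 0, s, 0; 0, 0, 1])
      (by intro s hs; simp [Matrix.det_fin_three, hs])
      (by
        intro s hs
        simp [BianchiClass.mat, diagonal_fin_three, Matrix.det_fin_three, transpose_fin_three,
          sq])
      (by intro s hs; simp [BianchiClass.covec, vec_three_zero])
    rw [← rep_eq] at this
    rw [rep_eq]
    simpa [BianchiClass.mat, BianchiClass.covec, diagonal_fin_three, BianchiClass.orbit] using this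
  · have := mem_closure_orbit_of_diag (𝕜 := ℝ) (a := fun s => 1) (b := fun s => 1)
      (c := fun s => s ^ 2) (n := fun s => 0) (A := BianchiClass.IX.mat)
      (ν := BianchiClass.IX.covec) (by fun_prop) (by fun_prop) (by fun_prop) (by fun_prop)
      (fun s => !![s, 0, 0; 0, s, 0; 0, 0, 1])
      (by intro s hs; simp [Matrix.det_fin_three, hs])
      (by
        intro s hs
        simp [BianchiClass.mat, diagonal_fin_three, Matrix.det_fin_three, transpose_fin_three,
          sq])
      (by intro s hs; simp [BianchiClass.covec, vec_three_zero])
    rw [← rep_eq] at this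
    rw [rep_eq]
    simpa [BianchiClass.mat, BianchiClass.covec, diagonal_fin_three, BianchiClass.orbit] using this

/-- One inclusion is the closedness of `Z t`. For the other, `Z t` is a union of orbits whose
representatives are limits of curves in the orbit of `t`, and the closure is invariant. -/
theorem closure_orbit (t : BianchiClass) : closure t.orbit = Z t := by
  refine (closure_minimal (orbit_subset_Z t) (isClosed_Z t)).antisymm fun C hC => ?_
  obtain ⟨s, hs, hC⟩ := mem_Z_iff.1 hC
  exact orbit_subset_closure (smul_mem_orbit t) (rep_mem_closure hs) hC

theorem closure_orbit_eq_iUnion (t : BianchiClass) :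
    closure t.orbit = ⋃ (s : BianchiClass) (_ : s.orbit ⊆ closure t.orbit), s.orbit := by
  ext C
  simp only [Set.mem_iUnion, exists_prop, closure_orbit, orbit_subset_Z_iff, mem_Z_iff]

/-! ### The orbits in the unimodular part -/

theorem orbit_I : BianchiClass.I.orbit = {0} := by
  have : BianchiClass.I.rep = 0 := by
    rw [← T_mat_cov BianchiClass.I.rep, mat_rep, cov_rep, ← T_mat_cov 0]
    congr 1
    · simp only [BianchiClass.mat, diagonal_fin_three, mat, map_zero]
      rfl
    · simp [BianchiClass.covec, vec_three_zero]
  ext C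
  rw [BianchiClass.orbit, this]
  simp [MulAction.mem_orbit_iff, eq_comm]

theorem mem_unimodular_orbit_iff {t : BianchiClass} {C : W ℝ} (h : C ∈ t.orbit) :
    C ∈ unimodular ℝ ↔ t ∈ ({.I, .II, .VI₀, .VII₀, .VIII, .IX} : Set BianchiClass) := by
  obtain ⟨g, rfl⟩ := h
  have e : ((g⁻¹ : GL (Fin 3) ℝ) : Matrix (Fin 3) (Fin 3) ℝ)ᵀ *ᵥ t.covec = 0 ↔ t.covec = 0 := by
    refine ⟨fun h => ?_, fun h => by rw [h, Matrix.mulVec_zero]⟩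
    have := congrArg (fun x => (g : Matrix (Fin 3) (Fin 3) ℝ)ᵀ *ᵥ x) h
    simp only [Matrix.mulVec_mulVec, ← Matrix.transpose_mul, inv_mul_GL, Matrix.transpose_one,
      Matrix.one_mulVec, Matrix.mulVec_zero] at this
    exact this
  change g • t.rep ∈ _ ↔ _
  rw [mem_unimodular_iff, cov_smul, cov_rep, e]
  cases t <;> simp [BianchiClass.covec, BianchiClass.VI₀, BianchiClass.VII₀, vec_three_zero,
    covec_eq_zero_iff]

theorem mem_unimodular_iff_exists {C : W ℝ} : C ∈ unimodular ℝ ↔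
    ∃ t ∈ ({.I, .II, .VI₀, .VII₀, .VIII, .IX} : Set BianchiClass), C ∈ t.orbit := by
  constructor
  · intro h
    obtain ⟨t, ht⟩ := exists_mem_orbit (C := C) (by
      rw [(mem_unimodular_iff C).1 h, Matrix.mulVec_zero])
    exact ⟨t, (mem_unimodular_orbit_iff ht).1 h, ht⟩
  · rintro ⟨t, h, ht⟩
    exact (mem_unimodular_orbit_iff ht).2 h

theorem unimodular_eq : (unimodular ℝ : Set (W ℝ)) = BianchiClass.I.orbit ∪
    BianchiClass.II.orbit ∪ BianchiClass.VI₀.orbit ∪ BianchiClass.VII₀.orbit ∪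
    BianchiClass.VIII.orbit ∪ BianchiClass.IX.orbit := by
  ext C
  rw [SetLike.mem_coe, mem_unimodular_iff_exists]
  simp only [Set.mem_insert_iff, Set.mem_singleton_iff, exists_eq_or_imp, exists_eq_left,
    Set.mem_union, or_assoc]

/-- A union of orbits in an invariant set is relatively open as soon as the other orbits are covered
by finitely many orbit closures that avoid it. -/
theorem isOpenIn_orbit {t : BianchiClass} {S F : Set (W ℝ)} (hF : IsClosed F)
    (h : t.orbit ⊆ S \ F) (h' : S ⊆ t.orbit ∪ F) : IsOpenIn t.orbit S := by
  refine ⟨Fᶜ, hF.isOpen_compl, ?_⟩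
  ext C
  refine ⟨fun hC => ⟨(h hC).2, (h hC).1⟩, fun hC => (h' hC.2).resolve_right hC.1⟩

theorem isOpenIn_unimodular (t : BianchiClass) (ht : t ∈ ({.VIII, .IX} : Set BianchiClass)) :
    IsOpenIn t.orbit (unimodular ℝ : Set (W ℝ)) := by
  simp only [Set.mem_insert_iff, Set.mem_singleton_iff] at ht
  rcases ht with rfl | rfl
  -- The other five unimodular orbits lie in these two closed sets; `Z .VI₀` is needed because `VI₀`
  -- does not lie in the closure of `IX`.
  · refine isOpenIn_orbit (F := Z .IX ∪ Z .VI₀) ((isClosed_Z _).union (isClosed_Z _)) ?_ ?_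
    · intro C hC
      refine ⟨(mem_unimodular_orbit_iff hC).2 (by simp), ?_⟩
      rintro (h | h) <;>
      · obtain ⟨s, hs, hCs⟩ := mem_Z_iff.1 h
        obtain rfl := eq_of_mem_orbit hC hCs
        simp [Degenerates, BianchiClass.VI₀, BianchiClass.VII₀] at hs
    · intro C hC
      obtain ⟨s, hs, hCs⟩ := mem_unimodular_iff_exists.1 hC
      simp only [Set.mem_insert_iff, Set.mem_singleton_iff] at hs
      rcases hs with rfl | rfl | rfl | rfl | rfl | rfl
      · exact .inr (.inl (mem_Z_iff.2 ⟨_, by simp [Degenerates], hCs⟩))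
      · exact .inr (.inl (mem_Z_iff.2 ⟨_, by simp [Degenerates], hCs⟩))
      · exact .inr (.inr (mem_Z_iff.2 ⟨_, by simp [Degenerates], hCs⟩))
      · exact .inr (.inl (mem_Z_iff.2 ⟨_, by simp [Degenerates], hCs⟩))
      · exact .inl hCs
      · exact .inr (.inl (mem_Z_iff.2 ⟨_, by simp [Degenerates], hCs⟩))
  · refine isOpenIn_orbit (F := Z .VIII) (isClosed_Z _) ?_ ?_
    · intro C hC
      refine ⟨(mem_unimodular_orbit_iff hC).2 (by simp), ?_⟩
      intro h
      obtain ⟨s, hs, hCs⟩ := mem_Z_iff.1 h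
      obtain rfl := eq_of_mem_orbit hC hCs
      simp [Degenerates, BianchiClass.VI₀, BianchiClass.VII₀] at hs
    · intro C hC
      obtain ⟨s, hs, hCs⟩ := mem_unimodular_iff_exists.1 hC
      simp only [Set.mem_insert_iff, Set.mem_singleton_iff] at hs
      rcases hs with rfl | rfl | rfl | rfl | rfl | rfl
      · exact .inr (mem_Z_iff.2 ⟨_, by simp [Degenerates], hCs⟩)
      · exact .inr (mem_Z_iff.2 ⟨_, by simp [Degenerates], hCs⟩)
      · exact .inr (mem_Z_iff.2 ⟨_, by simp [Degenerates], hCs⟩)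
      · exact .inr (mem_Z_iff.2 ⟨_, by simp [Degenerates], hCs⟩)
      · exact .inr (mem_Z_iff.2 ⟨_, by simp [Degenerates], hCs⟩)
      · exact .inl hCs

theorem isOpenIn_unimodular_diff (t : BianchiClass) (ht : t ∈ ({.VI₀, .VII₀} : Set BianchiClass)) :
    IsOpenIn t.orbit
      ((unimodular ℝ : Set (W ℝ)) \ (BianchiClass.VIII.orbit ∪ BianchiClass.IX.orbit)) := by
  simp only [Set.mem_insert_iff, Set.mem_singleton_iff] at ht
  have key : ∀ t t' : BianchiClass, (t = .VI₀ ∧ t' = .VII₀) ∨ (t = .VII₀ ∧ t' = .VI₀) →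
      IsOpenIn t.orbit
        ((unimodular ℝ : Set (W ℝ)) \ (BianchiClass.VIII.orbit ∪ BianchiClass.IX.orbit)) := by
    intro t t' h
    refine isOpenIn_orbit (F := Z t') (isClosed_Z _) ?_ ?_
    · intro C hC
      refine ⟨⟨(mem_unimodular_orbit_iff hC).2 ?_, ?_⟩, ?_⟩
      · rcases h with ⟨rfl, rfl⟩ | ⟨rfl, rfl⟩ <;> simp
      · rintro (h' | h') <;> have := eq_of_mem_orbit hC h' <;>
          rcases h with ⟨rfl, rfl⟩ | ⟨rfl, rfl⟩ <;>
          simp [BianchiClass.VI₀, BianchiClass.VII₀] at this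
      · intro h'
        obtain ⟨s, hs, hCs⟩ := mem_Z_iff.1 h'
        obtain rfl := eq_of_mem_orbit hC hCs
        rcases h with ⟨rfl, rfl⟩ | ⟨rfl, rfl⟩ <;>
          simp [Degenerates, BianchiClass.VI₀, BianchiClass.VII₀] at hs
    · rintro C ⟨hC, hC'⟩
      obtain ⟨s, hs, hCs⟩ := mem_unimodular_iff_exists.1 hC
      simp only [Set.mem_insert_iff, Set.mem_singleton_iff] at hs
      rcases hs with rfl | rfl | rfl | rfl | rfl | rfl
      · exact .inr (mem_Z_iff.2 ⟨_, by simp [Degenerates], hCs⟩)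
      · refine .inr (mem_Z_iff.2 ⟨_, ?_, hCs⟩)
        rcases h with ⟨rfl, rfl⟩ | ⟨rfl, rfl⟩ <;> simp [Degenerates, BianchiClass.VI₀, BianchiClass.VII₀]
      · rcases h with ⟨rfl, rfl⟩ | ⟨rfl, rfl⟩
        · exact .inl hCs
        · exact .inr (mem_Z_iff.2 ⟨_, .refl _, hCs⟩)
      · rcases h with ⟨rfl, rfl⟩ | ⟨rfl, rfl⟩
        · exact .inr (mem_Z_iff.2 ⟨_, .refl _, hCs⟩)
        · exact .inl hCs
      · exact absurd (.inl hCs) hC'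
      · exact absurd (.inr hCs) hC'
  rcases ht with rfl | rfl
  · exact key _ _ (.inl ⟨rfl, rfl⟩)
  · exact key _ _ (.inr ⟨rfl, rfl⟩)

/-! ### Closures of `V` and of the one-parameter families -/

theorem Z_V_eq : Z .V = Set.range (j : V ℝ → W ℝ) := by
  ext C
  constructor
  · intro h
    refine ⟨cov C, ?_⟩
    have h' : mat C = 0 := h
    rw [j_eq_T, ← h', T_mat_cov]
  · rintro ⟨ν, rfl⟩
    change mat (j ν) = 0
    rw [j_eq_T, mat_T Matrix.isSymm_zero]

/-- The closed set of the brackets with `A ν = 0`, `det A = 0` and `c · adj A ≥ 0`. -/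
def signSet (c : ℝ) : Set (W ℝ) :=
  {C | mat C *ᵥ cov C = 0 ∧ (mat C).det = 0 ∧ ∀ x, 0 ≤ c * qf (mat C).adjugate x}

theorem isClosed_signSet (c : ℝ) : IsClosed (signSet c) := by
  have hm : Continuous (mat : W ℝ → _) := continuous_mat
  have hc : Continuous (cov : W ℝ → _) := continuous_cov
  have h : IsClosed {C : W ℝ | ∀ x, 0 ≤ c * qf (mat C).adjugate x} := by
    rw [Set.ofPred_forall]
    refine isClosed_iInter fun x => isClosed_le continuous_const ?_
    exact (continuous_qf.comp₂ hm.matrix_adjugate continuous_const).const_mul c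
  exact (isClosed_eq (hm.matrix_mulVec hc) continuous_const).inter
    ((isClosed_eq hm.matrix_det continuous_const).inter h)

theorem smul_mem_signSet {c : ℝ} (g : GL (Fin 3) ℝ) {C : W ℝ} (h : C ∈ signSet c) :
    g • C ∈ signSet c := by
  obtain ⟨h1, h2, h3⟩ := h
  refine ⟨?_, ?_, fun x => ?_⟩
  · rw [mat_smul, cov_smul, Matrix.smul_mulVec, ← Matrix.mulVec_mulVec, ← Matrix.mulVec_mulVec,
      Matrix.mulVec_mulVec (cov C), ← Matrix.transpose_mul, inv_mul_GL, Matrix.transpose_one,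
      Matrix.one_mulVec, h1, Matrix.mulVec_zero, smul_zero]
  · rw [mat_smul]
    simp [Matrix.det_smul, h2]
  · rw [mat_smul, adjugate_conj, qf_conj]
    exact h3 _

theorem rep_mem_signSet_iff (t : BianchiClass) (c : ℝ) :
    t.rep ∈ signSet c ↔ match t with
      | .I | .II | .IV | .V => True
      | .VI _ _ => c ≤ 0
      | .VII _ _ => 0 ≤ c
      | .VIII | .IX => False := by
  change (_ ∧ _ ∧ _) ↔ _
  simp only [mat_rep, cov_rep]
  cases t <;>
    simp only [BianchiClass.mat, BianchiClass.covec, adjugate_diagonal_fin_three,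
      diagonal_mulVec_eq_zero_iff, qf_diagonal, Matrix.det_diagonal, Fin.prod_univ_three] <;>
    simp
  · refine ⟨fun h => by simpa using h ![0, 0, 1], fun h x => ?_⟩
    have := mul_nonneg (neg_nonneg.2 h) (sq_nonneg (x 2))
    linarith
  · refine ⟨fun h => by simpa using h ![0, 0, 1], fun h x => mul_nonneg h (sq_nonneg _)⟩

theorem orbit_subset_signSet {t : BianchiClass} {c : ℝ} (h : t.rep ∈ signSet c) :
    t.orbit ⊆ signSet c := by
  rintro _ ⟨g, rfl⟩
  exact smul_mem_signSet g h

theorem rep_mem_signSet_of_mem {t : BianchiClass} {c : ℝ} {C : W ℝ} (hC : C ∈ t.orbit)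
    (h : C ∈ signSet c) : t.rep ∈ signSet c := by
  obtain ⟨g, rfl⟩ := hC
  simpa using smul_mem_signSet g⁻¹ h

/-- Here `adj A` has the single entry `-s²` and `ν νᵀ` the single entry `1`, so `h² = s⁻²`: as `s →
0` with fixed `ν` the parameter goes to infinity. -/
theorem diag_mem_VI {s : ℝ} (hs : 0 < s) :
    T !![1, 0, 0; 0, -s ^ 2, 0; 0, 0, 0] ![0, 0, 1] ∈
      (BianchiClass.VI (-s⁻¹) (neg_nonpos.2 (inv_nonneg.2 hs.le))).orbit := by
  rw [BianchiClass.orbit, rep_eq,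
    ← orbit_T_eq (M := !![s, 0, 0; 0, -1, 0; 0, 0, -s])
      (A := !![1, 0, 0; 0, -s ^ 2, 0; 0, 0, 0]) (ν := ![0, 0, 1])]
  · exact MulAction.mem_orbit_self _
  · simp [Matrix.det_fin_three, hs.ne']
  · simp [BianchiClass.mat, diagonal_fin_three, Matrix.det_fin_three, transpose_fin_three,
      vec_three_zero, sq]
  · ext i
    fin_cases i <;>
      simp [BianchiClass.covec, Matrix.mulVec, dotProduct, Fin.sum_univ_three, hs.ne']

theorem diag_mem_VII {s : ℝ} (hs : 0 < s) :
    T !![1, 0, 0; 0, s ^ 2, 0; 0, 0, 0] ![0, 0, 1] ∈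
      (BianchiClass.VII s⁻¹ (inv_nonneg.2 hs.le)).orbit := by
  rw [BianchiClass.orbit, rep_eq,
    ← orbit_T_eq (M := !![s, 0, 0; 0, 1, 0; 0, 0, s])
      (A := !![1, 0, 0; 0, s ^ 2, 0; 0, 0, 0]) (ν := ![0, 0, 1])]
  · exact MulAction.mem_orbit_self _
  · simp [Matrix.det_fin_three, hs.ne']
  · simp [BianchiClass.mat, diagonal_fin_three, Matrix.det_fin_three, transpose_fin_three,
      vec_three_zero, sq]
  · ext i
    fin_cases i <;>
      simp [BianchiClass.covec, Matrix.mulVec, dotProduct, Fin.sum_univ_three, hs.ne']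

theorem IV_rep_eq : BianchiClass.IV.rep = T !![1, 0, 0; 0, 0, 0; 0, 0, 0] ![0, 0, 1] := by
  rw [rep_eq]
  simp [BianchiClass.mat, BianchiClass.covec, diagonal_fin_three]

theorem iUnion_VI_smul (g : GL (Fin 3) ℝ) :
    ∀ C ∈ ⋃ (h : ℝ) (hh : h < 0), (BianchiClass.VI h hh.le).orbit,
      g • C ∈ ⋃ (h : ℝ) (hh : h < 0), (BianchiClass.VI h hh.le).orbit := by
  intro C hC
  simp only [Set.mem_iUnion] at hC ⊢
  obtain ⟨h, hh, hC⟩ := hC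
  exact ⟨h, hh, smul_mem_orbit _ g C hC⟩

theorem iUnion_VII_smul (g : GL (Fin 3) ℝ) :
    ∀ C ∈ ⋃ (h : ℝ) (hh : 0 < h), (BianchiClass.VII h hh.le).orbit,
      g • C ∈ ⋃ (h : ℝ) (hh : 0 < h), (BianchiClass.VII h hh.le).orbit := by
  intro C hC
  simp only [Set.mem_iUnion] at hC ⊢
  obtain ⟨h, hh, hC⟩ := hC
  exact ⟨h, hh, smul_mem_orbit _ g C hC⟩

/-- The upper bound is `signSet (-1)`, the conditions on `VI_h` that do not mention `h`. It is
attained because `h → -∞` leads to `IV`, and hence to the closure of `IV`, while `h → 0` leads to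
`VI₀`. -/
theorem closure_iUnion_VI :
    closure (⋃ (h : ℝ) (hh : h < 0), (BianchiClass.VI h hh.le).orbit) =
      (⋃ (h : ℝ) (hh : h ≤ 0), (BianchiClass.VI h hh).orbit) ∪ BianchiClass.IV.orbit ∪
        BianchiClass.V.orbit ∪ BianchiClass.II.orbit ∪ BianchiClass.I.orbit := by
  set S := ⋃ (h : ℝ) (hh : h < 0), (BianchiClass.VI h hh.le).orbit with hS
  refine Set.Subset.antisymm ?_ ?_
  · refine (closure_minimal ?_ (isClosed_signSet (-1))).trans ?_
    · refine Set.iUnion₂_subset fun h hh => orbit_subset_signSet ?_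
      rw [rep_mem_signSet_iff]
      simp
    · intro C hC
      obtain ⟨t, ht⟩ := exists_mem_orbit hC.1
      have := rep_mem_signSet_of_mem ht hC
      rw [rep_mem_signSet_iff] at this
      simp only [Set.mem_union, Set.mem_iUnion]
      cases t with
      | I => exact .inr ht
      | II => exact .inl (.inr ht)
      | IV => exact .inl (.inl (.inl (.inr ht)))
      | V => exact .inl (.inl (.inr ht))
      | VI h hh => exact .inl (.inl (.inl (.inl ⟨h, hh, ht⟩)))
      | VII h hh => norm_num at this
      | VIII => exact this.elim
      | IX => exact this.elim
  · have hIV : BianchiClass.IV.orbit ⊆ closure S := by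
      refine orbit_subset_closure iUnion_VI_smul ?_
      rw [IV_rep_eq]
      have := mem_closure_of_curve (S := S) (w := fun s => diagW 1 (-s ^ 2) 0)
        (ν := fun _ => ![0, 0, 1]) (continuous_diagW (by fun_prop) (by fun_prop) (by fun_prop))
        (by fun_prop) ?_
      · simpa [sym_diagW] using this
      · intro s hs
        refine Set.mem_iUnion₂.2 ⟨-|s|⁻¹, neg_neg_of_pos (inv_pos.2 (abs_pos.2 hs)), ?_⟩
        rw [← sq_abs, sym_diagW]
        exact diag_mem_VI (abs_pos.2 hs)
    have hcl : ∀ s : BianchiClass, Degenerates s .IV → s.orbit ⊆ closure S := by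
      intro s hs
      refine ((orbit_subset_Z_iff s _).2 hs).trans ?_
      rw [← closure_orbit]
      exact closure_minimal hIV isClosed_closure
    refine Set.union_subset (Set.union_subset (Set.union_subset (Set.union_subset ?_ hIV) ?_) ?_) ?_
    · refine Set.iUnion₂_subset fun h hh => ?_
      rcases hh.lt_or_eq with hh' | rfl
      · exact fun C hC => subset_closure (Set.mem_iUnion₂.2 ⟨h, hh', hC⟩)
      · refine orbit_subset_closure iUnion_VI_smul ?_
        rw [rep_eq]
        have := mem_closure_of_curve (S := S) (w := fun _ => diagW 1 (-1) 0)
          (ν := fun s => ![0, 0, -|s|]) (continuous_diagW (by fun_prop) (by fun_prop) (by fun_prop))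
          (continuous_covec (by fun_prop)) ?_
        · simpa [sym_diagW, BianchiClass.mat, BianchiClass.covec, diagonal_fin_three] using this
        · intro s hs
          refine Set.mem_iUnion₂.2 ⟨-|s|, neg_neg_of_pos (abs_pos.2 hs), ?_⟩
          rw [BianchiClass.orbit, rep_eq]
          convert MulAction.mem_orbit_self _ using 2
          · simp [sym_diagW, BianchiClass.mat, diagonal_fin_three]
          · simp [BianchiClass.covec]
    · exact hcl _ (by simp [Degenerates])
    · exact hcl _ (by simp [Degenerates])
    · exact hcl _ (by simp [Degenerates])

theorem closure_iUnion_VII :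
    closure (⋃ (h : ℝ) (hh : 0 < h), (BianchiClass.VII h hh.le).orbit) =
      (⋃ (h : ℝ) (hh : 0 ≤ h), (BianchiClass.VII h hh).orbit) ∪ BianchiClass.IV.orbit ∪
        BianchiClass.V.orbit ∪ BianchiClass.II.orbit ∪ BianchiClass.I.orbit := by
  set S := ⋃ (h : ℝ) (hh : 0 < h), (BianchiClass.VII h hh.le).orbit with hS
  refine Set.Subset.antisymm ?_ ?_
  · refine (closure_minimal ?_ (isClosed_signSet 1)).trans ?_
    · refine Set.iUnion₂_subset fun h hh => orbit_subset_signSet ?_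
      rw [rep_mem_signSet_iff]
      simp
    · intro C hC
      obtain ⟨t, ht⟩ := exists_mem_orbit hC.1
      have := rep_mem_signSet_of_mem ht hC
      rw [rep_mem_signSet_iff] at this
      simp only [Set.mem_union, Set.mem_iUnion]
      cases t with
      | I => exact .inr ht
      | II => exact .inl (.inr ht)
      | IV => exact .inl (.inl (.inl (.inr ht)))
      | V => exact .inl (.inl (.inr ht))
      | VI h hh => norm_num at this
      | VII h hh => exact .inl (.inl (.inl (.inl ⟨h, hh, ht⟩)))
      | VIII => exact this.elim
      | IX => exact this.elim
  · have hIV : BianchiClass.IV.orbit ⊆ closure S := by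
      refine orbit_subset_closure iUnion_VII_smul ?_
      rw [IV_rep_eq]
      have := mem_closure_of_curve (S := S) (w := fun s => diagW 1 (s ^ 2) 0)
        (ν := fun _ => ![0, 0, 1]) (continuous_diagW (by fun_prop) (by fun_prop) (by fun_prop))
        (by fun_prop) ?_
      · simpa [sym_diagW] using this
      · intro s hs
        refine Set.mem_iUnion₂.2 ⟨|s|⁻¹, inv_pos.2 (abs_pos.2 hs), ?_⟩
        rw [← sq_abs, sym_diagW]
        exact diag_mem_VII (abs_pos.2 hs)
    have hcl : ∀ s : BianchiClass, Degenerates s .IV → s.orbit ⊆ closure S := by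
      intro s hs
      refine ((orbit_subset_Z_iff s _).2 hs).trans ?_
      rw [← closure_orbit]
      exact closure_minimal hIV isClosed_closure
    refine Set.union_subset (Set.union_subset (Set.union_subset (Set.union_subset ?_ hIV) ?_) ?_) ?_
    · refine Set.iUnion₂_subset fun h hh => ?_
      rcases hh.lt_or_eq with hh' | rfl
      · exact fun C hC => subset_closure (Set.mem_iUnion₂.2 ⟨h, hh', hC⟩)
      · refine orbit_subset_closure iUnion_VII_smul ?_
        rw [rep_eq]
        have := mem_closure_of_curve (S := S) (w := fun _ => diagW 1 1 0)
          (ν := fun s => ![0, 0, |s|]) (continuous_diagW (by fun_prop) (by fun_prop) (by fun_prop))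
          (continuous_covec (by fun_prop)) ?_
        · simpa [sym_diagW, BianchiClass.mat, BianchiClass.covec, diagonal_fin_three] using this
        · intro s hs
          refine Set.mem_iUnion₂.2 ⟨|s|, abs_pos.2 hs, ?_⟩
          rw [BianchiClass.orbit, rep_eq]
          convert MulAction.mem_orbit_self _ using 2
          · simp [sym_diagW, BianchiClass.mat, diagonal_fin_three]
          · simp [BianchiClass.covec]
    · exact hcl _ (by simp [Degenerates])
    · exact hcl _ (by simp [Degenerates])
    · exact hcl _ (by simp [Degenerates])

theorem forall_smul_eq_iff (C : W ℝ) : (∀ g : GL (Fin 3) ℝ, g • C = C) ↔ C = 0 := by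
  constructor
  · intro h
    have h2 := scalarGL_smul (2 : ℝ) two_ne_zero C
    rw [h, two_smul] at h2
    simpa using h2
  · rintro rfl g
    exact smul_zero g

theorem rep_mem_lieVariety (t : BianchiClass) : t.rep ∈ lieVariety ℝ := by
  rw [rep_eq, T_mem_lieVariety (mat_isSymm_rep t), ← mat_rep, ← cov_rep]
  exact closureCond_mulVec (orbit_subset_Z t (MulAction.mem_orbit_self _))

/-! ### Local equations by rank -/

section Coordinates

variable {𝕜 : Type} [RCLike 𝕜]

theorem IsSubmanifoldAt.of_mem_orbit {S : Set (W 𝕜)} {d : ℕ}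
    (hS : ∀ (g : GL (Fin 3) 𝕜), ∀ C ∈ S, g • C ∈ S) {C D : W 𝕜} (h : IsSubmanifoldAt 𝕜 S d C)
    (hD : D ∈ MulAction.orbit (GL (Fin 3) 𝕜) C) : IsSubmanifoldAt 𝕜 S d D := by
  obtain ⟨g, rfl⟩ := hD
  refine h.image (actEquiv g) fun y => ⟨fun hy => ?_, fun hy => hS g y hy⟩
  have := hS g⁻¹ _ hy
  rwa [actEquiv_apply, inv_smul_smul] at this

/-- The slice `s` is chosen in each case so that the equations `f` are exactly linear along it,
although they are nonlinear on the whole space; no derivative has to be computed. -/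
theorem IsSubmanifoldAt.of_coordinates {F : Type*} [NormedAddCommGroup F] [NormedSpace 𝕜 F]
    [FiniteDimensional 𝕜 F] {B : Set (W 𝕜)} {d : ℕ} {w₀ : Fin 6 → 𝕜} {ν₀ : V 𝕜}
    (f : (Fin 6 → 𝕜) × V 𝕜 → F) (hf : ContDiff 𝕜 ∞ f) (s : F → (Fin 6 → 𝕜) × V 𝕜)
    (hs : IsLinearMap 𝕜 s) (hfs : ∀ v, f ((w₀, ν₀) + s v) = v)
    (hB : ∀ᶠ C in nhds (T (sym w₀) ν₀), C ∈ B ↔ f (matL C, cov C) = 0)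
    (hd : d + Module.finrank 𝕜 F = 9) : IsSubmanifoldAt 𝕜 B d (T (sym w₀) ν₀) := by
  have hc1 : ContDiff 𝕜 ∞ (matL : W 𝕜 → _) :=
    (LinearMap.toContinuousLinearMap (matL (𝕜 := 𝕜))).contDiff
  have hc2 : ContDiff 𝕜 ∞ (cov : W 𝕜 → _) :=
    (LinearMap.toContinuousLinearMap (cov (𝕜 := 𝕜))).contDiff
  refine .of_affine (fun C => f (matL C, cov C)) (hf.comp (hc1.prodMk hc2))
    (TL ∘ₗ hs.mk' s) (fun v => ?_) hB (by rw [hd, finrank_W])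
  have e : T (sym w₀) ν₀ + (TL ∘ₗ hs.mk' s) v = T (sym ((w₀, ν₀) + s v).1) ((w₀, ν₀) + s v).2 := by
    change TL (w₀, ν₀) + TL (s v) = TL ((w₀, ν₀) + s v)
    rw [map_add]
  rw [e, matL_T_sym, cov_T (sym_isSymm _)]
  exact hfs v

theorem det_sym (w : Fin 6 → 𝕜) : (sym w).det = w 0 * (w 3 * w 5 - w 4 ^ 2) -
    w 1 * (w 1 * w 5 - w 2 * w 4) + w 2 * (w 1 * w 4 - w 2 * w 3) := by
  simp [sym, Matrix.det_fin_three]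
  ring

theorem adjugate_sym (w : Fin 6 → 𝕜) : (sym w).adjugate =
    sym ![w 3 * w 5 - w 4 ^ 2, w 2 * w 4 - w 1 * w 5, w 1 * w 4 - w 2 * w 3,
      w 0 * w 5 - w 2 ^ 2, w 1 * w 2 - w 0 * w 4, w 0 * w 3 - w 1 ^ 2] := by
  rw [Matrix.adjugate_fin_three]
  ext i k
  fin_cases i <;> fin_cases k <;> simp [sym] <;> ring

theorem sym_eq_zero_iff (w : Fin 6 → 𝕜) : sym w = 0 ↔ w = 0 := by
  constructor
  · intro h
    have h' := fun i k => congrFun (congrFun h i) k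
    ext i
    fin_cases i
    exacts [h' 0 0, h' 0 1, h' 0 2, h' 1 1, h' 1 2, h' 2 2]
  · rintro rfl
    ext i k
    fin_cases i <;> fin_cases k <;> rfl

/-- Where `w 0` does not vanish, the three minors through this entry imply the other three. This
reduces the six equations for rank at most one to three independent ones. -/
theorem adjugate_sym_eq_zero_iff {w : Fin 6 → 𝕜} (h0 : w 0 ≠ 0) : (sym w).adjugate = 0 ↔
    w 0 * w 3 - w 1 ^ 2 = 0 ∧ w 0 * w 5 - w 2 ^ 2 = 0 ∧ w 0 * w 4 - w 1 * w 2 = 0 := by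
  rw [adjugate_sym, sym_eq_zero_iff]
  constructor
  · intro h
    have h3 := congrFun h 3
    have h4 := congrFun h 4
    have h5 := congrFun h 5
    simp at h3 h4 h5
    exact ⟨h5, h3, by linear_combination -h4⟩
  · rintro ⟨h1, h2, h3⟩
    ext i
    fin_cases i <;> simp <;> apply mul_left_cancel₀ h0 <;> rw [mul_zero]
    · apply mul_left_cancel₀ h0
      linear_combination w 5 * w 0 * h1 + w 1 ^ 2 * h2 - (w 0 * w 4 + w 1 * w 2) * h3
    · linear_combination w 2 * h3 - w 1 * h2
    · linear_combination w 1 * h3 - w 2 * h1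
    · linear_combination w 0 * h2
    · linear_combination -w 0 * h3
    · linear_combination w 0 * h1

theorem sym_mulVec (w : Fin 6 → 𝕜) (ν : V 𝕜) : sym w *ᵥ ν =
    ![w 0 * ν 0 + w 1 * ν 1 + w 2 * ν 2, w 1 * ν 0 + w 3 * ν 1 + w 4 * ν 2,
      w 2 * ν 0 + w 4 * ν 1 + w 5 * ν 2] := by
  ext i
  fin_cases i <;> simp [sym, Matrix.mulVec, dotProduct, Fin.sum_univ_three]

theorem vec_three_eq_zero_iff (a b c : 𝕜) : (![a, b, c] : V 𝕜) = 0 ↔ a = 0 ∧ b = 0 ∧ c = 0 := by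
  simp [funext_iff, Fin.forall_fin_succ]

theorem covec_zero_iff (ν : V 𝕜) : ν = 0 ↔ ν 0 = 0 ∧ ν 1 = 0 ∧ ν 2 = 0 := by
  simp [funext_iff, Fin.forall_fin_succ]

theorem diagW_zero : (diagW 0 0 0 : Fin 6 → 𝕜) = 0 := by
  ext i
  fin_cases i <;> rfl

theorem isSubmanifoldAt_rank_zero {B : Set (W 𝕜)}
    (hB : ∀ᶠ C in nhds (T (sym 0) 0), C ∈ B ↔ mat C = 0 ∧ cov C = 0) :
    IsSubmanifoldAt 𝕜 B 0 (T (sym 0) 0) := by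
  refine .of_coordinates (F := (Fin 6 → 𝕜) × V 𝕜) (fun p => p) contDiff_id (fun v => v)
    ⟨fun _ _ => rfl, fun _ _ => rfl⟩ ?_ ?_ (by simp)
  · intro v
    rw [show ((0 : Fin 6 → 𝕜), (0 : V 𝕜)) = 0 from rfl, zero_add]
  · filter_upwards [hB] with C hC
    rw [hC, mat, sym_eq_zero_iff, Prod.mk_eq_zero]

theorem isSubmanifoldAt_rank_one {B : Set (W 𝕜)}
    (hB : ∀ᶠ C in nhds (T (sym (diagW 1 0 0)) 0), C ∈ B ↔ (mat C).adjugate = 0 ∧ cov C = 0) :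
    IsSubmanifoldAt 𝕜 B 3 (T (sym (diagW 1 0 0)) 0) := by
  refine .of_coordinates (F := Fin 6 → 𝕜) (fun p => ![p.1 0 * p.1 3 - p.1 1 ^ 2,
    p.1 0 * p.1 5 - p.1 2 ^ 2, p.1 0 * p.1 4 - p.1 1 * p.1 2, p.2 0, p.2 1, p.2 2]) ?_
    (fun v => (![0, 0, 0, v 0, v 2, v 1], ![v 3, v 4, v 5])) ?_ ?_ ?_ (by simp)
  · refine contDiff_pi.2 fun i => ?_
    fin_cases i <;> simp <;> fun_prop
  · refine ⟨fun x y => Prod.ext ?_ ?_, fun c x => Prod.ext ?_ ?_⟩ <;> ext i <;> fin_cases i <;> simp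
  · intro v
    ext i
    fin_cases i <;> simp [diagW]
  · have h0 : ∀ᶠ C in nhds (T (sym (diagW 1 0 0)) 0 : W 𝕜), matL C 0 ≠ 0 := by
      refine ((continuous_apply 0).comp continuous_matL).continuousAt.eventually_ne ?_
      simp [matL_T_sym, diagW]
    filter_upwards [hB, h0] with C h1 h2
    rw [h1, mat, adjugate_sym_eq_zero_iff h2, covec_zero_iff]
    simp [funext_iff, Fin.forall_fin_succ, and_assoc]

theorem isSubmanifoldAt_rank_two {B : Set (W 𝕜)} {ε : 𝕜} (hε : ε ≠ 0)
    (hB : ∀ᶠ C in nhds (T (sym (diagW 1 ε 0)) 0), C ∈ B ↔ (mat C).det = 0 ∧ cov C = 0) :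
    IsSubmanifoldAt 𝕜 B 5 (T (sym (diagW 1 ε 0)) 0) := by
  refine .of_coordinates (F := Fin 4 → 𝕜) (fun p => ![p.1 0 * (p.1 3 * p.1 5 - p.1 4 ^ 2) -
    p.1 1 * (p.1 1 * p.1 5 - p.1 2 * p.1 4) + p.1 2 * (p.1 1 * p.1 4 - p.1 2 * p.1 3),
    p.2 0, p.2 1, p.2 2]) ?_
    -- At `diag(1, ε, 0)` the determinant is `ε` times the last entry when only that entry moves.
    (fun v => (![0, 0, 0, 0, 0, ε⁻¹ * v 0], ![v 1, v 2, v 3])) ?_ ?_ ?_ (by simp)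
  · refine contDiff_pi.2 fun i => ?_
    fin_cases i <;> simp <;> fun_prop
  · refine ⟨fun x y => Prod.ext ?_ ?_, fun c x => Prod.ext ?_ ?_⟩ <;> ext i <;> fin_cases i <;>
      simp <;> ring
  · intro v
    ext i
    fin_cases i <;> simp [diagW, hε]
  · filter_upwards [hB] with C h1
    rw [h1, mat, det_sym, covec_zero_iff]
    simp [funext_iff, Fin.forall_fin_succ]

theorem isSubmanifoldAt_rank_three {B : Set (W 𝕜)} (w₀ : Fin 6 → 𝕜)
    (hB : ∀ᶠ C in nhds (T (sym w₀) 0), C ∈ B ↔ cov C = 0) :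
    IsSubmanifoldAt 𝕜 B 6 (T (sym w₀) 0) := by
  refine .of_coordinates (F := Fin 3 → 𝕜) (fun p => p.2) contDiff_snd
    (fun v => (0, v)) ?_ ?_ hB (by simp)
  · exact ⟨fun x y => by simp, fun c x => by simp⟩
  · intro v
    simp

end Coordinates

/-! ### The orbits as submanifolds -/

/-- Near its representative an orbit coincides with its closure. -/
theorem eventually_mem_orbit_iff (t : BianchiClass) :
    ∀ᶠ C in nhds t.rep, C ∈ t.orbit ↔ C ∈ Z t := by
  -- There are infinitely many classes, but a proper degeneration always ends in one of these five;
  -- so only finitely many closed sets have to be avoided.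
  set P : Set BianchiClass := {s ∈ ({.I, .II, .V, .VI₀, .VII₀} : Set BianchiClass) |
    Degenerates s t ∧ s ≠ t} with hP
  have hfin : P.Finite := Set.Finite.subset (s := {.I, .II, .V, .VI₀, .VII₀}) (by simp)
    (Set.sep_subset _ _)
  have hcl : IsClosed (⋃ s ∈ P, Z s) := hfin.isClosed_biUnion fun s _ => isClosed_Z s
  have hrep : t.rep ∉ ⋃ s ∈ P, Z s := by
    intro h
    obtain ⟨s, hs, h⟩ := Set.mem_iUnion₂.1 h
    exact hs.2.2 (hs.2.1.antisymm ((rep_mem_Z_iff t s).1 h))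
  filter_upwards [hcl.isOpen_compl.mem_nhds hrep] with C hC
  refine ⟨fun h => orbit_subset_Z t h, fun h => ?_⟩
  obtain ⟨s, hs, hCs⟩ := mem_Z_iff.1 h
  by_cases hst : s = t
  · exact hst ▸ hCs
  · refine absurd (Set.mem_iUnion₂.2 ⟨s, ⟨?_, hs, hst⟩, orbit_subset_Z s hCs⟩) hC
    rcases hs with h | h | h | h | h | h <;> simp_all

theorem isSubmanifoldOfDim_orbit_of_rep {t : BianchiClass} {d : ℕ}
    (h : IsSubmanifoldAt ℝ t.orbit d t.rep) : IsSubmanifoldOfDim ℝ t.orbit d :=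
  fun _ hx => h.of_mem_orbit (smul_mem_orbit t) hx

/-- A singular symmetric matrix has an adjugate of rank at most one: its last diagonal entry times
the adjugate is `u uᵀ` for the last column `u`. So the sign of that one minor decides the sign of
the whole form. -/
theorem mul_qf_adjugate_sym {w : Fin 6 → ℝ} (h : (sym w).det = 0) (x : V ℝ) :
    (w 0 * w 3 - w 1 ^ 2) * qf (sym w).adjugate x = ((w 1 * w 4 - w 2 * w 3) * x 0 +
      (w 1 * w 2 - w 0 * w 4) * x 1 + (w 0 * w 3 - w 1 ^ 2) * x 2) ^ 2 := by
  rw [det_sym] at h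
  rw [adjugate_sym, qf, sym_mulVec]
  simp [dotProduct, Fin.sum_univ_three]
  linear_combination (w 3 * x 0 ^ 2 - 2 * w 1 * x 0 * x 1 + w 0 * x 1 ^ 2) * h

/-- For a symmetric matrix of rank two, `ν νᵀ` is determined by one of its entries. -/
theorem vecMulVec_eq_smul_adjugate {w : Fin 6 → ℝ} {ν : V ℝ} {k : ℝ} (hm : w 0 * w 3 - w 1 ^ 2 ≠ 0)
    (hν : sym w *ᵥ ν = 0) (h : ν 2 ^ 2 = k * (w 0 * w 3 - w 1 ^ 2)) (hdet : (sym w).det = 0) :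
    Matrix.vecMulVec ν ν = k • (sym w).adjugate := by
  rw [sym_mulVec, vec_three_eq_zero_iff] at hν
  obtain ⟨h0, h1, h2⟩ := hν
  rw [det_sym] at hdet
  have e0 : (w 0 * w 3 - w 1 ^ 2) * ν 0 = ν 2 * (w 1 * w 4 - w 2 * w 3) := by
    linear_combination w 3 * h0 - w 1 * h1
  have e1 : (w 0 * w 3 - w 1 ^ 2) * ν 1 = ν 2 * (w 1 * w 2 - w 0 * w 4) := by
    linear_combination w 0 * h1 - w 1 * h0
  set m := w 0 * w 3 - w 1 ^ 2 with hmd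
  have hm2 : m * m ≠ 0 := mul_ne_zero hm hm
  have key : ∀ a b α β γ : ℝ, m * a = ν 2 * α → m * b = ν 2 * β → α * β = m * γ → a * b = k * γ := by
    intro a b α β γ ha hb hab
    apply mul_left_cancel₀ hm2
    linear_combination m * b * ha + ν 2 * α * hb + ν 2 ^ 2 * hab + m * γ * h
  have a00 : (w 1 * w 4 - w 2 * w 3) * (w 1 * w 4 - w 2 * w 3) = m * (w 3 * w 5 - w 4 ^ 2) := by
    rw [hmd]
    linear_combination -w 3 * hdet
  have a01 : (w 1 * w 4 - w 2 * w 3) * (w 1 * w 2 - w 0 * w 4) = m * (w 2 * w 4 - w 1 * w 5) := by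
    rw [hmd]
    linear_combination w 1 * hdet
  have a11 : (w 1 * w 2 - w 0 * w 4) * (w 1 * w 2 - w 0 * w 4) = m * (w 0 * w 5 - w 2 ^ 2) := by
    rw [hmd]
    linear_combination -w 0 * hdet
  have e2 : m * ν 2 = ν 2 * m := mul_comm _ _
  have hsym : (Matrix.vecMulVec ν ν).IsSymm := by
    ext i l
    simp [Matrix.vecMulVec_apply, mul_comm]
  have hsym' : (k • (sym w).adjugate).IsSymm := by
    rw [adjugate_sym]
    exact (sym_isSymm _).smul k
  rw [eq_sym hsym, eq_sym hsym', adjugate_sym]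
  congr 1
  ext i
  fin_cases i <;> simp [Matrix.vecMulVec_apply, sym]
  · exact key _ _ _ _ _ e0 e0 a00
  · exact key _ _ _ _ _ e0 e1 a01
  · exact key _ _ _ _ _ e0 e2 (by ring)
  · exact key _ _ _ _ _ e1 e1 a11
  · exact key _ _ _ _ _ e1 e2 (by ring)
  · linear_combination h

theorem det_eq_zero_of_mulVec {A : Matrix (Fin 3) (Fin 3) ℝ} {ν : V ℝ} (hν : ν ≠ 0)
    (h : A *ᵥ ν = 0) : A.det = 0 :=
  Matrix.exists_mulVec_eq_zero_iff.1 ⟨ν, hν, h⟩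

/-- Near a covector with nonzero last coordinate, `A ν = 0` consists of three independent equations
that can be solved for the last column of `A`. They describe the union over all `h`; a single `h`
costs one more equation. -/
theorem isSubmanifoldAt_of_mulVec {B : Set (W ℝ)} {ε h : ℝ} (hh : h ≠ 0)
    (hB : ∀ᶠ C in nhds (T (sym (diagW 1 ε 0)) ![0, 0, h]), C ∈ B ↔ mat C *ᵥ cov C = 0) :
    IsSubmanifoldAt ℝ B 6 (T (sym (diagW 1 ε 0)) ![0, 0, h]) := by
  refine .of_coordinates (F := Fin 3 → ℝ) (fun p => ![p.1 0 * p.2 0 + p.1 1 * p.2 1 + p.1 2 * p.2 2,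
      p.1 1 * p.2 0 + p.1 3 * p.2 1 + p.1 4 * p.2 2,
      p.1 2 * p.2 0 + p.1 4 * p.2 1 + p.1 5 * p.2 2]) ?_
    (fun v => (![0, 0, h⁻¹ * v 0, 0, h⁻¹ * v 1, h⁻¹ * v 2], 0)) ?_ ?_ ?_ (by simp)
  · refine contDiff_pi.2 fun i => ?_
    fin_cases i <;> simp <;> fun_prop
  · refine ⟨fun x y => Prod.ext ?_ ?_, fun c x => Prod.ext ?_ ?_⟩ <;> ext i <;> fin_cases i <;>
      simp <;> ring
  · intro v
    ext i
    fin_cases i <;> simp [diagW] <;> field_simp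
  · filter_upwards [hB] with C h1
    rw [h1, mat, sym_mulVec]

theorem isSubmanifoldAt_of_mulVec_of_sq {B : Set (W ℝ)} {ε h k : ℝ} (hh : h ≠ 0)
    (hk : h ^ 2 = k * ε)
    (hB : ∀ᶠ C in nhds (T (sym (diagW 1 ε 0)) ![0, 0, h]), C ∈ B ↔ mat C *ᵥ cov C = 0 ∧
      cov C 2 ^ 2 = k * (matL C 0 * matL C 3 - matL C 1 ^ 2)) :
    IsSubmanifoldAt ℝ B 5 (T (sym (diagW 1 ε 0)) ![0, 0, h]) := by
  refine .of_coordinates (F := Fin 4 → ℝ) (fun p => ![p.1 0 * p.2 0 + p.1 1 * p.2 1 + p.1 2 * p.2 2,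
      p.1 1 * p.2 0 + p.1 3 * p.2 1 + p.1 4 * p.2 2,
      p.1 2 * p.2 0 + p.1 4 * p.2 1 + p.1 5 * p.2 2,
      k * (p.1 0 * p.1 3 - p.1 1 ^ 2) - p.2 2 ^ 2]) ?_
    -- Because `k ε = h²`, changing the first entry by `v 3 / h²` changes the last equation by
    -- exactly `v 3`; the last column takes care of the other three.
    (fun v => (![(h ^ 2)⁻¹ * v 3, 0, h⁻¹ * v 0, 0, h⁻¹ * v 1, h⁻¹ * v 2], 0)) ?_ ?_ ?_ (by simp)
  · refine contDiff_pi.2 fun i => ?_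
    fin_cases i <;> simp <;> fun_prop
  · refine ⟨fun x y => Prod.ext ?_ ?_, fun c x => Prod.ext ?_ ?_⟩ <;> ext i <;> fin_cases i <;>
      simp <;> ring
  · intro v
    ext i
    fin_cases i <;> simp [diagW] <;> field_simp
    linear_combination (-(h ^ 2 + v 3)) * hk
  · filter_upwards [hB] with C h1
    rw [h1, mat, sym_mulVec, vec_three_eq_zero_iff]
    rw [@eq_comm _ (cov C 2 ^ 2)]
    simp [funext_iff, Fin.forall_fin_succ, and_assoc, sub_eq_zero]

/-- The upper triangle of the matrix of a representative. -/
noncomputable def BianchiClass.upper : BianchiClass → Fin 6 → ℝ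
  | .I => diagW 0 0 0
  | .II => diagW 1 0 0
  | .IV => diagW 1 0 0
  | .V => diagW 0 0 0
  | .VI _ _ => diagW 1 (-1) 0
  | .VII _ _ => diagW 1 1 0
  | .VIII => diagW 1 1 (-1)
  | .IX => diagW 1 1 1

theorem rep_eq_sym (t : BianchiClass) : t.rep = T (sym t.upper) t.covec := by
  rw [rep_eq]
  cases t <;> simp only [BianchiClass.mat, diagonal_fin_three] <;> rfl

theorem eventually_pos {x : W ℝ} {p : (Fin 6 → ℝ) × V ℝ → ℝ} (hp : Continuous p)
    (h : 0 < p (matL x, cov x)) : ∀ᶠ C in nhds x, 0 < p (matL C, cov C) := by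
  have : Continuous fun C : W ℝ => (matL C, cov C) := continuous_matL.prodMk continuous_cov
  exact continuousAt_const.eventually_lt (hp.comp this).continuousAt h

theorem isSubmanifoldAt_I : IsSubmanifoldAt ℝ BianchiClass.I.orbit 0 BianchiClass.I.rep := by
  have h := eventually_mem_orbit_iff .I
  rw [rep_eq_sym] at h ⊢
  simp only [BianchiClass.upper, diagW_zero, BianchiClass.covec, vec_three_zero] at h ⊢
  exact isSubmanifoldAt_rank_zero h

theorem isSubmanifoldAt_V : IsSubmanifoldAt ℝ BianchiClass.V.orbit 3 BianchiClass.V.rep := by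
  have h := eventually_mem_orbit_iff .V
  rw [rep_eq_sym] at h ⊢
  refine .of_coordinates (F := Fin 6 → ℝ) (fun p => p.1) contDiff_fst (fun v => (v, 0))
    ⟨fun _ _ => by simp, fun _ _ => by simp⟩ ?_ ?_ (by simp)
  · intro v
    simp [BianchiClass.upper, diagW_zero]
  · filter_upwards [h] with C hC
    rw [hC]
    change sym (matL C) = 0 ↔ _
    rw [sym_eq_zero_iff]

theorem isSubmanifoldAt_II : IsSubmanifoldAt ℝ BianchiClass.II.orbit 3 BianchiClass.II.rep := by
  have h := eventually_mem_orbit_iff .II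
  rw [rep_eq_sym] at h ⊢
  simp only [BianchiClass.upper, BianchiClass.covec, vec_three_zero] at h ⊢
  exact isSubmanifoldAt_rank_one h

/-- On rank-one matrices with nonzero first entry every row is a multiple of the first, so `A ν = 0`
is a single equation beyond the three minors. -/
theorem isSubmanifoldAt_IV : IsSubmanifoldAt ℝ BianchiClass.IV.orbit 5 BianchiClass.IV.rep := by
  have h := eventually_mem_orbit_iff .IV
  have h0 := eventually_pos (x := BianchiClass.IV.rep) (p := fun p => p.1 0) (by fun_prop) (by
    rw [rep_eq_sym, matL_T_sym]
    simp [BianchiClass.upper, diagW])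
  rw [rep_eq_sym] at h h0 ⊢
  refine .of_coordinates (F := Fin 4 → ℝ) (fun p => ![p.1 0 * p.1 3 - p.1 1 ^ 2,
    p.1 0 * p.1 5 - p.1 2 ^ 2, p.1 0 * p.1 4 - p.1 1 * p.1 2,
    p.1 0 * p.2 0 + p.1 1 * p.2 1 + p.1 2 * p.2 2]) ?_
    (fun v => (![0, 0, 0, v 0, v 2, v 1], ![v 3, 0, 0])) ?_ ?_ ?_ (by simp)
  · refine contDiff_pi.2 fun i => ?_
    fin_cases i <;> simp <;> fun_prop
  · refine ⟨fun x y => Prod.ext ?_ ?_, fun c x => Prod.ext ?_ ?_⟩ <;> ext i <;> fin_cases i <;> simp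
  · intro v
    ext i
    fin_cases i <;> simp [BianchiClass.upper, diagW, BianchiClass.covec]
  · filter_upwards [h, h0] with C hC h0
    rw [hC]
    change (sym (matL C)).adjugate = 0 ∧ sym (matL C) *ᵥ cov C = 0 ↔ _
    rw [adjugate_sym_eq_zero_iff h0.ne', sym_mulVec, vec_three_eq_zero_iff]
    generalize matL C = w at *
    generalize cov C = ν
    simp only [funext_iff, Fin.forall_fin_succ]
    simp only [Pi.zero_apply, IsEmpty.forall_iff, and_true]
    simp
    constructor
    · rintro ⟨⟨h1, h2, h3⟩, h4, -, -⟩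
      exact ⟨h1, h2, h3, h4⟩
    · rintro ⟨h1, h2, h3, h4⟩
      refine ⟨⟨h1, h2, h3⟩, h4, ?_, ?_⟩
      · apply mul_left_cancel₀ h0.ne'
        linear_combination w 1 * h4 + ν 1 * h1 + ν 2 * h3
      · apply mul_left_cancel₀ h0.ne'
        linear_combination w 2 * h4 + ν 1 * h3 + ν 2 * h2

theorem isSubmanifoldAt_VIII : IsSubmanifoldAt ℝ BianchiClass.VIII.orbit 6 BianchiClass.VIII.rep := by
  have h := eventually_mem_orbit_iff .VIII
  have h0 := eventually_pos (x := BianchiClass.VIII.rep) (p := fun p => p.1 0) (by fun_prop) (by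
    rw [rep_eq_sym, matL_T_sym]
    simp [BianchiClass.upper, diagW])
  have h5 := eventually_pos (x := BianchiClass.VIII.rep) (p := fun p => -p.1 5) (by fun_prop) (by
    rw [rep_eq_sym, matL_T_sym]
    simp [BianchiClass.upper, diagW])
  rw [rep_eq_sym] at h h0 h5 ⊢
  simp only [BianchiClass.upper, BianchiClass.covec, vec_three_zero] at h h0 h5 ⊢
  refine isSubmanifoldAt_rank_three _ ?_
  -- Two diagonal entries of opposite sign persist nearby and exclude definiteness, so only `ν = 0`
  -- remains of the conditions.
  filter_upwards [h, h0, h5] with C hC h0 h5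
  rw [hC]
  refine ⟨fun h => h.2, fun h => ⟨?_, h⟩⟩
  have e : ∀ i : Fin 3, (Pi.single i 1 : V ℝ) ≠ 0 := fun i => by simp
  rintro (h | h)
  · have := h _ (e 2)
    simp [qf, mat, sym] at this
    linarith
  · have := h _ (e 0)
    simp [qf, mat, sym] at this
    linarith

theorem isSubmanifoldAt_IX : IsSubmanifoldAt ℝ BianchiClass.IX.orbit 6 BianchiClass.IX.rep := by
  have h := eventually_mem_orbit_iff .IX
  have h0 := eventually_pos (x := BianchiClass.IX.rep) (p := fun p => p.1 0) (by fun_prop) (by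
    rw [rep_eq_sym, matL_T_sym]
    simp [BianchiClass.upper, diagW])
  have h1 := eventually_pos (x := BianchiClass.IX.rep)
    (p := fun p => p.1 0 * p.1 3 - p.1 1 ^ 2) (by fun_prop) (by
      rw [rep_eq_sym, matL_T_sym]
      simp [BianchiClass.upper, diagW])
  have h2 := eventually_pos (x := BianchiClass.IX.rep)
    (p := fun p => (sym p.1).det) ((continuous_sym.comp continuous_fst).matrix_det) (by
      rw [rep_eq_sym, matL_T_sym]
      simp [BianchiClass.upper, diagW, sym, Matrix.det_fin_three])
  rw [rep_eq_sym] at h h0 h1 h2 ⊢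
  simp only [BianchiClass.upper, BianchiClass.covec, vec_three_zero] at h h0 h1 h2 ⊢
  refine isSubmanifoldAt_rank_three _ ?_
  filter_upwards [h, h0, h1, h2] with C hC h0 h1 h2
  rw [hC]
  refine ⟨fun h => h.2, fun h => ⟨Or.inl fun x => ?_, h⟩⟩
  rcases eq_or_ne x 0 with rfl | hx
  · simp [qf]
  · exact ((pos_iff_minors (matL C)).2 ⟨h0, h1, h2⟩ x hx).le

theorem isSubmanifoldAt_VI (h : ℝ) (hh : h ≤ 0) :
    IsSubmanifoldAt ℝ (BianchiClass.VI h hh).orbit 5 (BianchiClass.VI h hh).rep := by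
  have hZ := eventually_mem_orbit_iff (.VI h hh)
  have hm := eventually_pos (x := (BianchiClass.VI h hh).rep)
    (p := fun p => -(p.1 0 * p.1 3 - p.1 1 ^ 2)) (by fun_prop) (by
      rw [rep_eq_sym, matL_T_sym]
      simp [BianchiClass.upper, diagW])
  have hadj : ∀ w : Fin 6 → ℝ, 0 < -(w 0 * w 3 - w 1 ^ 2) → (sym w).det = 0 →
      ∀ x, qf (sym w).adjugate x ≤ 0 := by
    intro w hw hd x
    have := mul_qf_adjugate_sym hd x
    by_contra! hx
    have h1 := mul_pos hw hx
    nlinarith [sq_nonneg ((w 1 * w 4 - w 2 * w 3) * x 0 +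
      (w 1 * w 2 - w 0 * w 4) * x 1 + (w 0 * w 3 - w 1 ^ 2) * x 2)]
  -- For `h = 0` the relation forces `ν = 0` and the determinant is a genuine equation. For `h ≠ 0`
  -- the covector is nonzero nearby, so `A ν = 0` implies `det A = 0`, and one entry of the relation
  -- implies the others.
  rcases eq_or_ne h 0 with rfl | h0
  · rw [rep_eq_sym] at hZ hm ⊢
    simp only [BianchiClass.upper, BianchiClass.covec, vec_three_zero] at hZ hm ⊢
    refine isSubmanifoldAt_rank_two (by norm_num) ?_
    filter_upwards [hZ, hm] with C hC hm
    rw [hC]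
    constructor
    · rintro ⟨-, h2, -, h4⟩
      refine ⟨h2, ?_⟩
      ext i
      have := congrFun (congrFun h4 i) i
      simpa [Matrix.vecMulVec_apply] using this
    · rintro ⟨h1, h2⟩
      refine ⟨by rw [h2, Matrix.mulVec_zero], h1, hadj _ hm h1, by simp [h2]⟩
  · have hn := ((continuous_apply 2).comp continuous_cov).continuousAt.eventually_ne
      (x := (BianchiClass.VI h hh).rep) (y := 0) (by simpa [cov_rep, BianchiClass.covec] using h0)
    rw [rep_eq_sym] at hZ hm hn ⊢
    refine isSubmanifoldAt_of_mulVec_of_sq (k := -h ^ 2) h0 (by ring) ?_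
    filter_upwards [hZ, hm, hn] with C hC hm hn
    rw [hC]
    constructor
    · rintro ⟨h1, -, -, h4⟩
      refine ⟨h1, ?_⟩
      have := congrFun (congrFun h4 2) 2
      rw [mat, adjugate_sym] at this
      simpa [Matrix.vecMulVec_apply, sym, sq] using this
    · rintro ⟨h1, h2⟩
      have hd := det_eq_zero_of_mulVec (fun e => hn (by simp [e])) h1
      exact ⟨h1, hd, hadj _ hm hd, vecMulVec_eq_smul_adjugate (neg_pos.1 hm).ne h1 h2 hd⟩

theorem qf_adjugate_nonneg {w : Fin 6 → ℝ} (hw : 0 < w 0 * w 3 - w 1 ^ 2) (hd : (sym w).det = 0)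
    (x : V ℝ) : 0 ≤ qf (sym w).adjugate x := by
  refine nonneg_of_mul_nonneg_right (a := w 0 * w 3 - w 1 ^ 2) ?_ hw
  rw [mul_qf_adjugate_sym hd x]
  exact sq_nonneg _

theorem isSubmanifoldAt_VII (h : ℝ) (hh : 0 ≤ h) :
    IsSubmanifoldAt ℝ (BianchiClass.VII h hh).orbit 5 (BianchiClass.VII h hh).rep := by
  have hZ := eventually_mem_orbit_iff (.VII h hh)
  have hm := eventually_pos (x := (BianchiClass.VII h hh).rep)
    (p := fun p => p.1 0 * p.1 3 - p.1 1 ^ 2) (by fun_prop) (by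
      rw [rep_eq_sym, matL_T_sym]
      simp [BianchiClass.upper, diagW])
  rcases eq_or_ne h 0 with rfl | h0
  · rw [rep_eq_sym] at hZ hm ⊢
    simp only [BianchiClass.upper, BianchiClass.covec, vec_three_zero] at hZ hm ⊢
    refine isSubmanifoldAt_rank_two (by norm_num) ?_
    filter_upwards [hZ, hm] with C hC hm
    rw [hC]
    constructor
    · rintro ⟨-, h2, -, h4⟩
      refine ⟨h2, ?_⟩
      ext i
      have := congrFun (congrFun h4 i) i
      simpa [Matrix.vecMulVec_apply] using this
    · rintro ⟨h1, h2⟩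
      refine ⟨by rw [h2, Matrix.mulVec_zero], h1, qf_adjugate_nonneg hm h1, by simp [h2]⟩
  · have hn := ((continuous_apply 2).comp continuous_cov).continuousAt.eventually_ne
      (x := (BianchiClass.VII h hh).rep) (y := 0) (by simpa [cov_rep, BianchiClass.covec] using h0)
    rw [rep_eq_sym] at hZ hm hn ⊢
    refine isSubmanifoldAt_of_mulVec_of_sq (k := h ^ 2) h0 (by ring) ?_
    filter_upwards [hZ, hm, hn] with C hC hm hn
    rw [hC]
    constructor
    · rintro ⟨h1, -, -, h4⟩
      refine ⟨h1, ?_⟩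
      have := congrFun (congrFun h4 2) 2
      rw [mat, adjugate_sym] at this
      simpa [Matrix.vecMulVec_apply, sym, sq] using this
    · rintro ⟨h1, h2⟩
      have hd := det_eq_zero_of_mulVec (fun e => hn (by simp [e])) h1
      exact ⟨h1, hd, qf_adjugate_nonneg hm hd, vecMulVec_eq_smul_adjugate hm.ne' h1 h2 hd⟩

theorem isSubmanifoldOfDim_orbit (t : BianchiClass) :
    IsSubmanifoldOfDim ℝ t.orbit t.orbitDim := by
  refine isSubmanifoldOfDim_orbit_of_rep ?_
  cases t with
  | I => exact isSubmanifoldAt_I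
  | II => exact isSubmanifoldAt_II
  | IV => exact isSubmanifoldAt_IV
  | V => exact isSubmanifoldAt_V
  | VI h hh => exact isSubmanifoldAt_VI h hh
  | VII h hh => exact isSubmanifoldAt_VII h hh
  | VIII => exact isSubmanifoldAt_VIII
  | IX => exact isSubmanifoldAt_IX

theorem isSubmanifoldOfDim_iUnion_VII :
    IsSubmanifoldOfDim ℝ (⋃ (h : ℝ) (hh : 0 < h), (BianchiClass.VII h hh.le).orbit) 6 := by
  intro D hD
  obtain ⟨h, hh, hD⟩ := Set.mem_iUnion₂.1 hD
  refine IsSubmanifoldAt.of_mem_orbit iUnion_VII_smul ?_ hD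
  have hm := eventually_pos (x := (BianchiClass.VII h hh.le).rep)
    (p := fun p => p.1 0 * p.1 3 - p.1 1 ^ 2) (by fun_prop) (by
      rw [rep_eq_sym, matL_T_sym]
      simp [BianchiClass.upper, diagW])
  have hn := ((continuous_apply 2).comp continuous_cov).continuousAt.eventually_ne
    (x := (BianchiClass.VII h hh.le).rep) (y := 0)
    (by simpa [cov_rep, BianchiClass.covec] using hh.ne')
  rw [rep_eq_sym] at hm hn ⊢
  refine isSubmanifoldAt_of_mulVec hh.ne' ?_
  filter_upwards [hm, hn] with C hm hn
  rw [Set.mem_iUnion₂]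
  constructor
  · rintro ⟨k, hk, hC⟩
    exact closureCond_mulVec (orbit_subset_Z _ hC)
  · intro h1
    have hd := det_eq_zero_of_mulVec (fun e => hn (by simp [e])) h1
    have hk : 0 < cov C 2 ^ 2 / (matL C 0 * matL C 3 - matL C 1 ^ 2) :=
      div_pos (sq_pos_of_ne_zero hn) hm
    -- The parameter is recovered from the ratio of the last entries of `ν νᵀ` and `adj A`, which is
    -- positive near the representative.
    have hZ : C ∈ Z (.VII (√(cov C 2 ^ 2 / (matL C 0 * matL C 3 - matL C 1 ^ 2)))
        (Real.sqrt_nonneg _)) := by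
      refine ⟨h1, hd, qf_adjugate_nonneg hm hd, vecMulVec_eq_smul_adjugate hm.ne' h1 ?_ hd⟩
      rw [Real.sq_sqrt hk.le]
      field_simp
    refine ⟨_, Real.sqrt_pos.2 hk, ?_⟩
    obtain ⟨s, hs, hCs⟩ := mem_Z_iff.1 hZ
    -- The proper degenerations of `VII_h` with `h > 0` have covector zero, while the covector of
    -- `C` does not vanish.
    have hcov : ∀ t : BianchiClass, t.covec = 0 → C ∉ t.orbit := by
      rintro t ht ⟨g, rfl⟩
      apply hn
      change cov (g • t.rep) 2 = 0
      rw [cov_smul, cov_rep, ht, Matrix.mulVec_zero]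
      rfl
    rcases hs with rfl | rfl | ⟨rfl, -⟩ | ⟨rfl, h⟩ | ⟨rfl, h⟩ | ⟨rfl, h | h⟩
    · exact hCs
    · exact absurd hCs (hcov _ vec_three_zero)
    · exact absurd hCs (hcov _ vec_three_zero)
    all_goals cases h

/-! ### The automorphism groups as matrix groups -/

theorem mem_aut_iff (t : BianchiClass) (g : GL (Fin 3) ℝ) : g ∈ t.aut ↔
    (g : Matrix (Fin 3) (Fin 3) ℝ) * t.mat * (g : Matrix (Fin 3) (Fin 3) ℝ)ᵀ =
      (g : Matrix (Fin 3) (Fin 3) ℝ).det • t.mat ∧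
    (g : Matrix (Fin 3) (Fin 3) ℝ)ᵀ *ᵥ t.covec = t.covec := by
  rw [BianchiClass.aut, rep_eq, mem_autGroup_T (mat_isSymm_rep t)]

/-- Multiplication by the adjugate removes the determinant and compares the entries of `M` with its
cofactors; for diagonal `A` the zeros of `M` become visible at once. -/
theorem conj_eq_iff_adjugate {M : Matrix (Fin 3) (Fin 3) ℝ} (hM : M.det ≠ 0)
    (A : Matrix (Fin 3) (Fin 3) ℝ) : M * A * Mᵀ = M.det • A ↔ A * Mᵀ = M.adjugate * A := by
  constructor
  · intro h
    have h' := congrArg (fun B => M.adjugate * B) h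
    simp only [← Matrix.mul_assoc, Matrix.adjugate_mul, Matrix.smul_mul, Matrix.one_mul,
      Matrix.mul_smul] at h'
    exact smul_right_injective _ hM (by simpa only [← Matrix.smul_mul] using h')
  · intro h
    rw [Matrix.mul_assoc, h, ← Matrix.mul_assoc, Matrix.mul_adjugate, Matrix.smul_mul,
      Matrix.one_mul]

theorem conj_diagonal_iff {M : Matrix (Fin 3) (Fin 3) ℝ} (hM : M.det ≠ 0) (d : Fin 3 → ℝ) :
    M * Matrix.diagonal d * Mᵀ = M.det • Matrix.diagonal d ↔
      ∀ i k, d i * M k i = M.adjugate i k * d k := by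
  rw [conj_eq_iff_adjugate hM, ← Matrix.ext_iff]
  simp only [Matrix.diagonal_mul, Matrix.mul_diagonal, Matrix.transpose_apply]

theorem transpose_mulVec_covec_iff {M : Matrix (Fin 3) (Fin 3) ℝ} {h : ℝ} (hh : h ≠ 0) :
    Mᵀ *ᵥ ![0, 0, h] = ![0, 0, h] ↔ M 2 0 = 0 ∧ M 2 1 = 0 ∧ M 2 2 = 1 := by
  have e : ∀ i, (Mᵀ *ᵥ ![0, 0, h]) i = M 2 i * h := by
    intro i
    simp [Matrix.mulVec, dotProduct, Fin.sum_univ_three]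
  rw [funext_iff]
  simp only [e, Fin.forall_fin_succ]
  simp [hh]

theorem conj_rank_one_iff {M : Matrix (Fin 3) (Fin 3) ℝ} (hM : M.det ≠ 0) :
    M * Matrix.diagonal ![1, 0, 0] * Mᵀ = M.det • Matrix.diagonal ![1, 0, 0] ↔
      M 1 0 = 0 ∧ M 2 0 = 0 ∧ M 0 0 = M 1 1 * M 2 2 - M 1 2 * M 2 1 := by
  rw [conj_diagonal_iff hM, Matrix.adjugate_fin_three]
  constructor
  · intro h
    have h0 := h 0 0
    have h1 := h 0 1
    have h2 := h 0 2
    simp at h0 h1 h2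
    exact ⟨h1, h2, h0⟩
  · rintro ⟨h1, h2, h3⟩ i k
    fin_cases i <;> fin_cases k <;> simp [h1, h2, h3]

theorem conj_rank_two_iff {M : Matrix (Fin 3) (Fin 3) ℝ} (hM : M.det ≠ 0) {ε : ℝ} (hε : ε ≠ 0) :
    M * Matrix.diagonal ![1, ε, 0] * Mᵀ = M.det • Matrix.diagonal ![1, ε, 0] ↔
      M 2 0 = 0 ∧ M 2 1 = 0 ∧ M 0 0 = M 1 1 * M 2 2 ∧ M 1 1 = M 0 0 * M 2 2 ∧
      M 1 0 = -ε * (M 0 1 * M 2 2) ∧ ε * M 0 1 = -(M 1 0 * M 2 2) := by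
  rw [conj_diagonal_iff hM, Matrix.adjugate_fin_three]
  constructor
  · intro h
    have h20 := h 0 2
    have h21 := h 1 2
    have h00 := h 0 0
    have h01 := h 0 1
    have h10 := h 1 0
    have h11 := h 1 1
    simp [hε] at h20 h21
    simp [h20, h21] at h00 h01 h10 h11
    refine ⟨h20, h21, h00, ?_, by linear_combination h01, h10⟩
    apply mul_left_cancel₀ hε
    linear_combination h11
  · rintro ⟨h1, h2, h3, h4, h5, h6⟩ i k
    fin_cases i <;> fin_cases k <;> simp [h1, h2]
    · exact h3
    · linear_combination h5
    · exact h6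
    · linear_combination ε * h4

theorem conj_fin_two (a b c d ε l : ℝ) :
    !![a, b; c, d] * Matrix.diagonal ![1, ε] * !![a, b; c, d]ᵀ = l • Matrix.diagonal ![1, ε] ↔
      a ^ 2 + ε * b ^ 2 = l ∧ a * c + ε * b * d = 0 ∧ c ^ 2 + ε * d ^ 2 = l * ε := by
  have e : Matrix.diagonal ![1, ε] = !![1, 0; 0, ε] := by
    ext i k
    fin_cases i <;> fin_cases k <;> rfl
  have e' : !![a, b; c, d]ᵀ = !![a, c; b, d] := by
    ext i k
    fin_cases i <;> fin_cases k <;> rfl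
  rw [e, e', Matrix.mul_fin_two, Matrix.mul_fin_two, ← Matrix.ext_iff]
  simp [Fin.forall_fin_succ]
  constructor
  · rintro ⟨⟨h1, h2⟩, h3, h4⟩
    refine ⟨by linear_combination h1, by linear_combination h2, by linear_combination h4⟩
  · rintro ⟨h1, h2, h3⟩
    exact ⟨⟨by linear_combination h1, by linear_combination h2⟩, by linear_combination h2,
      by linear_combination h3⟩

/-- The two-dimensional version of the comparison with cofactors: each relation is obtained by
multiplying the conformal equations by the adjugate and cancelling the determinant. -/
theorem conformal_relations {a b c d ε l μ : ℝ} (hD : a * d - b * c ≠ 0)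
    (hμ : l = μ * (a * d - b * c)) (h1 : a ^ 2 + ε * b ^ 2 = l) (h2 : a * c + ε * b * d = 0)
    (h3 : c ^ 2 + ε * d ^ 2 = l * ε) (hε : ε ≠ 0) :
    a = d * μ ∧ d = a * μ ∧ c = -ε * (b * μ) ∧ ε * b = -(c * μ) := by
  subst hμ
  refine ⟨?_, ?_, ?_, ?_⟩
  · apply mul_right_cancel₀ hD
    linear_combination d * h1 - b * h2
  · apply mul_right_cancel₀ hD
    apply mul_right_cancel₀ hε
    linear_combination a * h3 - c * h2
  · apply mul_right_cancel₀ hD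
    linear_combination d * h2 - b * h3
  · apply mul_right_cancel₀ hD
    linear_combination a * h2 - c * h1

theorem det_block (g₁ : Matrix (Fin 2) (Fin 2) ℝ) (h : Fin 2 → ℝ) (c : ℝ) :
    (block g₁ h c).det = g₁.det * c := by
  simp [block, Matrix.det_fin_three, Matrix.det_fin_two]
  ring

theorem block_mul (g₁ g₁' : Matrix (Fin 2) (Fin 2) ℝ) (h h' : Fin 2 → ℝ) :
    block g₁ h 1 * block g₁' h' 1 = block (g₁ * g₁') (h + g₁ *ᵥ h') 1 := by
  ext i k
  fin_cases i <;> fin_cases k <;>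
    simp [block, Matrix.mul_apply, Fin.sum_univ_three, Matrix.mulVec, dotProduct,
      Fin.sum_univ_two, add_comm]

theorem block_injective {g₁ g₁' : Matrix (Fin 2) (Fin 2) ℝ} {h h' : Fin 2 → ℝ} {c c' : ℝ}
    (e : block g₁ h c = block g₁' h' c') : g₁ = g₁' ∧ h = h' := by
  have e' := fun i k => congrFun (congrFun e i) k
  constructor
  · ext i k
    fin_cases i <;> fin_cases k
    exacts [e' 0 0, e' 0 1, e' 1 0, e' 1 1]
  · ext i
    fin_cases i
    exacts [e' 0 2, e' 1 2]

theorem eq_block {M : Matrix (Fin 3) (Fin 3) ℝ} (h0 : M 2 0 = 0) (h1 : M 2 1 = 0) :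
    M = block !![M 0 0, M 0 1; M 1 0, M 1 1] ![M 0 2, M 1 2] (M 2 2) := by
  ext i k
  fin_cases i <;> fin_cases k <;> simp [block, h0, h1]

/-- The upper left block of an invertible matrix with last row `(0, 0, c)`. -/
theorem exists_eq_block (g : GL (Fin 3) ℝ) (h0 : (g : Matrix (Fin 3) (Fin 3) ℝ) 2 0 = 0)
    (h1 : (g : Matrix (Fin 3) (Fin 3) ℝ) 2 1 = 0) :
    ∃ (g₁ : GL (Fin 2) ℝ) (h : Fin 2 → ℝ), (g : Matrix (Fin 3) (Fin 3) ℝ) =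
      block (g₁ : Matrix (Fin 2) (Fin 2) ℝ) h ((g : Matrix (Fin 3) (Fin 3) ℝ) 2 2) := by
  have hd := GL_det_ne_zero g
  have e := eq_block h0 h1
  rw [e, det_block] at hd
  exact ⟨Matrix.GeneralLinearGroup.mkOfDetNeZero _ (left_ne_zero_of_mul hd), _, e⟩

/-- The full determinant is `c · det g₁`. Thus invariance of the rank-two form says that `g₁` is
conformal and that `c` is its conformal factor divided by its determinant. -/
theorem mem_aut_planar_iff {ε : ℝ} (hε : ε ≠ 0) (g : GL (Fin 3) ℝ) :
    (g : Matrix (Fin 3) (Fin 3) ℝ) * Matrix.diagonal ![1, ε, 0] *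
      (g : Matrix (Fin 3) (Fin 3) ℝ)ᵀ = (g : Matrix (Fin 3) (Fin 3) ℝ).det •
        Matrix.diagonal ![1, ε, 0] ↔
    ∃ (g₁ : GL (Fin 2) ℝ) (h : Fin 2 → ℝ) (c : ℝ), (g : Matrix (Fin 3) (Fin 3) ℝ) =
      block (g₁ : Matrix (Fin 2) (Fin 2) ℝ) h c ∧
      (g₁ : Matrix (Fin 2) (Fin 2) ℝ) * Matrix.diagonal ![1, ε] *
        (g₁ : Matrix (Fin 2) (Fin 2) ℝ)ᵀ =
        (c * (g₁ : Matrix (Fin 2) (Fin 2) ℝ).det) • Matrix.diagonal ![1, ε] := by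
  rw [conj_rank_two_iff (GL_det_ne_zero g) hε]
  constructor
  · rintro ⟨h1, h2, h3, h4, h5, h6⟩
    obtain ⟨g₁, h, e⟩ := exists_eq_block g h1 h2
    generalize (g : Matrix (Fin 3) (Fin 3) ℝ) 2 2 = c at *
    refine ⟨g₁, h, c, e, ?_⟩
    rw [Matrix.eta_fin_two (g₁ : Matrix (Fin 2) (Fin 2) ℝ), conj_fin_two, Matrix.det_fin_two_of]
    simp only [e] at h3 h4 h5 h6
    simp [block] at h3 h4 h5 h6
    refine ⟨?_, ?_, ?_⟩
    · linear_combination (g₁ : Matrix (Fin 2) (Fin 2) ℝ) 0 0 * h3 +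
        (g₁ : Matrix (Fin 2) (Fin 2) ℝ) 0 1 * h6
    · linear_combination (g₁ : Matrix (Fin 2) (Fin 2) ℝ) 1 0 * h3 +
        (g₁ : Matrix (Fin 2) (Fin 2) ℝ) 1 1 * h6
    · linear_combination (g₁ : Matrix (Fin 2) (Fin 2) ℝ) 1 0 * h5 +
        ε * (g₁ : Matrix (Fin 2) (Fin 2) ℝ) 1 1 * h4
  · rintro ⟨g₁, h, c, e, h1⟩
    have hd := GL_det_ne_zero g₁
    rw [Matrix.eta_fin_two (g₁ : Matrix (Fin 2) (Fin 2) ℝ), conj_fin_two, Matrix.det_fin_two_of] at h1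
    rw [Matrix.eta_fin_two (g₁ : Matrix (Fin 2) (Fin 2) ℝ), Matrix.det_fin_two_of] at hd
    obtain ⟨h3, h4, h5, h6⟩ := conformal_relations hd rfl h1.1 h1.2.1 h1.2.2 hε
    rw [e]
    exact ⟨rfl, rfl, h3, h4, h5, h6⟩

/-- The conformal factor can be read off at the first entry, since the first entry of `S` is one. -/
theorem conf_apply {g₁ : Matrix (Fin 2) (Fin 2) ℝ} {ε l : ℝ}
    (h : g₁ * Matrix.diagonal ![1, ε] * g₁ᵀ = l • Matrix.diagonal ![1, ε]) :
    (g₁ * Matrix.diagonal ![1, ε] * g₁ᵀ) 0 0 = l := by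
  rw [h]
  simp

theorem mem_aut_planar_CO_iff {ε : ℝ} (hε : ε ≠ 0) (g : GL (Fin 3) ℝ) :
    (g : Matrix (Fin 3) (Fin 3) ℝ) * Matrix.diagonal ![1, ε, 0] *
      (g : Matrix (Fin 3) (Fin 3) ℝ)ᵀ = (g : Matrix (Fin 3) (Fin 3) ℝ).det •
        Matrix.diagonal ![1, ε, 0] ↔
    ∃ g₁ ∈ CO (Matrix.diagonal ![1, ε]), ∃ h : Fin 2 → ℝ, (g : Matrix (Fin 3) (Fin 3) ℝ) =
      block (g₁ : Matrix (Fin 2) (Fin 2) ℝ) h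
        (((g₁ : Matrix (Fin 2) (Fin 2) ℝ) * Matrix.diagonal ![1, ε] *
          (g₁ : Matrix (Fin 2) (Fin 2) ℝ)ᵀ) 0 0 / (g₁ : Matrix (Fin 2) (Fin 2) ℝ).det) := by
  rw [mem_aut_planar_iff hε]
  constructor
  · rintro ⟨g₁, h, c, e, h1⟩
    have hd := GL_det_ne_zero g₁
    have hc : c ≠ 0 := by
      have := GL_det_ne_zero g
      rw [e, det_block] at this
      exact right_ne_zero_of_mul this
    refine ⟨g₁, ⟨_, mul_ne_zero hc hd, h1⟩, h, ?_⟩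
    rw [conf_apply h1, mul_div_cancel_right₀ _ hd]
    exact e
  · rintro ⟨g₁, ⟨l, hl, h1⟩, h, e⟩
    refine ⟨g₁, h, _, e, ?_⟩
    rw [conf_apply h1, div_mul_cancel₀ _ (GL_det_ne_zero g₁)]
    exact h1

/-- Determinants of both sides; in dimension two the conformal factor is therefore the determinant
up to sign. -/
theorem conf_sq {g₁ : Matrix (Fin 2) (Fin 2) ℝ} {ε l : ℝ} (hε : ε ≠ 0)
    (h : g₁ * Matrix.diagonal ![1, ε] * g₁ᵀ = l • Matrix.diagonal ![1, ε]) : l ^ 2 = g₁.det ^ 2 := by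
  have := congrArg Matrix.det h
  simp only [Matrix.det_mul, Matrix.det_transpose, Matrix.det_smul, Matrix.det_diagonal,
    Fin.prod_univ_two, Fintype.card_fin] at this
  simp at this
  apply mul_right_cancel₀ hε
  linear_combination -this

theorem one_eq_diagonal : (1 : Matrix (Fin 2) (Fin 2) ℝ) = Matrix.diagonal ![1, 1] := by
  ext i k
  fin_cases i <;> fin_cases k <;> rfl

theorem mem_aut_VI₀_iff (g : GL (Fin 3) ℝ) : g ∈ BianchiClass.VI₀.aut ↔
    ∃ g₁ ∈ CO mink, ∃ h : Fin 2 → ℝ, (g : Matrix (Fin 3) (Fin 3) ℝ) =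
      block (g₁ : Matrix (Fin 2) (Fin 2) ℝ) h
        (((g₁ : Matrix (Fin 2) (Fin 2) ℝ) * mink * (g₁ : Matrix (Fin 2) (Fin 2) ℝ)ᵀ) 0 0 /
          (g₁ : Matrix (Fin 2) (Fin 2) ℝ).det) := by
  rw [mem_aut_iff]
  refine Iff.trans ?_ (mem_aut_planar_CO_iff (ε := -1) (by norm_num) g)
  simp [BianchiClass.mat, BianchiClass.covec, vec_three_zero]

theorem conf_mink_div_det (g₁ : GL (Fin 2) ℝ) (h : g₁ ∈ CO mink) :
    ((g₁ : Matrix (Fin 2) (Fin 2) ℝ) * mink * (g₁ : Matrix (Fin 2) (Fin 2) ℝ)ᵀ) 0 0 /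
      (g₁ : Matrix (Fin 2) (Fin 2) ℝ).det ∈ ({-1, 1} : Set ℝ) := by
  obtain ⟨l, hl, h⟩ := h
  have hd := GL_det_ne_zero g₁
  have hsq := conf_sq (ε := -1) (by norm_num) h
  rw [mink, conf_apply h]
  rcases sq_eq_sq_iff_eq_or_eq_neg.1 hsq with e | e
  · right
    rw [e, Set.mem_singleton_iff, div_self hd]
  · left
    rw [e, neg_div, div_self hd]

theorem mem_aut_VII₀_iff (g : GL (Fin 3) ℝ) : g ∈ BianchiClass.VII₀.aut ↔
    ∃ g₁ ∈ CO 1, ∃ h : Fin 2 → ℝ, (g : Matrix (Fin 3) (Fin 3) ℝ) =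
      block (g₁ : Matrix (Fin 2) (Fin 2) ℝ) h
        (|(g₁ : Matrix (Fin 2) (Fin 2) ℝ).det| / (g₁ : Matrix (Fin 2) (Fin 2) ℝ).det) := by
  rw [mem_aut_iff]
  have h1 := mem_aut_planar_CO_iff (ε := 1) one_ne_zero g
  rw [← one_eq_diagonal] at h1
  refine Iff.trans (Iff.trans ?_ h1) ?_
  · simp [BianchiClass.mat, BianchiClass.covec, vec_three_zero]
  · refine exists_congr fun g₁ => and_congr_right fun hg₁ => ?_
    obtain ⟨l, hl, hg₁⟩ := hg₁
    have e : ((g₁ : Matrix (Fin 2) (Fin 2) ℝ) * (1 : Matrix (Fin 2) (Fin 2) ℝ) *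
        (g₁ : Matrix (Fin 2) (Fin 2) ℝ)ᵀ) 0 0 =
        |(g₁ : Matrix (Fin 2) (Fin 2) ℝ).det| := by
      rw [one_eq_diagonal] at hg₁ ⊢
      -- For the definite form the conformal factor is a sum of squares, so it must be the absolute
      -- value of the determinant.
      have hl0 : 0 ≤ l := by
        rw [Matrix.eta_fin_two (g₁ : Matrix (Fin 2) (Fin 2) ℝ), conj_fin_two] at hg₁
        rw [← hg₁.1]
        positivity
      rw [conf_apply hg₁]
      exact (abs_of_nonneg hl0).symm.trans
        ((sq_eq_sq_iff_abs_eq_abs _ _).1 (conf_sq one_ne_zero hg₁))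
    rw [e]

theorem mem_aut_I : BianchiClass.I.aut = ⊤ := by
  rw [eq_top_iff]
  intro g _
  rw [mem_aut_iff]
  simp [BianchiClass.mat, BianchiClass.covec, vec_three_zero, diagonal_eq_zero_iff]

theorem mem_aut_II_iff (g : GL (Fin 3) ℝ) : g ∈ BianchiClass.II.aut ↔
    ∃ (g₂ : GL (Fin 2) ℝ) (h : Fin 2 → ℝ), (g : Matrix (Fin 3) (Fin 3) ℝ) =
      !![(g₂ : Matrix (Fin 2) (Fin 2) ℝ).det, h 0, h 1;
         0, g₂ 0 0, g₂ 0 1;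
         0, g₂ 1 0, g₂ 1 1] := by
  have hd := GL_det_ne_zero g
  rw [mem_aut_iff]
  simp only [BianchiClass.mat, BianchiClass.covec, vec_three_zero, Matrix.mulVec_zero, and_true]
  rw [conj_rank_one_iff hd]
  constructor
  · rintro ⟨h1, h2, h3⟩
    have hd2 : (!![(g : Matrix (Fin 3) (Fin 3) ℝ) 1 1, (g : Matrix (Fin 3) (Fin 3) ℝ) 1 2;
        (g : Matrix (Fin 3) (Fin 3) ℝ) 2 1, (g : Matrix (Fin 3) (Fin 3) ℝ) 2 2]).det ≠ 0 := by
      rw [Matrix.det_fin_three, h1, h2] at hd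
      rw [Matrix.det_fin_two_of]
      intro h
      apply hd
      linear_combination (g : Matrix (Fin 3) (Fin 3) ℝ) 0 0 * h
    refine ⟨Matrix.GeneralLinearGroup.mkOfDetNeZero _ hd2, ![(g : Matrix (Fin 3) (Fin 3) ℝ) 0 1,
      (g : Matrix (Fin 3) (Fin 3) ℝ) 0 2], ?_⟩
    have e : ((Matrix.GeneralLinearGroup.mkOfDetNeZero _ hd2 : GL (Fin 2) ℝ) :
      Matrix (Fin 2) (Fin 2) ℝ) = !![(g : Matrix (Fin 3) (Fin 3) ℝ) 1 1,
        (g : Matrix (Fin 3) (Fin 3) ℝ) 1 2; (g : Matrix (Fin 3) (Fin 3) ℝ) 2 1,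
        (g : Matrix (Fin 3) (Fin 3) ℝ) 2 2] := rfl
    rw [e, Matrix.det_fin_two_of, ← h3]
    ext i k
    fin_cases i <;> fin_cases k <;> simp [h1, h2]
  · rintro ⟨g₂, h, e⟩
    rw [e, Matrix.det_fin_two]
    exact ⟨rfl, rfl, rfl⟩

theorem mem_aut_IV_iff (g : GL (Fin 3) ℝ) : g ∈ BianchiClass.IV.aut ↔
    ∃ μ h₁ h₂ h₃ : ℝ, μ ≠ 0 ∧ (g : Matrix (Fin 3) (Fin 3) ℝ) =
      !![μ, h₁, h₂; 0, μ, h₃; 0, 0, 1] := by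
  have hd := GL_det_ne_zero g
  rw [mem_aut_iff]
  simp only [BianchiClass.mat, BianchiClass.covec]
  rw [conj_rank_one_iff hd, transpose_mulVec_covec_iff one_ne_zero]
  generalize (g : Matrix (Fin 3) (Fin 3) ℝ) = M at *
  constructor
  · rintro ⟨⟨h1, h2, h3⟩, -, h4, h5⟩
    rw [h4, h5] at h3
    refine ⟨M 0 0, M 0 1, M 0 2, M 1 2, ?_, ?_⟩
    · rintro h0
      rw [Matrix.det_fin_three, h0, h1, h2] at hd
      simp at hd
    · ext i k
      fin_cases i <;> fin_cases k <;> simp [h1, h2, h3, h4, h5]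
  · rintro ⟨μ, h₁, h₂, h₃, hμ, rfl⟩
    simp

theorem mem_aut_V_iff (g : GL (Fin 3) ℝ) : g ∈ BianchiClass.V.aut ↔
    ∃ g₁ ∈ (⊤ : Subgroup (GL (Fin 2) ℝ)), ∃ h : Fin 2 → ℝ,
      (g : Matrix (Fin 3) (Fin 3) ℝ) = block (g₁ : Matrix (Fin 2) (Fin 2) ℝ) h 1 := by
  rw [mem_aut_iff]
  simp only [BianchiClass.mat, BianchiClass.covec]
  rw [transpose_mulVec_covec_iff one_ne_zero, vec_three_zero]
  have : Matrix.diagonal (0 : Fin 3 → ℝ) = 0 := Matrix.diagonal_zero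
  simp only [this, Matrix.mul_zero, Matrix.zero_mul, smul_zero, true_and]
  constructor
  · rintro ⟨h1, h2, h3⟩
    obtain ⟨g₁, h, e⟩ := exists_eq_block g h1 h2
    exact ⟨g₁, Subgroup.mem_top _, h, h3 ▸ e⟩
  · rintro ⟨g₁, -, h, e⟩
    rw [e]
    exact ⟨rfl, rfl, rfl⟩

theorem mem_aut_planar_covec_iff {ε k : ℝ} (hε : ε ≠ 0) (hk : k ≠ 0) (g : GL (Fin 3) ℝ) :
    ((g : Matrix (Fin 3) (Fin 3) ℝ) * Matrix.diagonal ![1, ε, 0] *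
      (g : Matrix (Fin 3) (Fin 3) ℝ)ᵀ = (g : Matrix (Fin 3) (Fin 3) ℝ).det •
        Matrix.diagonal ![1, ε, 0] ∧
      (g : Matrix (Fin 3) (Fin 3) ℝ)ᵀ *ᵥ ![0, 0, k] = ![0, 0, k]) ↔
    ∃ g₁ ∈ COPlus (Matrix.diagonal ![1, ε]), ∃ h : Fin 2 → ℝ,
      (g : Matrix (Fin 3) (Fin 3) ℝ) = block (g₁ : Matrix (Fin 2) (Fin 2) ℝ) h 1 := by
  rw [mem_aut_planar_iff hε, transpose_mulVec_covec_iff hk]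
  constructor
  · rintro ⟨⟨g₁, h, c, e, h1⟩, -, -, h2⟩
    obtain rfl : c = 1 := by
      rw [← h2, e]
      rfl
    rw [one_mul] at h1
    exact ⟨g₁, h1, h, e⟩
  · rintro ⟨g₁, h1, h, e⟩
    refine ⟨⟨g₁, h, 1, e, ?_⟩, ?_⟩
    · rw [one_mul]
      exact h1
    · rw [e]
      exact ⟨rfl, rfl, rfl⟩

theorem mem_aut_VI_iff {k : ℝ} (hk : k < 0) (g : GL (Fin 3) ℝ) :
    g ∈ (BianchiClass.VI k hk.le).aut ↔ ∃ g₁ ∈ COPlus mink, ∃ h : Fin 2 → ℝ,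
      (g : Matrix (Fin 3) (Fin 3) ℝ) = block (g₁ : Matrix (Fin 2) (Fin 2) ℝ) h 1 := by
  rw [mem_aut_iff]
  exact mem_aut_planar_covec_iff (by norm_num) hk.ne g

theorem mem_aut_VII_iff {k : ℝ} (hk : 0 < k) (g : GL (Fin 3) ℝ) :
    g ∈ (BianchiClass.VII k hk.le).aut ↔ ∃ g₁ ∈ COPlus 1, ∃ h : Fin 2 → ℝ,
      (g : Matrix (Fin 3) (Fin 3) ℝ) = block (g₁ : Matrix (Fin 2) (Fin 2) ℝ) h 1 := by
  rw [mem_aut_iff, one_eq_diagonal]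
  exact mem_aut_planar_covec_iff one_ne_zero hk.ne' g

/-- Taking determinants gives `(det g)² det S = (det g)³ det S`, so an automorphism has determinant
one and is an isometry. -/
theorem mem_aut_simple_iff {S : Matrix (Fin 3) (Fin 3) ℝ} (hS : S.det ≠ 0) (g : GL (Fin 3) ℝ) :
    ((g : Matrix (Fin 3) (Fin 3) ℝ) * S * (g : Matrix (Fin 3) (Fin 3) ℝ)ᵀ =
      (g : Matrix (Fin 3) (Fin 3) ℝ).det • S) ↔
    (g : Matrix (Fin 3) (Fin 3) ℝ) * S * (g : Matrix (Fin 3) (Fin 3) ℝ)ᵀ = S ∧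
      (g : Matrix (Fin 3) (Fin 3) ℝ).det = 1 := by
  have hd := GL_det_ne_zero g
  constructor
  · intro h
    have h1 : (g : Matrix (Fin 3) (Fin 3) ℝ).det = 1 := by
      have := congrArg Matrix.det h
      rw [Matrix.det_mul, Matrix.det_mul, Matrix.det_transpose, Matrix.det_smul,
        Fintype.card_fin] at this
      apply mul_left_cancel₀ (mul_ne_zero (mul_ne_zero hd hd) hS)
      linear_combination -this
    rw [h1, one_smul] at h
    exact ⟨h, h1⟩
  · rintro ⟨h1, h2⟩
    rw [h2, one_smul, h1]

theorem mem_aut_VIII_iff (g : GL (Fin 3) ℝ) : g ∈ BianchiClass.VIII.aut ↔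
    (g : Matrix (Fin 3) (Fin 3) ℝ) * Matrix.diagonal ![1, 1, -1] *
        (g : Matrix (Fin 3) (Fin 3) ℝ)ᵀ = Matrix.diagonal ![1, 1, -1] ∧
      (g : Matrix (Fin 3) (Fin 3) ℝ).det = 1 := by
  rw [mem_aut_iff, ← mem_aut_simple_iff (by simp [Matrix.det_diagonal, Fin.prod_univ_three])]
  simp [BianchiClass.mat, BianchiClass.covec, vec_three_zero]

theorem mat_IX : BianchiClass.IX.mat = 1 := by
  ext i k
  fin_cases i <;> fin_cases k <;> rfl

theorem mem_aut_IX_iff (g : GL (Fin 3) ℝ) : g ∈ BianchiClass.IX.aut ↔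
    (g : Matrix (Fin 3) (Fin 3) ℝ) ∈ Matrix.specialOrthogonalGroup (Fin 3) ℝ := by
  rw [mem_aut_iff, mat_IX, mem_aut_simple_iff (by simp), Matrix.mem_specialOrthogonalGroup_iff,
    Matrix.mem_orthogonalGroup_iff]
  simp [BianchiClass.covec, vec_three_zero]

/-! ### Semidirect products, the affine group and the index two subgroups -/

theorem isBlockSemidirect {H : Subgroup (GL (Fin 3) ℝ)} {K : Subgroup (GL (Fin 2) ℝ)}
    (h : ∀ g : GL (Fin 3) ℝ, g ∈ H ↔ ∃ g₁ ∈ K, ∃ v : Fin 2 → ℝ,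
      (g : Matrix (Fin 3) (Fin 3) ℝ) = block (g₁ : Matrix (Fin 2) (Fin 2) ℝ) v 1) :
    IsBlockSemidirect H K := by
  refine ⟨h, ?_⟩
  choose a ha b hb using fun g : H => (h g).1 g.2
  have key : ∀ (g : H) (g₁ : GL (Fin 2) ℝ) (v : Fin 2 → ℝ),
      ((g : GL (Fin 3) ℝ) : Matrix (Fin 3) (Fin 3) ℝ) =
        block (g₁ : Matrix (Fin 2) (Fin 2) ℝ) v 1 → a g = g₁ ∧ b g = v := by
    intro g g₁ v e
    obtain ⟨h1, h2⟩ := block_injective ((hb g).symm.trans e)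
    exact ⟨Units.ext h1, h2⟩
  -- The blocks are determined by the matrix, and by `block_mul` they multiply by the semidirect
  -- product law.
  let f : H →* Semi K := MonoidHom.mk' (fun g => ⟨Multiplicative.ofAdd (b g), ⟨a g, ha g⟩⟩) (by
    intro g g'
    obtain ⟨h1, h2⟩ := key (g * g') (a g * a g') _ (by
      rw [Subgroup.coe_mul, Units.val_mul, hb g, hb g', block_mul, Units.val_mul])
    refine SemidirectProduct.ext ?_ (Subtype.ext h1)
    exact congrArg Multiplicative.ofAdd h2)
  have hf : Function.Bijective f := by
    constructor
    · intro g g' e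
      refine Subtype.ext (Units.ext ?_)
      rw [hb g, hb g']
      have h1 : a g = a g' := congrArg (fun x : Semi K => (x.right : GL (Fin 2) ℝ)) e
      have h2 : b g = b g' := congrArg (fun x : Semi K => x.left.toAdd) e
      rw [h1, h2]
    · rintro ⟨v, g₁, hg₁⟩
      have hd : (block (g₁ : Matrix (Fin 2) (Fin 2) ℝ) v.toAdd 1).det ≠ 0 := by
        rw [det_block, mul_one]
        exact GL_det_ne_zero g₁
      have hg : Matrix.GeneralLinearGroup.mkOfDetNeZero _ hd ∈ H := (h _).2 ⟨g₁, hg₁, _, rfl⟩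
      obtain ⟨h1, h2⟩ := key ⟨_, hg⟩ g₁ v.toAdd rfl
      refine ⟨⟨_, hg⟩, SemidirectProduct.ext ?_ (Subtype.ext h1)⟩
      exact congrArg Multiplicative.ofAdd h2
  exact ⟨MulEquiv.ofBijective f hf, hb⟩

/-- The affine transformation `x ↦ g x + v` of the plane. -/
def affineMap (g : GL (Fin 2) ℝ) (v : Fin 2 → ℝ) : (Fin 2 → ℝ) ≃ᵃ[ℝ] (Fin 2 → ℝ) :=
  (LinearEquiv.toAffineEquiv (Matrix.toLin'OfInv
    (M' := (g : Matrix (Fin 2) (Fin 2) ℝ)) (M := ((g⁻¹ : GL (Fin 2) ℝ) : Matrix (Fin 2) (Fin 2) ℝ))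
    (by rw [← Units.val_mul, inv_mul_cancel, Units.val_one])
    (by rw [← Units.val_mul, mul_inv_cancel, Units.val_one]))).trans (AffineEquiv.constVAdd ℝ _ v)

theorem affineMap_apply (g : GL (Fin 2) ℝ) (v x : Fin 2 → ℝ) :
    affineMap g v x = v + (g : Matrix (Fin 2) (Fin 2) ℝ) *ᵥ x := by
  simp [affineMap, Matrix.toLin'OfInv]

theorem block_mulVec (g : Matrix (Fin 2) (Fin 2) ℝ) (v x : Fin 2 → ℝ) :
    block g v 1 *ᵥ ![x 0, x 1, 1] = ![(v + g *ᵥ x) 0, (v + g *ᵥ x) 1, 1] := by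
  ext i
  fin_cases i <;> simp [block, Matrix.mulVec, dotProduct, Fin.sum_univ_three, Fin.sum_univ_two,
    add_comm]

theorem vec_affine_injective {x y : Fin 2 → ℝ}
    (h : (![x 0, x 1, 1] : Fin 3 → ℝ) = ![y 0, y 1, 1]) : x = y := by
  ext i
  fin_cases i
  exacts [congrFun h 0, congrFun h 1]

theorem exists_eq_affineMap (e : (Fin 2 → ℝ) ≃ᵃ[ℝ] (Fin 2 → ℝ)) :
    ∃ g v, e = affineMap g v := by
  set M := LinearMap.toMatrix' (e.linear : (Fin 2 → ℝ) →ₗ[ℝ] (Fin 2 → ℝ))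
  set M' := LinearMap.toMatrix' (e.linear.symm : (Fin 2 → ℝ) →ₗ[ℝ] (Fin 2 → ℝ))
  refine ⟨⟨M, M', ?_, ?_⟩, e 0, ?_⟩
  · rw [← LinearMap.toMatrix'_comp]
    simp
  · rw [← LinearMap.toMatrix'_comp]
    simp
  · refine AffineEquiv.ext fun x => ?_
    rw [affineMap_apply, LinearMap.toMatrix'_mulVec]
    have := e.map_vadd 0 x
    simp only [vadd_eq_add, add_zero] at this
    rw [this, add_comm]
    rfl

/-- The automorphisms of `V` are the matrices that fix `λ³`, so they act on the affine plane `λ³ =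
1`, with homogeneous coordinates `(x, 1)`. -/
theorem exists_mulEquiv_affineEquiv :
    ∃ e : BianchiClass.V.aut ≃* ((Fin 2 → ℝ) ≃ᵃ[ℝ] (Fin 2 → ℝ)),
      ∀ (g : BianchiClass.V.aut) (x : Fin 2 → ℝ),
        ((g : GL (Fin 3) ℝ) : Matrix (Fin 3) (Fin 3) ℝ).mulVec ![x 0, x 1, 1] =
          ![e g x 0, e g x 1, 1] := by
  choose a ha b hb using fun g : BianchiClass.V.aut => (mem_aut_V_iff g).1 g.2
  have key : ∀ (g : BianchiClass.V.aut) (x : Fin 2 → ℝ),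
      ((g : GL (Fin 3) ℝ) : Matrix (Fin 3) (Fin 3) ℝ).mulVec ![x 0, x 1, 1] =
          ![affineMap (a g) (b g) x 0, affineMap (a g) (b g) x 1, 1] := by
    intro g x
    rw [hb g, block_mulVec, affineMap_apply]
  let f : BianchiClass.V.aut →* ((Fin 2 → ℝ) ≃ᵃ[ℝ] (Fin 2 → ℝ)) :=
    MonoidHom.mk' (fun g => affineMap (a g) (b g)) (by
      intro g g'
      refine AffineEquiv.ext fun x => vec_affine_injective ?_
      rw [← key, AffineEquiv.coe_mul, Function.comp_apply, ← key, ← key, Subgroup.coe_mul,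
        Units.val_mul, Matrix.mulVec_mulVec])
  have hf : Function.Bijective f := by
    constructor
    · intro g g' e
      have e' : ∀ x, affineMap (a g) (b g) x = affineMap (a g') (b g') x := fun x =>
        congrArg (fun φ : (Fin 2 → ℝ) ≃ᵃ[ℝ] (Fin 2 → ℝ) => φ x) e
      simp only [affineMap_apply] at e'
      have h0 : b g = b g' := by simpa using e' 0
      refine Subtype.ext (Units.ext ?_)
      rw [hb g, hb g']
      congr 1
      refine Matrix.ext_of_mulVec_single fun i => ?_
      simpa [h0] using e' (Pi.single i 1)
    · intro e
      obtain ⟨g₁, v, rfl⟩ := exists_eq_affineMap e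
      have hd : (block (g₁ : Matrix (Fin 2) (Fin 2) ℝ) v 1).det ≠ 0 := by
        rw [det_block, mul_one]
        exact GL_det_ne_zero g₁
      refine ⟨⟨Matrix.GeneralLinearGroup.mkOfDetNeZero _ hd,
        (mem_aut_V_iff _).2 ⟨g₁, Subgroup.mem_top _, _, rfl⟩⟩, ?_⟩
      refine AffineEquiv.ext fun x => vec_affine_injective ?_
      rw [affineMap_apply]
      exact (key _ x).symm.trans (block_mulVec _ _ _)
  exact ⟨MulEquiv.ofBijective f hf, key⟩

/-- On `K` the last diagonal entry is a homomorphism to `{1, -1}`; its kernel is `H`, and `a` shows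
that it is onto. -/
theorem relIndex_eq_two {H K : Subgroup (GL (Fin 3) ℝ)}
    (h1 : ∀ g ∈ K, (g : Matrix (Fin 3) (Fin 3) ℝ) 2 0 = 0 ∧ (g : Matrix (Fin 3) (Fin 3) ℝ) 2 1 = 0 ∧
      ((g : Matrix (Fin 3) (Fin 3) ℝ) 2 2 = 1 ∨ (g : Matrix (Fin 3) (Fin 3) ℝ) 2 2 = -1))
    (h2 : ∀ g ∈ K, (g ∈ H ↔ (g : Matrix (Fin 3) (Fin 3) ℝ) 2 2 = 1))
    {a : GL (Fin 3) ℝ} (ha : a ∈ K) (ha' : (a : Matrix (Fin 3) (Fin 3) ℝ) 2 2 = -1) :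
    H.relIndex K = 2 := by
  rw [Subgroup.relIndex, Subgroup.index_eq_two_iff]
  refine ⟨⟨a, ha⟩, fun ⟨b, hb⟩ => ?_⟩
  rw [Subgroup.mem_subgroupOf, Subgroup.mem_subgroupOf]
  change Xor (b * a ∈ H) (b ∈ H)
  rw [h2 _ (K.mul_mem hb ha), h2 _ hb, Units.val_mul, Matrix.mul_apply, Fin.sum_univ_three,
    (h1 b hb).1, (h1 b hb).2.1, ha']
  rcases (h1 b hb).2.2 with e | e <;> rw [e] <;> norm_num [Xor]

theorem diag_mem_aut {ε : ℝ} (t : BianchiClass) (ht : t.mat = Matrix.diagonal ![1, ε, 0])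
    (ht' : t.covec = 0) : ∃ a ∈ t.aut, (a : Matrix (Fin 3) (Fin 3) ℝ) 2 2 = -1 := by
  have hd : (Matrix.diagonal ![1, -1, -1] : Matrix (Fin 3) (Fin 3) ℝ).det ≠ 0 := by
    simp [Matrix.det_diagonal, Fin.prod_univ_three]
  refine ⟨Matrix.GeneralLinearGroup.mkOfDetNeZero _ hd, ?_, rfl⟩
  rw [mem_aut_iff, ht, ht']
  refine ⟨?_, Matrix.mulVec_zero _⟩
  have e : ((Matrix.GeneralLinearGroup.mkOfDetNeZero _ hd : GL (Fin 3) ℝ) :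
    Matrix (Fin 3) (Fin 3) ℝ) = Matrix.diagonal ![1, -1, -1] := rfl
  rw [e, Matrix.diagonal_transpose, Matrix.diagonal_mul_diagonal, Matrix.diagonal_mul_diagonal,
    Matrix.det_diagonal, ← Matrix.diagonal_smul]
  congr 1
  ext i
  fin_cases i <;> simp [Fin.prod_univ_three]

theorem aut_le_and_relIndex {ε k : ℝ} (hε : ε ≠ 0) (hk : k ≠ 0) (s t : BianchiClass)
    (hs : s.mat = Matrix.diagonal ![1, ε, 0]) (hs' : s.covec = ![0, 0, k])
    (ht : t.mat = Matrix.diagonal ![1, ε, 0]) (ht' : t.covec = 0) :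
    s.aut ≤ t.aut ∧ s.aut.relIndex t.aut = 2 := by
  have h0 : ∀ g : GL (Fin 3) ℝ, g ∈ t.aut ↔ (g : Matrix (Fin 3) (Fin 3) ℝ) *
      Matrix.diagonal ![1, ε, 0] * (g : Matrix (Fin 3) (Fin 3) ℝ)ᵀ =
        (g : Matrix (Fin 3) (Fin 3) ℝ).det • Matrix.diagonal ![1, ε, 0] := by
    intro g
    rw [mem_aut_iff, ht, ht']
    exact and_iff_left (Matrix.mulVec_zero _)
  have hle : s.aut ≤ t.aut := by
    intro g hg
    rw [mem_aut_iff, hs] at hg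
    exact (h0 g).2 hg.1
  have h1 : ∀ g ∈ t.aut, (g : Matrix (Fin 3) (Fin 3) ℝ) 2 0 = 0 ∧
      (g : Matrix (Fin 3) (Fin 3) ℝ) 2 1 = 0 ∧ ((g : Matrix (Fin 3) (Fin 3) ℝ) 2 2 = 1 ∨
        (g : Matrix (Fin 3) (Fin 3) ℝ) 2 2 = -1) := by
    intro g hg
    have hd := GL_det_ne_zero g
    rw [h0, conj_rank_two_iff hd hε] at hg
    obtain ⟨h20, h21, h00, h11, h10, h01⟩ := hg
    refine ⟨h20, h21, ?_⟩
    generalize (g : Matrix (Fin 3) (Fin 3) ℝ) = M at *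
    -- If the square of the last entry is not one, the relations for the upper left block annihilate
    -- its first row, against invertibility.
    by_contra hc
    have hc' : 1 - M 2 2 ^ 2 ≠ 0 := by
      intro h
      exact hc (sq_eq_sq_iff_eq_or_eq_neg.1 (by linear_combination -h))
    have e00 : M 0 0 = 0 := by
      apply mul_right_cancel₀ hc'
      linear_combination h00 + M 2 2 * h11
    have e01 : M 0 1 = 0 := by
      apply mul_right_cancel₀ hc'
      apply mul_left_cancel₀ hε
      linear_combination h01 - M 2 2 * h10
    rw [Matrix.det_fin_three, h20, h21, e00, e01] at hd
    simp at hd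
  obtain ⟨a, ha, ha'⟩ := diag_mem_aut t ht ht'
  refine ⟨hle, relIndex_eq_two h1 (fun g hg => ?_) ha ha'⟩
  rw [mem_aut_iff, hs, hs', transpose_mulVec_covec_iff hk]
  exact ⟨fun h => h.2.2.2, fun h => ⟨(h0 g).1 hg, (h1 g hg).1, (h1 g hg).2.1, h⟩⟩

/-! ### The automorphism groups as submanifolds -/

/-- Left multiplication by `g` on the space of matrices. -/
noncomputable def mulLeftEquiv (g : GL (Fin 3) ℝ) : (Fin 3 → Fin 3 → ℝ) ≃L[ℝ] (Fin 3 → Fin 3 → ℝ) :=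
  LinearEquiv.toContinuousLinearEquiv
    { toFun := fun y => (g : Matrix (Fin 3) (Fin 3) ℝ) * Matrix.of y
      map_add' := fun x y => Matrix.mul_add (g : Matrix (Fin 3) (Fin 3) ℝ) (Matrix.of x) (Matrix.of y)
      map_smul' := fun c y => Matrix.mul_smul (g : Matrix (Fin 3) (Fin 3) ℝ) c (Matrix.of y)
      invFun := fun y => ((g⁻¹ : GL (Fin 3) ℝ) : Matrix (Fin 3) (Fin 3) ℝ) * Matrix.of y
      left_inv := fun y => by
        change ((g⁻¹ : GL (Fin 3) ℝ) : Matrix (Fin 3) (Fin 3) ℝ) *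
          ((g : Matrix (Fin 3) (Fin 3) ℝ) * Matrix.of y) = Matrix.of y
        rw [← Matrix.mul_assoc, inv_mul_GL, Matrix.one_mul]
      right_inv := fun y => by
        change (g : Matrix (Fin 3) (Fin 3) ℝ) *
          (((g⁻¹ : GL (Fin 3) ℝ) : Matrix (Fin 3) (Fin 3) ℝ) * Matrix.of y) = Matrix.of y
        rw [← Matrix.mul_assoc, mul_inv_GL, Matrix.one_mul] }

theorem mulLeftEquiv_apply (g : GL (Fin 3) ℝ) (y : Fin 3 → Fin 3 → ℝ) :
    Matrix.of (mulLeftEquiv g y) = (g : Matrix (Fin 3) (Fin 3) ℝ) * Matrix.of y := rfl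

theorem mem_matrixSet_iff {H : Subgroup (GL (Fin 3) ℝ)} {y : Fin 3 → Fin 3 → ℝ} :
    y ∈ matrixSet H ↔ ∃ g ∈ H, Matrix.of y = (g : Matrix (Fin 3) (Fin 3) ℝ) :=
  exists_congr fun _ => and_congr_right fun _ => Matrix.ext_iff

theorem mulLeftEquiv_mem_matrixSet {H : Subgroup (GL (Fin 3) ℝ)} {g : GL (Fin 3) ℝ} (hg : g ∈ H)
    {y : Fin 3 → Fin 3 → ℝ} (hy : y ∈ matrixSet H) : mulLeftEquiv g y ∈ matrixSet H := by
  rw [mem_matrixSet_iff] at hy ⊢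
  obtain ⟨a, ha, e⟩ := hy
  exact ⟨g * a, H.mul_mem hg ha, by rw [mulLeftEquiv_apply, e, Units.val_mul]⟩

/-- The coordinates of the identity matrix. -/
def idMat : Fin 3 → Fin 3 → ℝ := fun i k => if i = k then 1 else 0

theorem of_idMat : Matrix.of idMat = (1 : Matrix (Fin 3) (Fin 3) ℝ) := by
  ext i k
  simp [idMat, Matrix.one_apply]

/-- Left translations carry a chart at the identity to every other element of the group. -/
theorem isSubmanifoldOfDim_matrixSet {H : Subgroup (GL (Fin 3) ℝ)} {d : ℕ}
    (h : IsSubmanifoldAt ℝ (matrixSet H) d idMat) : IsSubmanifoldOfDim ℝ (matrixSet H) d := by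
  intro y hy
  obtain ⟨g, hg, e⟩ := mem_matrixSet_iff.1 hy
  have e' : y = mulLeftEquiv g idMat := by
    apply Matrix.of.injective
    rw [mulLeftEquiv_apply, of_idMat, Matrix.mul_one, e]
  rw [e']
  refine h.image _ fun z => ⟨fun hz => ?_, fun hz => mulLeftEquiv_mem_matrixSet hg hz⟩
  have h1 := mulLeftEquiv_mem_matrixSet (H.inv_mem hg) hz
  have h2 : mulLeftEquiv g⁻¹ (mulLeftEquiv g z) = z := by
    apply Matrix.of.injective
    rw [mulLeftEquiv_apply, mulLeftEquiv_apply, ← Matrix.mul_assoc, inv_mul_GL, Matrix.one_mul]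
  rwa [h2] at h1

theorem continuous_det_of : Continuous fun y : Fin 3 → Fin 3 → ℝ => (Matrix.of y).det :=
  Continuous.matrix_det continuous_id

theorem eventually_det_pos : ∀ᶠ y in nhds idMat, 0 < (Matrix.of y).det := by
  refine continuous_det_of.continuousAt.tendsto.eventually_const_lt ?_
  rw [of_idMat, Matrix.det_one]
  exact one_pos

theorem eventually_diag_pos (i : Fin 3) : ∀ᶠ y in nhds idMat, 0 < y i i := by
  have h : Continuous fun y : Fin 3 → Fin 3 → ℝ => y i i := by fun_prop
  refine h.continuousAt.tendsto.eventually_const_lt ?_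
  simp [idMat]

theorem mem_matrixSet_aut_iff (t : BianchiClass) {y : Fin 3 → Fin 3 → ℝ}
    (hy : (Matrix.of y).det ≠ 0) : y ∈ matrixSet t.aut ↔
      Matrix.of y * t.mat * (Matrix.of y)ᵀ = (Matrix.of y).det • t.mat ∧
      (Matrix.of y)ᵀ *ᵥ t.covec = t.covec := by
  rw [mem_matrixSet_iff]
  constructor
  · rintro ⟨g, hg, e⟩
    rw [mem_aut_iff] at hg
    rwa [e]
  · intro h
    exact ⟨Matrix.GeneralLinearGroup.mkOfDetNeZero _ hy, (mem_aut_iff t _).2 h, rfl⟩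

theorem finrank_mat : Module.finrank ℝ (Fin 3 → Fin 3 → ℝ) = 9 := by
  simp [Module.finrank_pi_fintype]

/-- The regular value theorem near the identity matrix, with coordinates for the equations. -/
theorem isSubmanifoldAt_idMat {B : Set (Fin 3 → Fin 3 → ℝ)} {d n : ℕ}
    (f : (Fin 3 → Fin 3 → ℝ) → Fin n → ℝ) (hf : ContDiff ℝ ∞ f)
    (s : (Fin n → ℝ) → Fin 3 → Fin 3 → ℝ) (hs : IsLinearMap ℝ s)
    (hfs : ∀ w, f (idMat + s w) = w) (hB : ∀ᶠ y in nhds idMat, y ∈ B ↔ f y = 0)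
    (hd : d + n = 9) : IsSubmanifoldAt ℝ B d idMat :=
  .of_affine f hf (hs.mk' s) hfs hB (by rw [finrank_mat, Module.finrank_fin_fun, hd])

theorem isSubmanifoldAt_aut_I : IsSubmanifoldAt ℝ (matrixSet BianchiClass.I.aut) 9 idMat := by
  refine isSubmanifoldAt_idMat (n := 0) (fun _ => 0) contDiff_const (fun _ => 0)
    ⟨by simp, by simp⟩ (fun w => Subsingleton.elim _ _) ?_ rfl
  filter_upwards [eventually_det_pos] with y hy
  rw [mem_aut_I, mem_matrixSet_iff]
  exact ⟨fun _ => rfl, fun _ => ⟨Matrix.GeneralLinearGroup.mkOfDetNeZero _ hy.ne',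
    Subgroup.mem_top _, rfl⟩⟩

theorem isSubmanifoldAt_aut_II : IsSubmanifoldAt ℝ (matrixSet BianchiClass.II.aut) 6 idMat := by
  refine isSubmanifoldAt_idMat (n := 3)
    (fun y => ![y 1 0, y 2 0, y 0 0 - (y 1 1 * y 2 2 - y 1 2 * y 2 1)]) ?_
    (fun w => ![![w 2, 0, 0], ![w 0, 0, 0], ![w 1, 0, 0]]) ?_ ?_ ?_ rfl
  · refine contDiff_pi.2 fun i => ?_
    fin_cases i <;> simp <;> fun_prop
  · refine ⟨fun x y => ?_, fun c x => ?_⟩ <;> ext i k <;> fin_cases i <;> fin_cases k <;> simp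
  · intro w
    ext i
    fin_cases i <;> simp [idMat]
  · filter_upwards [eventually_det_pos] with y hy
    rw [mem_matrixSet_aut_iff _ hy.ne']
    simp only [BianchiClass.mat, BianchiClass.covec, vec_three_zero, Matrix.mulVec_zero, and_true]
    rw [conj_rank_one_iff hy.ne']
    simp [funext_iff, Fin.forall_fin_succ, sub_eq_zero]

theorem isSubmanifoldAt_aut_IV : IsSubmanifoldAt ℝ (matrixSet BianchiClass.IV.aut) 4 idMat := by
  refine isSubmanifoldAt_idMat (n := 5)
    (fun y => ![y 1 0, y 2 0, y 2 1, y 2 2 - 1, y 0 0 - y 1 1]) ?_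
    (fun w => ![![w 4, 0, 0], ![w 0, 0, 0], ![w 1, w 2, w 3]]) ?_ ?_ ?_ rfl
  · refine contDiff_pi.2 fun i => ?_
    fin_cases i <;> simp <;> fun_prop
  · refine ⟨fun x y => ?_, fun c x => ?_⟩ <;> ext i k <;> fin_cases i <;> fin_cases k <;> simp
  · intro w
    ext i
    fin_cases i <;> simp [idMat]
  · filter_upwards [eventually_det_pos] with y hy
    rw [mem_matrixSet_aut_iff _ hy.ne']
    simp only [BianchiClass.mat, BianchiClass.covec]
    rw [conj_rank_one_iff hy.ne', transpose_mulVec_covec_iff one_ne_zero]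
    simp only [funext_iff, Fin.forall_fin_succ]
    simp [sub_eq_zero]
    constructor
    · rintro ⟨⟨h1, h2, h3⟩, -, h4, h5⟩
      refine ⟨h1, h2, h4, h5, ?_⟩
      rw [h3, h4, h5]
      ring
    · rintro ⟨h1, h2, h3, h4, h5⟩
      refine ⟨⟨h1, h2, ?_⟩, h2, h3, h4⟩
      rw [h5, h3, h4]
      ring

theorem isSubmanifoldAt_aut_V : IsSubmanifoldAt ℝ (matrixSet BianchiClass.V.aut) 6 idMat := by
  refine isSubmanifoldAt_idMat (n := 3) (fun y => ![y 2 0, y 2 1, y 2 2 - 1]) ?_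
    (fun w => ![![0, 0, 0], ![0, 0, 0], ![w 0, w 1, w 2]]) ?_ ?_ ?_ rfl
  · refine contDiff_pi.2 fun i => ?_
    fin_cases i <;> simp <;> fun_prop
  · refine ⟨fun x y => ?_, fun c x => ?_⟩ <;> ext i k <;> fin_cases i <;> fin_cases k <;> simp
  · intro w
    ext i
    fin_cases i <;> simp [idMat]
  · filter_upwards [eventually_det_pos] with y hy
    rw [mem_matrixSet_aut_iff _ hy.ne']
    simp only [BianchiClass.mat, BianchiClass.covec]
    rw [transpose_mulVec_covec_iff one_ne_zero, vec_three_zero]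
    have : Matrix.diagonal (0 : Fin 3 → ℝ) = 0 := Matrix.diagonal_zero
    simp [this, funext_iff, Fin.forall_fin_succ, sub_eq_zero]

/-- Near the identity the last diagonal entry is positive and has square one. With this entry equal
to one the conformal relations become linear, and a nonzero covector imposes nothing new. -/
theorem isSubmanifoldAt_aut_planar {ε k : ℝ} (hε : ε ≠ 0) (t : BianchiClass)
    (ht : t.mat = Matrix.diagonal ![1, ε, 0]) (ht' : t.covec = ![0, 0, k]) :
    IsSubmanifoldAt ℝ (matrixSet t.aut) 4 idMat := by
  refine isSubmanifoldAt_idMat (n := 5)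
    (fun y => ![y 2 0, y 2 1, y 2 2 - 1, y 0 0 - y 1 1, y 1 0 + ε * y 0 1]) ?_
    (fun w => ![![w 3, 0, 0], ![w 4, 0, 0], ![w 0, w 1, w 2]]) ?_ ?_ ?_ rfl
  · refine contDiff_pi.2 fun i => ?_
    fin_cases i <;> simp <;> fun_prop
  · refine ⟨fun x y => ?_, fun c x => ?_⟩ <;> ext i k <;> fin_cases i <;> fin_cases k <;> simp
  · intro w
    ext i
    fin_cases i <;> simp [idMat]
  · filter_upwards [eventually_det_pos, eventually_diag_pos 0, eventually_diag_pos 2]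
      with y hy h0 h2
    rw [mem_matrixSet_aut_iff _ hy.ne', ht, ht', conj_rank_two_iff hy.ne' hε]
    simp only [funext_iff, Fin.forall_fin_succ]
    simp [sub_eq_zero, Matrix.mulVec, dotProduct, Fin.sum_univ_three]
    constructor
    · rintro ⟨⟨h20, h21, h00, h11, h10, h01⟩, -⟩
      have h22 : y 2 2 = 1 := by
        have : y 2 2 ^ 2 = 1 := by
          apply mul_left_cancel₀ h0.ne'
          linear_combination -h00 - y 2 2 * h11
        exact (sq_eq_sq_iff_eq_or_eq_neg.1 (this.trans (one_pow 2).symm)).resolve_right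
          (by linarith)
      rw [h22] at h00 h10
      exact ⟨h20, h21, h22, by linear_combination h00, by linear_combination h10⟩
    · rintro ⟨h20, h21, h22, h00, h10⟩
      rw [h22]
      refine ⟨⟨h20, h21, by linear_combination h00, by linear_combination -h00,
        by linear_combination h10, by linear_combination h10⟩, ?_⟩
      simp [h20, h21]

/-- Along a slice through the identity, each equation of an orthogonal group is a coordinate plus at
most three quadratic terms, and the latter do not affect the derivative at zero. -/
theorem hasFDerivAt_add_quadratic {n : ℕ} (i : Fin n) (a b : Fin 3 → Fin n) (c : Fin 3 → ℝ) :
    HasFDerivAt (fun w : Fin n → ℝ => w i + ∑ m, c m * (w (a m) * w (b m)))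
      (ContinuousLinearMap.proj (R := ℝ) (φ := fun _ : Fin n => ℝ) i) 0 := by
  have h : ∀ m, HasFDerivAt (fun w : Fin n → ℝ => c m * (w (a m) * w (b m)))
      (0 : (Fin n → ℝ) →L[ℝ] ℝ) 0 := by
    intro m
    simpa using ((hasFDerivAt_apply (𝕜 := ℝ) (a m) (0 : Fin n → ℝ)).mul
      (hasFDerivAt_apply (𝕜 := ℝ) (b m) (0 : Fin n → ℝ))).const_mul (c m)
  have h1 := HasFDerivAt.fun_sum (u := Finset.univ) fun m _ => h m
  simpa using (hasFDerivAt_apply (𝕜 := ℝ) i (0 : Fin n → ℝ)).fun_add h1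

theorem isSubmanifoldAt_aut_simple {ε : ℝ} (hε : ε * ε = 1) (t : BianchiClass)
    (ht : t.mat = Matrix.diagonal ![1, 1, ε]) (ht' : t.covec = 0) :
    IsSubmanifoldAt ℝ (matrixSet t.aut) 3 idMat := by
  have hε0 : ε ≠ 0 := left_ne_zero_of_mul_eq_one hε
  -- The slice consists of upper triangular matrices `X`, scaled so that the derivative `X S + S Xᵀ`
  -- of `g S gᵀ` has upper triangle `w`; here `ε² = 1` is used.
  have hs : IsLinearMap ℝ fun w : Fin 6 → ℝ => (![![w 0 / 2, w 1, ε * w 2],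
      ![0, w 3 / 2, ε * w 4], ![0, 0, ε * w 5 / 2]] : Fin 3 → Fin 3 → ℝ) := by
    refine ⟨fun x y => ?_, fun c x => ?_⟩ <;> ext i k <;> fin_cases i <;> fin_cases k <;>
      simp <;> ring
  refine .of_regular (F := Fin 6 → ℝ) (fun y => ![y 0 0 ^ 2 + y 0 1 ^ 2 + ε * y 0 2 ^ 2 - 1,
    y 0 0 * y 1 0 + y 0 1 * y 1 1 + ε * (y 0 2 * y 1 2),
    y 0 0 * y 2 0 + y 0 1 * y 2 1 + ε * (y 0 2 * y 2 2),
    y 1 0 ^ 2 + y 1 1 ^ 2 + ε * y 1 2 ^ 2 - 1,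
    y 1 0 * y 2 0 + y 1 1 * y 2 1 + ε * (y 1 2 * y 2 2),
    y 2 0 ^ 2 + y 2 1 ^ 2 + ε * y 2 2 ^ 2 - ε]) ?_ (hs.mk' _) ?_ ?_ ?_
  · refine contDiff_pi.2 fun i => ?_
    fin_cases i <;> simp <;> fun_prop
  · refine hasFDerivAt_pi'.2 fun i => ?_
    rw [ContinuousLinearMap.comp_id]
    have h := hasFDerivAt_add_quadratic (n := 6) i
      (![![0, 1, 2], ![1, 2, 0], ![2, 0, 0], ![3, 4, 0], ![4, 0, 0], ![5, 0, 0]] i)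
      (![![0, 1, 2], ![3, 4, 0], ![5, 0, 0], ![3, 4, 0], ![5, 0, 0], ![5, 0, 0]] i)
      (![![1 / 4, 1, ε], ![1 / 2, ε, 0], ![ε / 2, 0, 0], ![1 / 4, ε, 0], ![ε / 2, 0, 0],
        ![ε / 4, 0, 0]] i)
    refine h.congr_of_eventuallyEq (.of_forall fun w => ?_)
    rcases mul_self_eq_one_iff.1 hε with rfl | rfl <;> fin_cases i <;>
      simp [idMat, Fin.sum_univ_three] <;> ring
  · filter_upwards [eventually_det_pos] with y hy
    rw [mem_matrixSet_aut_iff _ hy.ne', ht, ht', and_iff_left (Matrix.mulVec_zero _)]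
    -- An isometry has determinant `1` or `-1`, and the determinant is positive near the identity,
    -- so the condition on it can be dropped.
    have h1 : Matrix.of y * Matrix.diagonal ![1, 1, ε] * (Matrix.of y)ᵀ =
        (Matrix.of y).det • Matrix.diagonal ![1, 1, ε] ↔
        Matrix.of y * Matrix.diagonal ![1, 1, ε] * (Matrix.of y)ᵀ = Matrix.diagonal ![1, 1, ε] := by
      have hd : (Matrix.diagonal ![1, 1, ε]).det ≠ 0 := by
        simp [Matrix.det_diagonal, Fin.prod_univ_three, hε0]
      refine (mem_aut_simple_iff hd (Matrix.GeneralLinearGroup.mkOfDetNeZero _ hy.ne')).trans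
        (and_iff_left_of_imp fun h => ?_)
      have h2 := congrArg Matrix.det h
      rw [Matrix.det_mul, Matrix.det_mul, Matrix.det_transpose] at h2
      have h3 : (Matrix.of y).det ^ 2 = 1 ^ 2 := by
        apply mul_right_cancel₀ hd
        rw [one_pow, one_mul]
        change (Matrix.of y).det * _ * (Matrix.of y).det = _ at h2
        linear_combination h2
      exact (sq_eq_sq_iff_eq_or_eq_neg.1 h3).resolve_right (by linarith)
    have h2 : ∀ i k, (Matrix.of y * Matrix.diagonal ![1, 1, ε] * (Matrix.of y)ᵀ) i k =
        y i 0 * y k 0 + y i 1 * y k 1 + ε * (y i 2 * y k 2) := by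
      intro i k
      rw [Matrix.mul_apply]
      simp [Matrix.mul_diagonal, Fin.sum_univ_three]
      ring
    rw [h1, ← Matrix.ext_iff]
    simp only [h2]
    constructor
    · intro h
      ext i
      have h00 := h 0 0
      have h01 := h 0 1
      have h02 := h 0 2
      have h11 := h 1 1
      have h12 := h 1 2
      have h22 := h 2 2
      simp at h00 h01 h02 h11 h12 h22
      fin_cases i
      · exact sub_eq_zero.2 (by linear_combination h00)
      · exact h01
      · exact h02
      · exact sub_eq_zero.2 (by linear_combination h11)
      · exact h12
      · exact sub_eq_zero.2 (by linear_combination h22)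
    · intro h
      simp [funext_iff, Fin.forall_fin_succ] at h
      obtain ⟨h00, h01, h02, h11, h12, h22⟩ := h
      intro i k
      fin_cases i <;> fin_cases k <;> simp
      · linear_combination h00
      · exact h01
      · exact h02
      · linear_combination h01
      · linear_combination h11
      · exact h12
      · linear_combination h02
      · linear_combination h12
      · linear_combination h22
  · rw [finrank_mat, Module.finrank_fin_fun]

theorem isSubmanifoldOfDim_aut (t : BianchiClass) :
    IsSubmanifoldOfDim ℝ (matrixSet t.aut) (9 - t.orbitDim) := by
  apply isSubmanifoldOfDim_matrixSet
  cases t with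
  | I => exact isSubmanifoldAt_aut_I
  | II => exact isSubmanifoldAt_aut_II
  | IV => exact isSubmanifoldAt_aut_IV
  | V => exact isSubmanifoldAt_aut_V
  | VI h hh => exact isSubmanifoldAt_aut_planar (by norm_num) _ rfl rfl
  | VII h hh => exact isSubmanifoldAt_aut_planar one_ne_zero _ rfl rfl
  | VIII => exact isSubmanifoldAt_aut_simple (by norm_num) _ rfl vec_three_zero
  | IX => exact isSubmanifoldAt_aut_simple (by norm_num) _ rfl vec_three_zero

/-! ### Irreducibility of `Λ³V* ⊗ S²V` -/

section Irreducible

variable {𝕜 : Type} [RCLike 𝕜]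

/-- A space of matrices that is invariant under congruences and contains a nonzero symmetric matrix
contains all symmetric matrices. -/
theorem mem_of_conj_invariant (P : Submodule 𝕜 (Matrix (Fin 3) (Fin 3) 𝕜))
    (hP : ∀ M : Matrix (Fin 3) (Fin 3) 𝕜, M.det ≠ 0 → ∀ A ∈ P, M * A * Mᵀ ∈ P)
    {A : Matrix (Fin 3) (Fin 3) 𝕜} (hA : A.IsSymm) (hA0 : A ≠ 0) (hAP : A ∈ P)
    {B : Matrix (Fin 3) (Fin 3) 𝕜} (hB : B.IsSymm) : B ∈ P := by
  have hinv : ∀ M C : Matrix (Fin 3) (Fin 3) 𝕜, M.det ≠ 0 → M⁻¹ * (M * C * Mᵀ) * M⁻¹ᵀ = C := by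
    intro M C hM
    have h1 : M⁻¹ * M = 1 := Matrix.nonsing_inv_mul M (isUnit_iff_ne_zero.2 hM)
    calc _ = (M⁻¹ * M) * C * (M⁻¹ * M)ᵀ := by simp only [Matrix.transpose_mul, Matrix.mul_assoc]
      _ = C := by rw [h1, Matrix.transpose_one, Matrix.one_mul, Matrix.mul_one]
  obtain ⟨M, d, hM, hd⟩ := exists_conj_diagonal hA
  have hdP : Matrix.diagonal d ∈ P := hd ▸ hP M hM A hAP
  obtain ⟨i, hi⟩ : ∃ i, d i ≠ 0 := by
    by_contra! h
    apply hA0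
    rw [← hinv M A hM, hd, show d = 0 from funext h]
    simp
  have hE : Matrix.diagonal (Pi.single i (1 : 𝕜)) ∈ P := by
    -- Doubling the `i`-th basis vector multiplies `d i` by four and fixes the other entries, so the
    -- difference isolates `3 d i` at the place `i`.
    set r : Fin 3 → 𝕜 := 1 + Pi.single i 1 with hr
    have h2 : (Matrix.diagonal r).det ≠ 0 := by
      rw [Matrix.det_diagonal]
      refine Finset.prod_ne_zero_iff.2 fun k _ => ?_
      rcases eq_or_ne k i with rfl | hk
      · simp [hr]
      · simp [hr, hk]
    have h3 := P.smul_mem (3 * d i)⁻¹ (P.sub_mem (hP _ h2 _ hdP) hdP)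
    convert h3 using 1
    rw [Matrix.diagonal_transpose, Matrix.diagonal_mul_diagonal, Matrix.diagonal_mul_diagonal,
      Matrix.diagonal_sub, ← Matrix.diagonal_smul]
    congr 1
    ext k
    rcases eq_or_ne k i with rfl | hk
    · simp [hr]
      field_simp
      norm_num
    · simp [hr, hk]
  have hE' : ∀ k, Matrix.diagonal (Pi.single k (1 : 𝕜)) ∈ P := by
    intro k
    have h := hP _ (det_perm_ne_zero (Equiv.swap i k)) _ hE
    rw [perm_conj_diagonal] at h
    convert h using 2
    ext m
    simp [Pi.single_apply, Equiv.swap_apply_eq_iff]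
  -- Permutations have produced all diagonal matrix units, hence all diagonal matrices; every
  -- symmetric matrix is congruent to one of them.
  obtain ⟨N, e, hN, he⟩ := exists_conj_diagonal hB
  have heP : Matrix.diagonal e ∈ P := by
    have : Matrix.diagonal e = ∑ k, e k • Matrix.diagonal (Pi.single k (1 : 𝕜)) := by
      ext a b
      simp [Matrix.sum_apply, Matrix.diagonal_apply, Pi.single_apply]
    rw [this]
    exact P.sum_mem fun k _ => P.smul_mem _ (hE' k)
  have hN' : (N⁻¹).det ≠ 0 := by
    rw [Matrix.det_nonsing_inv, Ring.inverse_eq_inv']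
    exact inv_ne_zero hN
  rw [← hinv N B hN, he]
  exact hP _ hN' _ heP

variable (𝕜) in
/-- The coefficient matrix `M(e₁, e₂, e₃)(λⁱ, λᵏ)`. -/
noncomputable def coeffMatrix : W' 𝕜 →ₗ[𝕜] Matrix (Fin 3) (Fin 3) 𝕜 where
  toFun M := Matrix.of fun i k => (M (Pi.basisFun 𝕜 (Fin 3))).1.val
    (LinearMap.proj i) (LinearMap.proj k)
  map_add' _ _ := rfl
  map_smul' _ _ := rfl

theorem coeffMatrix_isSymm (M : W' 𝕜) : (coeffMatrix 𝕜 M).IsSymm :=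
  Matrix.IsSymm.ext fun _ _ => (M _).2 _ _

/-- The value of a symmetric form at two covectors. -/
noncomputable def evalForm (α β : Module.Dual 𝕜 (V 𝕜)) : symForms 𝕜 →ₗ[𝕜] 𝕜 where
  toFun f := f.1.val α β
  map_add' _ _ := rfl
  map_smul' _ _ := rfl

theorem dual_eq_sum (α : Module.Dual 𝕜 (V 𝕜)) :
    α = ∑ i, α (Pi.single i 1) • (LinearMap.proj i : Module.Dual 𝕜 (V 𝕜)) := by
  refine LinearMap.pi_ext' fun i => LinearMap.ext_ring ?_
  simp [Pi.single_apply]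

theorem val_eq_sum (f : DualForms 𝕜) (α β : Module.Dual 𝕜 (V 𝕜)) :
    f.val α β = ∑ i, ∑ k, α (Pi.single i 1) * f.val (LinearMap.proj i) (LinearMap.proj k) *
      β (Pi.single k 1) := by
  conv_lhs => rw [dual_eq_sum α, dual_eq_sum β]
  simp only [map_sum, map_smul, LinearMap.sum_apply, LinearMap.smul_apply, smul_eq_mul,
    Finset.mul_sum, mul_assoc]
  rw [Finset.sum_comm]
  refine Finset.sum_congr rfl fun i _ => Finset.sum_congr rfl fun k _ => ?_
  ring

/-- An alternating form of top degree is the determinant times its value on the basis, so the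
coefficient matrix determines the element. -/
theorem W'_apply_eq (M : W' 𝕜) (v : Fin 3 → V 𝕜) (α β : Module.Dual 𝕜 (V 𝕜)) :
    (M v).1.val α β = (Matrix.of v).det *
      ∑ i, ∑ k, α (Pi.single i 1) * coeffMatrix 𝕜 M i k * β (Pi.single k 1) := by
  have h := congrArg (fun f : V 𝕜 [⋀^Fin 3]→ₗ[𝕜] 𝕜 => f v)
    (((evalForm α β).compAlternatingMap M).eq_smul_basis_det (Pi.basisFun 𝕜 (Fin 3)))
  rw [Pi.basisFun_det] at h
  refine h.trans ((mul_comm _ _).trans ?_)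
  exact congrArg₂ (· * ·) rfl (val_eq_sum _ α β)

theorem coeffMatrix_injective : Function.Injective (coeffMatrix 𝕜) := by
  intro M N h
  refine ext_W' fun v α β => ?_
  rw [W'_apply_eq, W'_apply_eq, h]

/-- The same transformation law as for the matrix of a bracket in `smul_T`. -/
theorem coeffMatrix_rep (g : GL (Fin 3) 𝕜) (M : W' 𝕜) : coeffMatrix 𝕜 (repW' 𝕜 g M) =
    (g : Matrix (Fin 3) (Fin 3) 𝕜).det⁻¹ • ((g : Matrix (Fin 3) (Fin 3) 𝕜) * coeffMatrix 𝕜 M *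
      (g : Matrix (Fin 3) (Fin 3) 𝕜)ᵀ) := by
  ext i k
  refine (actW'_apply g M _ _ _).trans ?_
  rw [W'_apply_eq]
  have h1 : (Matrix.of fun i => ((g⁻¹ : GL (Fin 3) 𝕜) : Matrix (Fin 3) (Fin 3) 𝕜) *ᵥ
      Pi.basisFun 𝕜 (Fin 3) i).det = (g : Matrix (Fin 3) (Fin 3) 𝕜).det⁻¹ := by
    have e : (Matrix.of fun i => ((g⁻¹ : GL (Fin 3) 𝕜) : Matrix (Fin 3) (Fin 3) 𝕜) *ᵥ
        Pi.basisFun 𝕜 (Fin 3) i) = ((g⁻¹ : GL (Fin 3) 𝕜) : Matrix (Fin 3) (Fin 3) 𝕜)ᵀ := by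
      ext a b
      simp
    rw [e, Matrix.det_transpose]
    apply eq_inv_of_mul_eq_one_left
    rw [← Matrix.det_mul, inv_mul_GL, Matrix.det_one]
  rw [h1]
  have h2 : ∀ a b, dualPull g (LinearMap.proj a) (Pi.single b 1) =
      (g : Matrix (Fin 3) (Fin 3) 𝕜) a b := by
    intro a b
    simp [dualPull]
  simp only [h2, Matrix.smul_apply, smul_eq_mul]
  congr 1
  rw [Matrix.mul_apply, Finset.sum_comm]
  simp only [Matrix.mul_apply, Matrix.transpose_apply, Finset.sum_mul]

theorem exists_W'_ne_zero : ∃ M : W' 𝕜, M ≠ 0 := by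
  let f : symForms 𝕜 := ⟨LinearMap.mk₂ 𝕜 (fun α β : Module.Dual 𝕜 (V 𝕜) =>
    α (Pi.single 0 1) * β (Pi.single 0 1))
    (fun _ _ _ => by simp [add_mul]) (fun _ _ _ => by simp [mul_assoc])
    (fun _ _ _ => by simp [mul_add]) (fun _ _ _ => by simp [mul_left_comm]),
    fun α β => mul_comm _ _⟩
  refine ⟨(LinearMap.toSpanSingleton 𝕜 (symForms 𝕜) f).compAlternatingMap
    Matrix.detRowAlternating, fun h => ?_⟩
  have h1 := congrArg (fun M : W' 𝕜 =>
    (M (1 : Matrix (Fin 3) (Fin 3) 𝕜)).1.val (LinearMap.proj 0) (LinearMap.proj 0)) h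
  have h2 : ((Matrix.det (1 : Matrix (Fin 3) (Fin 3) 𝕜)) • f).1.val
      (LinearMap.proj 0) (LinearMap.proj 0) = 0 := h1
  rw [Matrix.det_one, one_smul] at h2
  have h3 : (Pi.single 0 1 : V 𝕜) 0 * (Pi.single 0 1 : V 𝕜) 0 = 0 := h2
  simp at h3

/-- A linear subspace absorbs the factor `det g⁻¹`, so the coefficient matrices of a
subrepresentation are stable under plain congruence and `mem_of_conj_invariant` applies. -/
theorem repW'_isIrreducible : (repW' 𝕜).IsIrreducible := by
  obtain ⟨M₀, hM₀⟩ := exists_W'_ne_zero (𝕜 := 𝕜)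
  have hbt : (⊥ : Subrepresentation (repW' 𝕜)) ≠ ⊤ := by
    intro h
    have h' := congrArg Subrepresentation.toSubmodule h
    have h2 : M₀ ∈ (⊤ : Submodule 𝕜 (W' 𝕜)) := Submodule.mem_top
    exact hM₀ ((Submodule.mem_bot 𝕜).1 (h'.ge h2))
  refine { exists_pair_ne := ⟨_, _, hbt⟩, eq_bot_or_eq_top := fun U => ?_ }
  by_cases hU : U.toSubmodule = ⊥
  · left
    exact Subrepresentation.toSubmodule_injective hU
  · right
    apply Subrepresentation.toSubmodule_injective
    obtain ⟨M, hMU, hM⟩ := Submodule.exists_mem_ne_zero_of_ne_bot hU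
    refine eq_top_iff.2 fun N _ => ?_
    have hN := mem_of_conj_invariant (U.toSubmodule.map (coeffMatrix 𝕜)) ?_ (coeffMatrix_isSymm M)
      (fun h => hM (coeffMatrix_injective (h.trans (map_zero _).symm)))
      (Submodule.mem_map_of_mem hMU) (coeffMatrix_isSymm N)
    · obtain ⟨N', hN', e⟩ := hN
      exact coeffMatrix_injective e ▸ hN'
    · rintro g hg _ ⟨M', hM', rfl⟩
      have h := Submodule.mem_map_of_mem (f := coeffMatrix 𝕜)
        (U.apply_mem_toSubmodule (Matrix.GeneralLinearGroup.mkOfDetNeZero g hg) hM')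
      rw [coeffMatrix_rep] at h
      have h2 := Submodule.smul_mem _ g.det h
      rw [smul_smul] at h2
      have e : (Matrix.GeneralLinearGroup.mkOfDetNeZero g hg : Matrix (Fin 3) (Fin 3) 𝕜) = g := rfl
      rw [e, mul_inv_cancel₀ hg, one_smul] at h2
      exact h2

end Irreducible

/-! ### The unimodular orbits over the complex numbers -/

theorem orbit_T_conj_zero {𝕜 : Type} [RCLike 𝕜] {A M : Matrix (Fin 3) (Fin 3) 𝕜} (hM : M.det ≠ 0) :
    MulAction.orbit (GL (Fin 3) 𝕜) (T A 0) = MulAction.orbit (GL (Fin 3) 𝕜) (T (M * A * Mᵀ) 0) := by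
  rw [orbit_T_eq (B := M.det⁻¹ • (M * A * Mᵀ)) (μ := 0) hM _ (Matrix.mulVec_zero _),
    orbit_T_smul _ _ hM, smul_smul, mul_inv_cancel₀ hM, one_smul, smul_zero]
  rw [smul_smul, mul_inv_cancel₀ hM, one_smul]

theorem j_zero {𝕜 : Type} [RCLike 𝕜] : j (0 : V 𝕜) = 0 := by
  refine ext_br fun a b => ?_
  rw [j, br_mkW]
  simp [br]

theorem complexRep_eq (r : Fin 4) :
    complexRep r = T (Matrix.diagonal fun i : Fin 3 => if (i : ℕ) < r then 1 else 0) 0 := by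
  rw [T_def, j_zero, add_zero, complexRep]

/-- The orbit of a diagonal bracket is determined by the number of nonzero entries. -/
theorem orbit_diagonal {d : Fin 3 → ℂ} {r : Fin 4} (hd : ∀ i, d i ≠ 0 ↔ (i : ℕ) < r) :
    MulAction.orbit (GL (Fin 3) ℂ) (T (Matrix.diagonal d) 0) = complexOrbit r := by
  have h : ∀ i, ∃ z : ℂ, z ≠ 0 ∧ z * d i * z = if (i : ℕ) < r then 1 else 0 := by
    intro i
    by_cases hi : d i = 0
    · refine ⟨1, one_ne_zero, ?_⟩
      rw [if_neg (fun h => (hd i).2 h hi), hi]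
      ring
    -- A square root of `(d i)⁻¹` scales the entry to one; this is where algebraic closedness
    -- removes the signs.
    · obtain ⟨z, hz⟩ := IsAlgClosed.exists_eq_mul_self (d i)⁻¹
      refine ⟨z, ?_, ?_⟩
      · rintro rfl
        rw [mul_zero] at hz
        exact inv_ne_zero hi hz
      · rw [if_pos ((hd i).1 hi)]
        calc z * d i * z = (z * z) * d i := by ring
          _ = 1 := by rw [← hz, inv_mul_cancel₀ hi]
  choose z hz hzd using h
  rw [orbit_T_conj_zero (M := Matrix.diagonal z) (by
    rw [Matrix.det_diagonal]
    exact Finset.prod_ne_zero_iff.2 fun i _ => hz i), complexOrbit, complexRep_eq,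
    Matrix.diagonal_transpose, Matrix.diagonal_mul_diagonal, Matrix.diagonal_mul_diagonal]
  simp only [hzd]

theorem exists_perm_lt (b : Fin 3 → Bool) :
    ∃ (σ : Equiv.Perm (Fin 3)) (r : Fin 4), ∀ i, b (σ i) = true ↔ (i : ℕ) < r := by
  revert b
  decide

theorem exists_mem_complexOrbit {C : W ℂ} (hC : cov C = 0) : ∃ r, C ∈ complexOrbit r := by
  obtain ⟨M, d, hM, hd⟩ := exists_conj_diagonal (mat_isSymm C)
  obtain ⟨σ, r, hr⟩ := exists_perm_lt fun i => decide (d i ≠ 0)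
  refine ⟨r, ?_⟩
  rw [← orbit_diagonal (d := d ∘ σ) (r := r) (fun i => by simpa using hr i), ← perm_conj_diagonal,
    ← orbit_T_conj_zero (det_perm_ne_zero σ), ← hd, ← orbit_T_conj_zero hM]
  have : T (mat C) 0 = C := by
    rw [← hC, T_mat_cov]
  rw [this]
  exact MulAction.mem_orbit_self C

/-- Symmetric matrices of rank at most `r`, by the vanishing of their minors. -/
def rankCond : Fin 4 → Matrix (Fin 3) (Fin 3) ℂ → Prop :=
  ![fun A => A = 0, fun A => A.adjugate = 0, fun A => A.det = 0, fun _ => True]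

/-- The unimodular brackets of rank at most `r`. -/
def rankLE (r : Fin 4) : Set (W ℂ) := {C | rankCond r (mat C) ∧ cov C = 0}

theorem isClosed_rankLE (r : Fin 4) : IsClosed (rankLE r) := by
  have hm : Continuous (mat : W ℂ → _) := continuous_mat
  refine IsClosed.inter ?_ (isClosed_eq continuous_cov continuous_const)
  fin_cases r
  · exact isClosed_eq hm continuous_const
  · exact isClosed_eq hm.matrix_adjugate continuous_const
  · exact isClosed_eq hm.matrix_det continuous_const
  · exact isClosed_univ

theorem smul_mem_rankLE {r : Fin 4} (g : GL (Fin 3) ℂ) {C : W ℂ} (h : C ∈ rankLE r) :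
    g • C ∈ rankLE r := by
  obtain ⟨h1, h2⟩ := h
  refine ⟨?_, by rw [cov_smul, h2, Matrix.mulVec_zero]⟩
  rw [mat_smul]
  fin_cases r
  · change mat C = 0 at h1
    change _ • _ = _
    rw [h1]
    simp
  · change (mat C).adjugate = 0 at h1
    change (_ • _ : Matrix (Fin 3) (Fin 3) ℂ).adjugate = 0
    rw [adjugate_conj, h1]
    simp
  · change (mat C).det = 0 at h1
    change (_ • _ : Matrix (Fin 3) (Fin 3) ℂ).det = 0
    rw [Matrix.det_smul, Matrix.det_mul, Matrix.det_mul, h1]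
    simp
  · trivial

theorem complexRep_mem_rankLE_iff (s r : Fin 4) : complexRep s ∈ rankLE r ↔ s ≤ r := by
  rw [rankLE, Set.mem_ofPred_eq, complexRep_eq, mat_T (Matrix.isSymm_diagonal _),
    cov_T (Matrix.isSymm_diagonal _), diagonal_fin_three]
  fin_cases s <;> fin_cases r <;>
    simp [rankCond, Matrix.adjugate_fin_three, Matrix.det_fin_three, ← Matrix.ext_iff,
      Fin.forall_fin_succ]

theorem complexOrbit_subset_rankLE_iff {s r : Fin 4} : complexOrbit s ⊆ rankLE r ↔ s ≤ r := by
  rw [← complexRep_mem_rankLE_iff]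
  refine ⟨fun h => h (MulAction.mem_orbit_self _), fun h => ?_⟩
  rintro _ ⟨g, rfl⟩
  exact smul_mem_rankLE g h

theorem mem_rankLE_iff {C : W ℂ} {r : Fin 4} : C ∈ rankLE r ↔ ∃ s ≤ r, C ∈ complexOrbit s := by
  constructor
  · intro h
    obtain ⟨s, hs⟩ := exists_mem_complexOrbit h.2
    refine ⟨s, ?_, hs⟩
    obtain ⟨g, rfl⟩ := hs
    have := smul_mem_rankLE g⁻¹ h
    rwa [inv_smul_smul, complexRep_mem_rankLE_iff] at this
  · rintro ⟨s, hs, h⟩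
    exact complexOrbit_subset_rankLE_iff.2 hs h

theorem complexRep_mem_closure {s r : Fin 4} (h : s ≤ r) :
    complexRep s ∈ closure (complexOrbit r) := by
  -- A diagonal form of rank `r` for `z ≠ 0`, whose entries beyond the first `s` vanish at `z = 0`.
  set d : ℂ → Fin 3 → ℂ := fun z i => if (i : ℕ) < s then 1 else if (i : ℕ) < r then z else 0
    with hd
  have hc : ∀ i, Continuous fun z => d z i := by
    intro i
    simp only [hd]
    split_ifs <;> fun_prop
  have e : ∀ z, sym (diagW (d z 0) (d z 1) (d z 2)) = Matrix.diagonal (d z) := fun z => by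
    rw [sym_diagW, diagonal_fin_three]
  have key := mem_closure_of_curve (S := complexOrbit r)
    (w := fun z => diagW (d z 0) (d z 1) (d z 2)) (ν := fun _ => 0)
    (continuous_diagW (hc 0) (hc 1) (hc 2)) continuous_const (fun z hz => ?_)
  · rw [e] at key
    rw [complexRep_eq]
    convert key using 4 with i
    simp [hd]
  · rw [e, ← orbit_diagonal (d := d z) (r := r)]
    · exact MulAction.mem_orbit_self _
    · intro i
      have h' : (s : ℕ) ≤ r := h
      simp only [hd]
      split_ifs with h1 h2
      · simpa using lt_of_lt_of_le h1 h'
      · simpa [h2] using hz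
      · simpa using not_lt.1 h2

theorem closure_complexOrbit (r : Fin 4) : closure (complexOrbit r) = rankLE r := by
  refine (closure_minimal (complexOrbit_subset_rankLE_iff.2 le_rfl) (isClosed_rankLE r)).antisymm ?_
  intro C hC
  obtain ⟨s, hs, hC⟩ := mem_rankLE_iff.1 hC
  exact orbit_subset_closure (fun g C hC => MulAction.mem_orbit_of_mem_orbit g hC)
    (complexRep_mem_closure hs) hC

theorem complexOrbit_subset_closure_iff (s r : Fin 4) :
    complexOrbit s ⊆ closure (complexOrbit r) ↔ s ≤ r := by
  rw [closure_complexOrbit, complexOrbit_subset_rankLE_iff]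

theorem closure_complexOrbit_eq_iUnion (r : Fin 4) :
    closure (complexOrbit r) = ⋃ (s : Fin 4) (_ : s ≤ r), complexOrbit s := by
  ext C
  simp only [closure_complexOrbit, mem_rankLE_iff, Set.mem_iUnion, exists_prop]

theorem rankLE_three : rankLE 3 = (unimodular ℂ : Set (W ℂ)) := by
  ext C
  rw [SetLike.mem_coe, mem_unimodular_iff]
  exact and_iff_right trivial

theorem closure_complexOrbit_three : closure (complexOrbit 3) = (unimodular ℂ : Set (W ℂ)) := by
  rw [closure_complexOrbit, rankLE_three]

/-- The orbit consists of the forms of rank exactly `r`, so it is the part of a closed set where the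
rank exceeds `q`, an open condition. -/
theorem complexOrbit_eq_sdiff {q r : Fin 4} (h : (q : ℕ) + 1 = r) :
    complexOrbit r = (rankLE q)ᶜ ∩ rankLE r := by
  ext C
  constructor
  · intro hC
    refine ⟨fun hq => ?_, complexOrbit_subset_rankLE_iff.2 le_rfl hC⟩
    obtain ⟨g, rfl⟩ := hC
    have := smul_mem_rankLE g⁻¹ hq
    rw [inv_smul_smul, complexRep_mem_rankLE_iff] at this
    omega
  · rintro ⟨h1, h2⟩
    obtain ⟨s, hs, hC⟩ := mem_rankLE_iff.1 h2
    have hsq : ¬ s ≤ q := fun h => h1 (complexOrbit_subset_rankLE_iff.2 h hC)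
    obtain rfl : s = r := by omega
    exact hC

theorem isOpenIn_complexOrbit_three : IsOpenIn (complexOrbit 3) (unimodular ℂ : Set (W ℂ)) :=
  ⟨(rankLE 2)ᶜ, (isClosed_rankLE 2).isOpen_compl, by
    rw [complexOrbit_eq_sdiff (q := 2) rfl, rankLE_three]⟩

theorem eventually_mem_complexOrbit_iff (r : Fin 4) :
    ∀ᶠ C in nhds (complexRep r), C ∈ complexOrbit r ↔ rankCond r (mat C) ∧ cov C = 0 := by
  rcases Nat.eq_zero_or_pos (r : ℕ) with h | h
  · refine .of_forall fun C => ?_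
    change _ ↔ C ∈ rankLE r
    rw [mem_rankLE_iff]
    refine ⟨fun hC => ⟨r, le_rfl, hC⟩, ?_⟩
    rintro ⟨s, hs, hC⟩
    obtain rfl : s = r := by omega
    exact hC
  · have hq : ((⟨r - 1, by omega⟩ : Fin 4) : ℕ) + 1 = r := by
      change (r : ℕ) - 1 + 1 = r
      omega
    have hm : complexRep r ∈ (rankLE ⟨r - 1, by omega⟩)ᶜ := by
      have := MulAction.mem_orbit_self (M := GL (Fin 3) ℂ) (complexRep r)
      change _ ∈ complexOrbit r at this
      rw [complexOrbit_eq_sdiff hq] at this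
      exact this.1
    filter_upwards [(isClosed_rankLE _).isOpen_compl.mem_nhds hm] with C hC
    rw [complexOrbit_eq_sdiff hq]
    exact and_iff_right hC

theorem isSubmanifoldOfDim_complexOrbit (r : Fin 4) :
    IsSubmanifoldOfDim ℂ (complexOrbit r) (![0, 3, 5, 6] r) := by
  have hB := eventually_mem_complexOrbit_iff r
  suffices h : IsSubmanifoldAt ℂ (complexOrbit r) (![0, 3, 5, 6] r) (complexRep r) from
    fun x hx => h.of_mem_orbit (fun g C hC => MulAction.mem_orbit_of_mem_orbit g hC) hx
  have e : ∀ a b c : ℂ, T (Matrix.diagonal ![a, b, c]) 0 = T (sym (diagW a b c)) 0 := fun a b c => by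
    rw [sym_diagW, diagonal_fin_three]
    rfl
  have e' : complexRep r = T (sym (diagW (if (0 : ℕ) < r then 1 else 0) (if (1 : ℕ) < r then 1 else 0)
      (if (2 : ℕ) < r then 1 else 0))) 0 := by
    rw [complexRep_eq, sym_diagW, diagonal_fin_three]
    rfl
  rw [e'] at hB ⊢
  fin_cases r
  · simp [diagW_zero] at hB ⊢
    exact isSubmanifoldAt_rank_zero hB
  · simp at hB ⊢
    exact isSubmanifoldAt_rank_one hB
  · simp at hB ⊢
    exact isSubmanifoldAt_rank_two one_ne_zero hB
  · simp at hB ⊢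
    exact isSubmanifoldAt_rank_three _ (hB.mono fun C hC => hC.trans (and_iff_right trivial))

end Bianchi

theorem mainTheorem7 :
    -- the stabilizer of a bracket is its automorphism group
    (∀ C : W ℝ, MulAction.stabilizer (GL (Fin 3) ℝ) C = autGroup C) ∧
    (∀ t : BianchiClass, t.rep ∈ lieVariety ℝ) ∧
    -- the automorphism groups of the unimodular classes
    BianchiClass.I.aut = ⊤ ∧
    (∀ g : GL (Fin 3) ℝ, g ∈ BianchiClass.II.aut ↔
      ∃ (g₂ : GL (Fin 2) ℝ) (h : Fin 2 → ℝ), (g : Matrix (Fin 3) (Fin 3) ℝ) =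
        !![(g₂ : Matrix (Fin 2) (Fin 2) ℝ).det, h 0, h 1;
           0, g₂ 0 0, g₂ 0 1;
           0, g₂ 1 0, g₂ 1 1]) ∧
    (∀ g : GL (Fin 3) ℝ, g ∈ BianchiClass.VI₀.aut ↔
      ∃ g₁ ∈ CO mink, ∃ h : Fin 2 → ℝ, (g : Matrix (Fin 3) (Fin 3) ℝ) =
        block (g₁ : Matrix (Fin 2) (Fin 2) ℝ) h
          (((g₁ : Matrix (Fin 2) (Fin 2) ℝ) * mink * (g₁ : Matrix (Fin 2) (Fin 2) ℝ)ᵀ) 0 0 /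
            (g₁ : Matrix (Fin 2) (Fin 2) ℝ).det)) ∧
    (∀ g₁ ∈ CO mink,
      ((g₁ : Matrix (Fin 2) (Fin 2) ℝ) * mink * (g₁ : Matrix (Fin 2) (Fin 2) ℝ)ᵀ) 0 0 /
        (g₁ : Matrix (Fin 2) (Fin 2) ℝ).det ∈ ({-1, 1} : Set ℝ)) ∧
    (∀ g : GL (Fin 3) ℝ, g ∈ BianchiClass.VII₀.aut ↔
      ∃ g₁ ∈ CO 1, ∃ h : Fin 2 → ℝ, (g : Matrix (Fin 3) (Fin 3) ℝ) =
        block (g₁ : Matrix (Fin 2) (Fin 2) ℝ) h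
          (|(g₁ : Matrix (Fin 2) (Fin 2) ℝ).det| / (g₁ : Matrix (Fin 2) (Fin 2) ℝ).det)) ∧
    (∀ g : GL (Fin 3) ℝ, g ∈ BianchiClass.VIII.aut ↔
      (g : Matrix (Fin 3) (Fin 3) ℝ) * Matrix.diagonal ![1, 1, -1] *
          (g : Matrix (Fin 3) (Fin 3) ℝ)ᵀ = Matrix.diagonal ![1, 1, -1] ∧
        (g : Matrix (Fin 3) (Fin 3) ℝ).det = 1) ∧
    (∀ g : GL (Fin 3) ℝ, g ∈ BianchiClass.IX.aut ↔
      (g : Matrix (Fin 3) (Fin 3) ℝ) ∈ Matrix.specialOrthogonalGroup (Fin 3) ℝ) ∧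
    -- the automorphism groups of the other classes
    IsBlockSemidirect BianchiClass.V.aut ⊤ ∧
    (∃ e : BianchiClass.V.aut ≃* ((Fin 2 → ℝ) ≃ᵃ[ℝ] (Fin 2 → ℝ)),
      ∀ (g : BianchiClass.V.aut) (x : Fin 2 → ℝ),
        ((g : GL (Fin 3) ℝ) : Matrix (Fin 3) (Fin 3) ℝ).mulVec ![x 0, x 1, 1] =
          ![e g x 0, e g x 1, 1]) ∧
    (∀ g : GL (Fin 3) ℝ, g ∈ BianchiClass.IV.aut ↔
      ∃ μ h₁ h₂ h₃ : ℝ, μ ≠ 0 ∧ (g : Matrix (Fin 3) (Fin 3) ℝ) =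
        !![μ, h₁, h₂; 0, μ, h₃; 0, 0, 1]) ∧
    (∀ (h : ℝ) (hh : h < 0),
      IsBlockSemidirect (BianchiClass.VI h hh.le).aut (COPlus mink) ∧
      (BianchiClass.VI h hh.le).aut ≤ BianchiClass.VI₀.aut ∧
      (BianchiClass.VI h hh.le).aut.relIndex BianchiClass.VI₀.aut = 2) ∧
    (∀ (h : ℝ) (hh : 0 < h),
      IsBlockSemidirect (BianchiClass.VII h hh.le).aut (COPlus 1) ∧
      (BianchiClass.VII h hh.le).aut ≤ BianchiClass.VII₀.aut ∧
      (BianchiClass.VII h hh.le).aut.relIndex BianchiClass.VII₀.aut = 2) ∧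
    -- the dimensions of the automorphism groups and of the orbits
    (∀ t : BianchiClass,
      IsSubmanifoldOfDim ℝ (matrixSet t.aut) (9 - t.orbitDim) ∧
      IsSubmanifoldOfDim ℝ t.orbit t.orbitDim) ∧
    IsSubmanifoldOfDim ℝ (⋃ (h : ℝ) (hh : 0 < h), (BianchiClass.VII h hh.le).orbit) 6 ∧
    -- irreducibility
    (repW' ℝ).IsIrreducible ∧
    -- the orbits in the unimodular part
    (∀ C : W ℝ, (∀ g : GL (Fin 3) ℝ, g • C = C) ↔ C = 0) ∧
    BianchiClass.I.orbit = {0} ∧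
    (unimodular ℝ : Set (W ℝ)) = BianchiClass.I.orbit ∪ BianchiClass.II.orbit ∪
      BianchiClass.VI₀.orbit ∪ BianchiClass.VII₀.orbit ∪
      BianchiClass.VIII.orbit ∪ BianchiClass.IX.orbit ∧
    (∀ t ∈ ({.I, .II, .VI₀, .VII₀, .VIII, .IX} : Set BianchiClass),
      ∀ C ∈ t.orbit, ∀ c : ℝ, c ≠ 0 → c • C ∈ t.orbit) ∧
    (∀ t ∈ ({.VIII, .IX} : Set BianchiClass), IsOpenIn t.orbit (unimodular ℝ : Set (W ℝ))) ∧
    (∀ t ∈ ({.VI₀, .VII₀} : Set BianchiClass), IsOpenIn t.orbit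
      ((unimodular ℝ : Set (W ℝ)) \ (BianchiClass.VIII.orbit ∪ BianchiClass.IX.orbit))) ∧
    -- the closures of the orbits
    (∀ s t : BianchiClass, s.orbit ⊆ closure t.orbit ↔
      s = t ∨ s = .I ∨ (s = .II ∧ t ≠ .I ∧ t ≠ .V) ∨ (s = .V ∧ t = .IV) ∨
      (s = .VI₀ ∧ t = .VIII) ∨ (s = .VII₀ ∧ (t = .VIII ∨ t = .IX))) ∧
    (∀ t : BianchiClass,
      closure t.orbit = ⋃ (s : BianchiClass) (_ : s.orbit ⊆ closure t.orbit), s.orbit) ∧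
    closure BianchiClass.V.orbit = Set.range (j : Bianchi.V ℝ → W ℝ) ∧
    closure (⋃ (h : ℝ) (hh : h < 0), (BianchiClass.VI h hh.le).orbit) =
      (⋃ (h : ℝ) (hh : h ≤ 0), (BianchiClass.VI h hh).orbit) ∪ BianchiClass.IV.orbit ∪
        BianchiClass.V.orbit ∪ BianchiClass.II.orbit ∪ BianchiClass.I.orbit ∧
    closure (⋃ (h : ℝ) (hh : 0 < h), (BianchiClass.VII h hh.le).orbit) =
      (⋃ (h : ℝ) (hh : 0 ≤ h), (BianchiClass.VII h hh).orbit) ∪ BianchiClass.IV.orbit ∪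
        BianchiClass.V.orbit ∪ BianchiClass.II.orbit ∪ BianchiClass.I.orbit ∧
    -- the unimodular orbits over the complex numbers
    (∀ r : Fin 4, IsSubmanifoldOfDim ℂ (complexOrbit r) (![0, 3, 5, 6] r)) ∧
    IsOpenIn (complexOrbit 3) (unimodular ℂ : Set (W ℂ)) ∧
    (∀ s r : Fin 4, complexOrbit s ⊆ closure (complexOrbit r) ↔ s ≤ r) ∧
    (∀ r : Fin 4, closure (complexOrbit r) = ⋃ (s : Fin 4) (_ : s ≤ r), complexOrbit s) ∧
    closure (complexOrbit 3) = (unimodular ℂ : Set (W ℂ)) ∧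
    (repW' ℂ).IsIrreducible := by
  refine ⟨stabilizer_eq_autGroup, rep_mem_lieVariety, mem_aut_I, mem_aut_II_iff, mem_aut_VI₀_iff,
    conf_mink_div_det, mem_aut_VII₀_iff, mem_aut_VIII_iff, mem_aut_IX_iff,
    isBlockSemidirect mem_aut_V_iff, exists_mulEquiv_affineEquiv, mem_aut_IV_iff, ?_, ?_,
    fun t => ⟨isSubmanifoldOfDim_aut t, isSubmanifoldOfDim_orbit t⟩, isSubmanifoldOfDim_iUnion_VII,
    repW'_isIrreducible, forall_smul_eq_iff, orbit_I, unimodular_eq, ?_, isOpenIn_unimodular,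
    isOpenIn_unimodular_diff, ?_, closure_orbit_eq_iUnion, ?_, closure_iUnion_VI,
    closure_iUnion_VII, isSubmanifoldOfDim_complexOrbit, isOpenIn_complexOrbit_three,
    complexOrbit_subset_closure_iff, closure_complexOrbit_eq_iUnion, closure_complexOrbit_three,
    repW'_isIrreducible⟩
  · intro h hh
    exact ⟨isBlockSemidirect (mem_aut_VI_iff hh),
      aut_le_and_relIndex (by norm_num) hh.ne _ _ rfl rfl rfl vec_three_zero⟩
  · intro h hh
    exact ⟨isBlockSemidirect (mem_aut_VII_iff hh),
      aut_le_and_relIndex one_ne_zero hh.ne' _ _ rfl rfl rfl vec_three_zero⟩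
  · intro t _ C hC c hc
    rw [← scalarGL_smul c hc]
    exact smul_mem_orbit t _ C hC
  · intro s t
    rw [closure_orbit]
    exact orbit_subset_Z_iff s t
  · rw [closure_orbit, Z_V_eq]
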